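/- Let $L>0$. Setting. On the fermionic Fock space with annihilation operators $a_n,b_n$ (all anticommuting except $\{a_n,a_m^\dagger\}=\{b_n,b_m^\dagger\}=\delta_{nm}$), where $n$ runs over $\mathbb{Z}$ for periodic (R) and over $\mathbb{Z}+\frac12$ for antiperiodic (NS) boundary conditions, the modes of the massless Dirac field at $t=0$ on the circle of circumference $L$ are $\psi_{1,n}=a_n$, $\psi_{2,n}=b_{-n}^\dagger$ for $n<0$; $\psi_{1,n}=b_{-n}^\dagger$, $\psi_{2,n}=a_n$ for $n>0$; $\psi_{1,0}=\frac{1}{\sqrt2}(a_0+b_0^\dagger)$, $\psi_{2,0}=\frac{\mathrm{i}}{\sqrt2}(a_0-b_0^\dagger)$. For $f=(f_1,f_2)\in\mathcal{H}=L^2([0,L])\oplus L^2([0,L])$ put $\psi(f)=\sum_{a,n}\tilde f_a(n)\,\psi_{a,n}$ with $\tilde f_a(n)=L^{-1/2}\int_0^L f_a(x)\,\mathrm{e}^{2\pi\mathrm{i} n x/L}\,\mathrm{d}x$, so that $\{\psi(f),\psi(g)^\dagger\}=\sum_a\int_0^L f_a g_a^*\,\mathrm{d}x$ and $\{\psi(f),\psi(g)\}=0$.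 A state is a positive normalized linear functional on the C*-algebra generated by all $\psi(f)$; it is pure if it is an extreme point of the set of all states, and mixed otherwise. It is quasi-free if $\omega(\psi(f_1)\cdots\psi(f_n)\psi(g_m)^\dagger\cdots\psi(g_1)^\dagger)=\delta_{nm}\det[\omega(\psi(f_i)\psi(g_j)^\dagger)]$ for all $n,m$. Its energy is $\omega(E)\in[0,\infty]$ with $E=\frac{2\pi}{L}\sum_{n\neq0}|n|(a_n^\dagger a_n+b_n^\dagger b_n)$, and a ground state is a state of lowest energy. (1) For antiperiodic boundary conditions there is a unique quasi-free ground state $\omega_{\mathrm{NS}}$, and for all $f,g\in\mathcal{H}$ $$\omega_{\mathrm{NS}}(\psi(f)\psi(g)^\dagger)=\frac{1}{2\mathrm{i}L}\lim_{\epsilon\to0^+}\int_0^L\!\!\int_0^L\left[\frac{f_1(x)g_1^*(y)}{\sin[\frac{\pi}{L}(x-y-\mathrm{i}\epsilon)]}-\frac{f_2(x)g_2^*(y)}{\sin[\frac{\pi}{L}(x-y+\mathrm{i}\epsilon)]}\right]\mathrm{d}x\,\mathrm{d}y.$$ (2) For periodic boundary conditions the quasi-free ground states are exactly the states $\omega_{\mathrm{R},h}$,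 distinct for distinct $h$, with $$\omega_{\mathrm{R},h}(\psi(f)\psi(g)^\dagger)=\frac{1}{2\mathrm{i}L}\lim_{\epsilon\to0^+}\int_0^L\!\!\int_0^L\left[\frac{f_1(x)g_1^*(y)}{\tan[\frac{\pi}{L}(x-y-\mathrm{i}\epsilon)]}-\frac{f_2(x)g_2^*(y)}{\tan[\frac{\pi}{L}(x-y+\mathrm{i}\epsilon)]}\right]\mathrm{d}x\,\mathrm{d}y+\sum_{a,b=1}^2h_{ab}\int_0^Lf_a(x)\,\mathrm{d}x\int_0^Lg_b^*(y)\,\mathrm{d}y,$$ where $h$ ranges over the matrices $$h=\frac{h_1+h_2}{2}\mathbb{1}+\frac{h_1-h_2}{2}\begin{pmatrix}\cos\psi&\sin\psi\,\mathrm{e}^{\mathrm{i}\phi}\\\sin\psi\,\mathrm{e}^{-\mathrm{i}\phi}&-\cos\psi\end{pmatrix},\quad|h_1|,|h_2|\le\frac{1}{2L},\ \phi\in[0,2\pi),\ \psi\in[0,\pi];$$ these are exactly the Hermitian $2\times2$ matrices whose eigenvalues (namely $h_1,h_2$) lie in $[-\frac{1}{2L},\frac{1}{2L}]$. All $\omega_{\mathrm{R},h}$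 have zero energy. The state $\omega_{\mathrm{R},h}$ is pure if $|h_1|=|h_2|=\frac{1}{2L}$ and mixed otherwise. (3) The thermal states $\mathrm{tr}(\mathrm{e}^{-\beta E}\,\cdot\,)/\mathrm{tr}(\mathrm{e}^{-\beta E})$ for periodic boundary conditions exist for all $\beta>0$ and converge pointwise, as $\beta\to\infty$, to the state with $h_1=h_2=0$. For $m>0$ the periodic Dirac field of mass $m$, with one-particle Hamiltonian $\mathrm{i}\sigma_z\partial_x+m\sigma_y$, has a unique vacuum (state of lowest energy for the normal-ordered massive Hamiltonian), and as $m\to0^+$ these vacua converge pointwise to the state with $\phi=\psi=\frac{\pi}{2}$, $h_2=-h_1=\frac{1}{2L}$. (4) Writing $h=\alpha\mathbb{1}+\vec\beta\cdot\vec\sigma$ with the Pauli matrices $\vec\sigma$, the allowed $h$ correspond bijectively to the points of the double cone $\{(\alpha,\vec\beta)\in\mathbb{R}\times\mathbb{R}^3:|\alpha|+|\vec\beta|\le\frac{1}{2L}\}$. Its extreme points are the tips $(\pm\frac{1}{2L},0)$ and the rim $\{\alpha=0,|\vec\beta|=\frac{1}{2L}\}$, and they correspond exactly to the pure states $\omega_{\mathrm{R},h}$: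 the tips to $h_1=h_2=\pm\frac{1}{2L}$ and the rim to $h_1=-h_2=\pm\frac{1}{2L}$. -/

import Mathlib

open MeasureTheory Filter Topology
open scoped ENNReal ComplexOrder

noncomputable section

namespace DiracCylinder

/-! ### Fermionic Fock space in the occupation-number representation -/

/-- The fermionic Fock space over a set `ι` of one-particle states: square-summable amplitudes on
the occupation configurations, i.e. on the finite subsets of `ι`. -/
abbrev Fock (ι : Type) : Type := lp (fun _ : Finset ι => ℂ) 2

section Annihilation

variable {ι : Type} [LinearOrder ι]

/-- Amplitudes of `c_i v`: the coefficient at `S` is `± v (S ∪ {i})` if `i ∉ S` and `0` otherwise,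
the sign being that of the number of occupied states that precede `i`. -/
def annihilateFun (i : ι) (v : Finset ι → ℂ) (S : Finset ι) : ℂ :=
  if i ∈ S then 0 else (-1) ^ (S.filter (· < i)).card * v (insert i S)

theorem sum_annihilateFun_le (i : ι) (v : Fock ι) (s : Finset (Finset ι)) :
    ∑ S ∈ s, ‖annihilateFun i v S‖ ^ (2 : ℝ≥0∞).toReal ≤ ‖v‖ ^ (2 : ℝ≥0∞).toReal := by
  have h2 : 0 < (2 : ℝ≥0∞).toReal := by norm_num
  have key : ∑ S ∈ s, ‖annihilateFun i v S‖ ^ (2 : ℝ≥0∞).toReal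
      = ∑ T ∈ (s.filter (i ∉ ·)).image (insert i), ‖v T‖ ^ (2 : ℝ≥0∞).toReal := by
    rw [Finset.sum_image, Finset.sum_filter]
    · refine Finset.sum_congr rfl fun S _ => ?_
      by_cases hS : i ∈ S <;> simp [annihilateFun, hS]
    · intro S hS T hT h
      have hS' : i ∉ S := (Finset.mem_filter.1 hS).2
      have hT' : i ∉ T := (Finset.mem_filter.1 hT).2
      rw [← Finset.erase_insert hS', ← Finset.erase_insert hT']
      exact congrArg (fun U => Finset.erase U i) h
  rw [key]
  exact lp.sum_rpow_le_norm_rpow h2 v _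

/-- The annihilation operator `c_i` on Fock space. -/
def annihilate (i : ι) : Fock ι →L[ℂ] Fock ι :=
  LinearMap.mkContinuous
    { toFun := fun v => ⟨annihilateFun i v, memℓp_gen' (sum_annihilateFun_le i v)⟩
      map_add' := fun v w => by
        ext S
        change annihilateFun i (fun T => v T + w T) S
          = annihilateFun i v S + annihilateFun i w S
        by_cases hS : i ∈ S <;> simp [annihilateFun, hS, mul_add]
      map_smul' := fun c v => by
        ext S
        by_cases hS : i ∈ S <;> simp [annihilateFun, hS, mul_left_comm] }
    1
    (fun v => by
      rw [one_mul]
      exact lp.norm_le_of_forall_sum_le (by norm_num) (norm_nonneg v) (sum_annihilateFun_le i v))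

end Annihilation

/-! ### Boundary conditions and modes -/

/-- Periodic (Ramond) and antiperiodic (Neveu--Schwarz) boundary conditions. -/
inductive BC
  | periodic
  | antiperiodic

/-- The mode number belonging to the label `n : ℤ`: it is `n` for periodic and `n + 1/2` for
antiperiodic boundary conditions. The corresponding momentum is `2π/L` times this. -/
def BC.mode : BC → ℤ → ℝ
  | .periodic, n => n
  | .antiperiodic, n => n + 1 / 2

/-- The label of the opposite mode number: `bc.mode (bc.neg n) = - bc.mode n`. -/
def BC.neg : BC → ℤ → ℤ
  | .periodic, n => -n
  | .antiperiodic, n => -n - 1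

/-- Labels of the one-particle states from which Fock space is built: species `0` are the particles
annihilated by `a_n`, species `1` the antiparticles annihilated by `b_n`. -/
abbrev Label : Type := Fin 2 ×ₗ ℤ

/-- The bounded operators on Fock space. -/
abbrev Op : Type := Fock Label →L[ℂ] Fock Label

/-- The annihilation operator of the particle with label `n`. -/
def fockA (n : ℤ) : Op := annihilate (toLex ((0 : Fin 2), n))

/-- The annihilation operator of the antiparticle with label `n`. -/
def fockB (n : ℤ) : Op := annihilate (toLex ((1 : Fin 2), n))

/-- The modes `ψ_{a,n}` of the Dirac field in terms of creation and annihilation operators. The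
chiralities `a = 1, 2` are indexed by `0, 1 : Fin 2`. -/
def fockPsi (bc : BC) (a : Fin 2) (n : ℤ) : Op :=
  if a = 0 then
    if bc.mode n < 0 then fockA n
    else if bc.mode n = 0 then ((1 / √2 : ℝ) : ℂ) • (fockA n + star (fockB n))
    else star (fockB (bc.neg n))
  else
    if bc.mode n < 0 then star (fockB (bc.neg n))
    else if bc.mode n = 0 then (Complex.I * ((1 / √2 : ℝ) : ℂ)) • (fockA n - star (fockB n))
    else fockA n

/-! ### The one-particle space and the smeared field -/

/-- Lebesgue measure on `[0, L]`. -/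
abbrev circleMeasure (L : ℝ) : Measure ℝ := volume.restrict (Set.Icc 0 L)

/-- The one-particle Hilbert space `L²([0, L]) ⊕ L²([0, L])`. -/
abbrev OneParticle (L : ℝ) : Type := PiLp 2 (fun _ : Fin 2 => Lp ℂ 2 (circleMeasure L))

/-- The Fourier coefficient `L^{-1/2} ∫₀ᴸ u(x) e^{2πi p x / L} dx`. -/
def fourierCoefficient (L : ℝ) (p : ℝ) (u : Lp ℂ 2 (circleMeasure L)) : ℂ :=
  ((1 / √L : ℝ) : ℂ) *
    ∫ x in Set.Icc 0 L, u x * Complex.exp (Complex.I * ((2 * Real.pi * p / L * x : ℝ) : ℂ))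

/-- The smeared Dirac field `ψ(f) = ∑_{a,n} f̃_a(n) ψ_{a,n}` at time zero, as an operator on Fock
space. The sum converges in operator norm. -/
def fieldOp (L : ℝ) (bc : BC) (f : OneParticle L) : Op :=
  ∑' q : Fin 2 × ℤ, fourierCoefficient L (bc.mode q.2) (f q.1) • fockPsi bc q.1 q.2

/-- The C*-algebra generated by the smeared fields. -/
def carAlgebra (L : ℝ) (bc : BC) : StarSubalgebra ℂ Op :=
  (StarAlgebra.adjoin ℂ (Set.range (fieldOp L bc))).topologicalClosure

/-- The smeared Dirac field `ψ(f)`, as an element of the algebra that it generates. -/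
def field (L : ℝ) (bc : BC) (f : OneParticle L) : carAlgebra L bc :=
  ⟨fieldOp L bc f, StarSubalgebra.le_topologicalClosure _
    (StarAlgebra.subset_adjoin ℂ _ (Set.mem_range_self f))⟩

/-- The normalized plane wave `x ↦ L^{-1/2} e^{-2πi p x / L}`. -/
def planeWaveFun (L : ℝ) (p : ℝ) (x : ℝ) : ℂ :=
  ((1 / √L : ℝ) : ℂ) * Complex.exp (-Complex.I * ((2 * Real.pi * p / L * x : ℝ) : ℂ))

theorem planeWaveFun_memLp (L p : ℝ) : MemLp (planeWaveFun L p) 2 (circleMeasure L) := by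
  have hc : Continuous (planeWaveFun L p) := by unfold planeWaveFun; fun_prop
  refine MemLp.of_bound hc.aestronglyMeasurable (1 / √L) (Eventually.of_forall fun x => ?_)
  have : ‖Complex.exp (-Complex.I * ((2 * Real.pi * p / L * x : ℝ) : ℂ))‖ = 1 := by
    rw [Complex.norm_exp]; simp
  unfold planeWaveFun
  rw [norm_mul, this, mul_one, Complex.norm_real, Real.norm_of_nonneg (by positivity)]

/-- The plane wave of mode number `p` in the component `a`. -/
def planeWave (L : ℝ) (a : Fin 2) (p : ℝ) : OneParticle L :=
  WithLp.toLp 2 (Pi.single a (planeWaveFun_memLp L p).toLp)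

/-- The field modes `ψ_{a,n} = L^{-1/2} ∫₀ᴸ ψ_a(x) e^{-2πi n x / L} dx`. -/
def psi (L : ℝ) (bc : BC) (a : Fin 2) (n : ℤ) : carAlgebra L bc :=
  field L bc (planeWave L a (bc.mode n))

/-- The operators `a_n`. -/
def modeA (L : ℝ) (bc : BC) (n : ℤ) : carAlgebra L bc :=
  if bc.mode n < 0 then psi L bc 0 n
  else if bc.mode n = 0 then
    ((1 / √2 : ℝ) : ℂ) • (psi L bc 0 n - Complex.I • psi L bc 1 n)
  else psi L bc 1 n

/-- The operators `b_n`. -/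
def modeB (L : ℝ) (bc : BC) (n : ℤ) : carAlgebra L bc :=
  if bc.mode n < 0 then star (psi L bc 0 (bc.neg n))
  else if bc.mode n = 0 then
    ((1 / √2 : ℝ) : ℂ) • (star (psi L bc 0 n) - Complex.I • star (psi L bc 1 n))
  else star (psi L bc 1 (bc.neg n))

/-! ### States -/

/-- Linear functionals on the field algebra. -/
abbrev Functional (L : ℝ) (bc : BC) : Type := carAlgebra L bc →ₗ[ℂ] ℂ

/-- The states: positive normalized linear functionals. -/
def states (L : ℝ) (bc : BC) : Set (Functional L bc) :=
  {ω | ω 1 = 1 ∧ ∀ A : carAlgebra L bc, 0 ≤ ω (star A * A)}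

/-- Pure states are the extreme points of the convex set of all states; the others are mixed. -/
def IsPure {L : ℝ} {bc : BC} (ω : Functional L bc) : Prop :=
  ω ∈ Set.extremePoints ℝ (states L bc)

/-- The two-point function `ω(ψ(f) ψ(g)†)`. -/
def twoPoint {L : ℝ} {bc : BC} (ω : Functional L bc) (f g : OneParticle L) : ℂ :=
  ω (field L bc f * star (field L bc g))

/-- (Gauge-invariant) quasi-free functionals: all expectation values are given in terms of the
two-point function by
`ω(ψ(f₁) ⋯ ψ(fₙ) ψ(gₘ)† ⋯ ψ(g₁)†) = δₙₘ det [ω(ψ(fᵢ) ψ(gⱼ)†)]`. -/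
def IsQuasiFree {L : ℝ} {bc : BC} (ω : Functional L bc) : Prop :=
  (∀ (n : ℕ) (f g : Fin n → OneParticle L),
    ω ((List.ofFn fun i => field L bc (f i)).prod *
        star (List.ofFn fun j => field L bc (g j)).prod)
      = (Matrix.of fun i j => twoPoint ω (f i) (g j)).det) ∧
  ∀ (n m : ℕ) (f : Fin n → OneParticle L) (g : Fin m → OneParticle L), n ≠ m →
    ω ((List.ofFn fun i => field L bc (f i)).prod *
        star (List.ofFn fun j => field L bc (g j)).prod) = 0

/-- The expectation value in `ω` of the Hamiltonian
`E = (2π/L) ∑_{n ≠ 0} |n| (a_n† a_n + b_n† b_n)`, where `n` runs through the (integer or half-odd)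
mode numbers; it is `∞` if the sum of the non-negative terms diverges. -/
def energy {L : ℝ} {bc : BC} (ω : Functional L bc) : ℝ≥0∞ :=
  ∑' n : ℤ, ENNReal.ofReal (2 * Real.pi / L * |bc.mode n| *
    (ω (star (modeA L bc n) * modeA L bc n) + ω (star (modeB L bc n) * modeB L bc n)).re)

/-- Ground states are the states of lowest energy. -/
def IsGroundState {L : ℝ} {bc : BC} (ω : Functional L bc) : Prop :=
  ω ∈ states L bc ∧ ∀ ω' ∈ states L bc, energy ω ≤ energy ω'

/-! ### Thermal states -/

/-- The energy `∑_{i ∈ S} (2π/L) |n_i|` of the occupation configuration `S`, i.e. the eigenvalue of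
the Hamiltonian on the corresponding basis vector of Fock space. -/
def configEnergy (L : ℝ) (bc : BC) (S : Finset Label) : ℝ :=
  ∑ i ∈ S, 2 * Real.pi / L * |bc.mode (ofLex i).2|

/-- The Boltzmann weight of an occupation configuration. -/
def boltzmannWeight (L : ℝ) (bc : BC) (β : ℝ) (S : Finset Label) : ℝ :=
  Real.exp (-β * configEnergy L bc S)

/-- The basis vector of Fock space belonging to the configuration `S`. -/
def configVector (S : Finset Label) : Fock Label := lp.single 2 S (1 : ℂ)

/-- The thermal (Gibbs) expectation value `tr(e^{-βE} A) / tr(e^{-βE})` on Fock space, with the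
traces taken in the eigenbasis of `E`. -/
def thermalExpectation (L : ℝ) (bc : BC) (β : ℝ) (A : carAlgebra L bc) : ℂ :=
  (∑' S : Finset Label, (boltzmannWeight L bc β S : ℂ) *
      inner ℂ (configVector S) ((A : Op) (configVector S))) /
    ((∑' S : Finset Label, boltzmannWeight L bc β S : ℝ) : ℂ)

/-! ### The massive Dirac field with periodic boundary conditions -/

/-- The one-particle Hamiltonian `i σ_z ∂_x + m σ_y` of the Dirac equation of mass `m`, acting on
waves `e^{i k x}`. -/
def diracMatrix (m k : ℝ) : Matrix (Fin 2) (Fin 2) ℂ :=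
  !![-(k : ℂ), -(Complex.I * m); Complex.I * m, (k : ℂ)]

/-- The expectation value in `ω` of the normal-ordered Hamiltonian of the Dirac field of mass `m`
with periodic boundary conditions: the sum over the momenta `k = 2πn/L` of
`∑_{a,b} D(k)_{ab} ψ_{a,n}† ψ_{b,n} + √(k² + m²)`, where `D(k)` has the eigenvalues `±√(k² + m²)`
and the added constant removes the energy of the filled negative-energy state, so that each term
is a non-negative operator with lowest eigenvalue `0`. -/
def massiveEnergy {L : ℝ} (m : ℝ) (ω : Functional L .periodic) : ℝ≥0∞ :=
  ∑' n : ℤ, ENNReal.ofReal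
    ((∑ a : Fin 2, ∑ b : Fin 2, diracMatrix m (2 * Real.pi * n / L) a b *
        ω (star (psi L .periodic a n) * psi L .periodic b n)).re
      + √((2 * Real.pi * n / L) ^ 2 + m ^ 2))

/-- The vacuum of the massive Dirac field: a state of lowest energy. -/
def IsMassiveVacuum {L : ℝ} (m : ℝ) (ω : Functional L .periodic) : Prop :=
  ω ∈ states L .periodic ∧ ∀ ω' ∈ states L .periodic, massiveEnergy m ω ≤ massiveEnergy m ω'

/-! ### Two-point functions -/

/-- The regularized two-point function for antiperiodic boundary conditions. -/
def sinKernel (L ε : ℝ) (f g : OneParticle L) : ℂ :=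
  1 / (2 * Complex.I * L) * ∫ x in Set.Icc 0 L, ∫ y in Set.Icc 0 L,
    (f 0 x * star (g 0 y) / Complex.sin (Real.pi / L * (x - y - Complex.I * ε))
      - f 1 x * star (g 1 y) / Complex.sin (Real.pi / L * (x - y + Complex.I * ε)))

/-- The regularized two-point function for periodic boundary conditions, without zero modes. -/
def cotKernel (L ε : ℝ) (f g : OneParticle L) : ℂ :=
  1 / (2 * Complex.I * L) * ∫ x in Set.Icc 0 L, ∫ y in Set.Icc 0 L,
    (f 0 x * star (g 0 y) / Complex.tan (Real.pi / L * (x - y - Complex.I * ε))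
      - f 1 x * star (g 1 y) / Complex.tan (Real.pi / L * (x - y + Complex.I * ε)))

/-- The zero-mode contribution `∑_{a,b} h_{ab} ∫ f_a ∫ g_b^*`. -/
def zeroModeTerm (L : ℝ) (h : Matrix (Fin 2) (Fin 2) ℂ) (f g : OneParticle L) : ℂ :=
  ∑ a : Fin 2, ∑ b : Fin 2,
    h a b * (∫ x in Set.Icc 0 L, f a x) * (∫ y in Set.Icc 0 L, star (g b y))

/-! ### The parameter space -/

/-- The matrix `h` with parameters `h₁, h₂, φ, ψ`. -/
def hMatrix (h₁ h₂ φ ψ : ℝ) : Matrix (Fin 2) (Fin 2) ℂ :=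
  (((h₁ + h₂) / 2 : ℝ) : ℂ) • (1 : Matrix (Fin 2) (Fin 2) ℂ) + (((h₁ - h₂) / 2 : ℝ) : ℂ) •
    !![(Real.cos ψ : ℂ), Real.sin ψ * Complex.exp (Complex.I * φ);
       Real.sin ψ * Complex.exp (-(Complex.I * φ)), -(Real.cos ψ : ℂ)]

/-- The allowed range of the parameters `h₁, h₂, φ, ψ`. -/
def ParamRange (L h₁ h₂ φ ψ : ℝ) : Prop :=
  |h₁| ≤ 1 / (2 * L) ∧ |h₂| ≤ 1 / (2 * L) ∧ φ ∈ Set.Ico 0 (2 * Real.pi) ∧ ψ ∈ Set.Icc 0 Real.pi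

/-- The set of all matrices `h` with parameters in the allowed range. -/
def hSet (L : ℝ) : Set (Matrix (Fin 2) (Fin 2) ℂ) :=
  {h | ∃ h₁ h₂ φ ψ : ℝ, ParamRange L h₁ h₂ φ ψ ∧ h = hMatrix h₁ h₂ φ ψ}

/-- Four-dimensional space with coordinates `(α, β)`. -/
abbrev R4 : Type := ℝ × EuclideanSpace ℝ (Fin 3)

/-- The Hermitian matrix `α 1 + β · σ`, with `σ` the Pauli matrices. -/
def pauliMatrix (x : R4) : Matrix (Fin 2) (Fin 2) ℂ :=
  (x.1 : ℂ) • (1 : Matrix (Fin 2) (Fin 2) ℂ) + (x.2 0 : ℂ) • !![0, 1; 1, 0]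
    + (x.2 1 : ℂ) • !![0, -Complex.I; Complex.I, 0] + (x.2 2 : ℂ) • !![1, 0; 0, -1]

/-- The double cone with axis along `α`: two cones with the tips `(±r, 0)` and the common base
`{α = 0, |β| ≤ r}`. -/
def doubleCone (r : ℝ) : Set R4 := {x | |x.1| + ‖x.2‖ ≤ r}

/-- The two tips of the double cone. -/
def tips (r : ℝ) : Set R4 := {(r, 0), (-r, 0)}

/-- The rim of the double cone, where the two cones meet. -/
def rim (r : ℝ) : Set R4 := {x | x.1 = 0 ∧ ‖x.2‖ = r}

end DiracCylinder

end

noncomputable section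

namespace DiracCylinder

/-! ### States on a C*-algebra -/

section States

variable {A : Type*} [CStarAlgebra A]

/-! The energy is a sum of occupation numbers with nonnegative coefficients. By Cauchy–Schwarz, `ω
(d† d) = 0` forces `ω (a d) = 0` for all `a`, so a vanishing occupation number means that `ω` is
annihilated by the mode. Anticommuting operators always have a common vacuum
(`exists_state_of_anticommute`). Hence the lowest energy is zero, and a ground state is a state in
which every mode of nonzero momentum is in its vacuum (`isGroundState_iff`).

If each vector of a complete orthonormal system is annihilated, either as a field or as an adjoint
field, the state is unique. An annihilated field can be moved through any normal ordered monomial,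
and its contractions are a Laplace expansion. The state is therefore quasi-free with a projection as
two-point function (`IsVacuum.quasiFree`), and normal ordered monomials span a dense subspace
(`IsCAR.functional_ext`). Antiperiodic modes have no zero mode, so this settles the antiperiodic
case.

For periodic boundary conditions two zero modes stay free, and a quasi-free ground state is fixed by
the 2 × 2 matrix `1/2 + L h` of their two-point functions. Positivity and the anticommutation
relations put its eigenvalues into [0, 1] (`exists_mem_hSet`). Conversely, for a given `h` the zero
modes are rotated to its eigenvectors and four vacua are mixed with independent probabilities `1/2 +
L h₁` and `1/2 + L h₂`. Determinants are affine along rank-one perturbations, so this mixture is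
again quasi-free (`quasiFree_mixture`). A vacuum is pure because each component of a convex
decomposition is a vacuum for the same modes and hence equal to it. A probability strictly between 0
and 1 exhibits a proper decomposition (`isPure_mixture_iff`).

The integral kernels are geometric series in the modes, damped by ε; Parseval and dominated
convergence remove the damping (`tendsto_regKernel`). The cotangent gives the zero modes weight 1/2,
which is why `h = 0` is the symmetric point.

In the thermal limit the Boltzmann weights concentrate on the four configurations of zero energy,
with equal weights. The massive vacuum is the vacuum of the eigenmodes of the Dirac matrix at each
momentum. As m → 0 its occupation numbers in the massless modes converge, and compactness of the
state space with uniqueness of vacua turns this into convergence of states (`IsVacuum.tendsto`).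

The double cone is the set of `α 1 + β · σ` whose eigenvalues `α ± |β|` are bounded by `1/(2L)`. Its
extreme points are those where both eigenvalues have modulus `1/(2L)`, which is the purity
criterion. -/

/-- Positive normalized linear functionals on a C*-algebra. -/
def IsState (ω : A →ₗ[ℂ] ℂ) : Prop := ω 1 = 1 ∧ ∀ a : A, 0 ≤ ω (star a * a)

namespace IsState

variable {ω : A →ₗ[ℂ] ℂ}

/-- Positivity makes the value on `(1 + t a)† (1 + t a)` real, so `t ω(a) + t̄ ω(a†)` is real for
every complex `t`. The choices `t = 1` and `t = i` give the imaginary and the real parts. -/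
theorem map_star (hω : IsState ω) (a : A) : ω (star a) = star (ω a) := by
  have key : ∀ t : ℂ, (t * ω a + star t * ω (star a)).im = 0 := by
    intro t
    have h0 := (Complex.nonneg_iff.1 (hω.2 (1 + t • a))).2
    have h1 := (Complex.nonneg_iff.1 (hω.2 (t • a))).2
    have h2 : star (1 + t • a) * (1 + t • a)
        = 1 + (t • a + star t • star a) + star (t • a) * (t • a) := by
      simp only [star_add, star_one, star_smul]
      rw [mul_add, add_mul, add_mul, mul_one, one_mul, mul_one]
      abel
    rw [h2] at h0
    simp only [map_add, map_smul, smul_eq_mul, hω.1, Complex.add_im, Complex.one_im] at h0 ⊢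
    linarith
  have h1 := key 1
  have h2 := key Complex.I
  simp at h1 h2
  apply Complex.ext
  · simp; linarith
  · simp; linarith

/-- The sesquilinear form `⟨a, b⟩ = ω (a† b)` of a state. -/
abbrev preInner (hω : IsState ω) : PreInnerProductSpace.Core ℂ A where
  inner a b := ω (star a * b)
  conj_inner_symm a b := by
    have := hω.map_star (star b * a)
    simp only [star_mul, star_star] at this
    rw [this]; simp
  re_inner_nonneg a := (Complex.nonneg_iff.1 (hω.2 a)).1
  add_left a b c := by simp [add_mul]
  smul_left a b r := by simp

/-- Cauchy–Schwarz for the semi-inner product of the GNS construction. -/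
theorem norm_sq_le (hω : IsState ω) (a b : A) :
    ‖ω (star a * b)‖ ^ 2 ≤ (ω (star a * a)).re * (ω (star b * b)).re := by
  have h : ‖ω (star a * b)‖ * ‖ω (star b * a)‖ ≤ (ω (star a * a)).re * (ω (star b * b)).re :=
    let := hω.preInner
    InnerProductSpace.Core.inner_mul_inner_self_le (𝕜 := ℂ) a b
  have hs := hω.map_star (star a * b)
  rw [star_mul, star_star] at hs
  rw [hs, norm_star] at h
  rw [sq]
  exact h

/-- Null vectors of the GNS form make up a left ideal. This turns a vanishing occupation number into
annihilation inside arbitrary products. -/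
theorem mul_eq_zero (hω : IsState ω) {d : A} (hd : ω (star d * d) = 0) (a : A) :
    ω (a * d) = 0 := by
  have h := hω.norm_sq_le (star a) d
  rw [star_star, hd, Complex.zero_re, mul_zero] at h
  have : ‖ω (a * d)‖ = 0 := by nlinarith [norm_nonneg (ω (a * d))]
  simpa using this

theorem star_mul_eq_zero (hω : IsState ω) {d : A} (hd : ω (star d * d) = 0) (a : A) :
    ω (star d * a) = 0 := by
  have h := hω.map_star (star a * d)
  rwa [hω.mul_eq_zero hd, star_zero, star_mul, star_star] at h

/-- In the spectral order `a† a ≤ ‖a‖² 1`, and the difference is itself of the form `b† b`.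
Continuity of states rests on this bound. -/
theorem re_star_mul_self_le (hω : IsState ω) (a : A) : (ω (star a * a)).re ≤ ‖a‖ ^ 2 := by
  let _ := CStarAlgebra.spectralOrder A
  let _ := CStarAlgebra.spectralOrderedRing A
  have h1 : star a * a ≤ algebraMap ℝ A ‖star a * a‖ :=
    IsSelfAdjoint.le_algebraMap_norm_self (.star_mul_self a)
  obtain ⟨b, hb⟩ := CStarAlgebra.nonneg_iff_eq_star_mul_self.1 (sub_nonneg.2 h1)
  have h2 := (Complex.nonneg_iff.1 (hω.2 b)).1
  have h3 : algebraMap ℝ A ‖star a * a‖ = ((‖star a * a‖ : ℝ) : ℂ) • (1 : A) := by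
    rw [Algebra.algebraMap_eq_smul_one, Complex.coe_smul]
  rw [← hb, h3, map_sub, map_smul, hω.1, CStarRing.norm_star_mul_self] at h2
  simp at h2
  nlinarith

theorem norm_le (hω : IsState ω) (a : A) : ‖ω a‖ ≤ ‖a‖ := by
  have h := hω.norm_sq_le 1 a
  simp only [star_one, one_mul, hω.1, Complex.one_re] at h
  exact abs_le_of_sq_le_sq' (h.trans (hω.re_star_mul_self_le a)) (norm_nonneg _) |>.2

theorem continuous (hω : IsState ω) : Continuous ω :=
  (LinearMap.mkContinuous ω 1 fun a => by simpa using hω.norm_le a).continuous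

theorem re_nonneg (hω : IsState ω) (a : A) : 0 ≤ (ω (star a * a)).re :=
  (Complex.nonneg_iff.1 (hω.2 a)).1

theorem eq_zero_of_re (hω : IsState ω) {a : A} (h : (ω (star a * a)).re = 0) :
    ω (star a * a) = 0 :=
  Complex.ext h (Complex.nonneg_iff.1 (hω.2 a)).2.symm

theorem convex_comb {ω' : A →ₗ[ℂ] ℂ} (hω : IsState ω) (hω' : IsState ω') {p : ℝ} (h0 : 0 ≤ p)
    (h1 : p ≤ 1) : IsState ((p : ℂ) • ω + ((1 - p : ℝ) : ℂ) • ω') := by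
  refine ⟨by simp [hω.1, hω'.1], fun a => ?_⟩
  have hp : (0 : ℂ) ≤ p := by exact_mod_cast h0
  have hp' : (0 : ℂ) ≤ ((1 - p : ℝ) : ℂ) := by exact_mod_cast sub_nonneg.2 h1
  simpa using add_nonneg (mul_nonneg hp (hω.2 a)) (mul_nonneg hp' (hω'.2 a))

end IsState

/-- Limits of states along ultrafilters exist. -/
theorem exists_tendsto_ultrafilter {ι : Type*} (G : Ultrafilter ι) (ω : ι → A →ₗ[ℂ] ℂ)
    (hω : ∀ i, IsState (ω i)) :
    ∃ ω' : A →ₗ[ℂ] ℂ, IsState ω' ∧ ∀ a, Tendsto (fun i => ω i a) G (𝓝 (ω' a)) := by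
  have hlim : ∀ a, ∃ z : ℂ, Tendsto (fun i => ω i a) G (𝓝 z) := by
    intro a
    -- Weak-* compactness in elementary form: the values on a fixed `a` stay in the compact disc of
    -- radius `‖a‖`.
    obtain ⟨z, -, hz⟩ := (isCompact_closedBall (0 : ℂ) ‖a‖).ultrafilter_le_nhds
      (G.map fun i => ω i a) (by
        rw [Filter.le_principal_iff]
        exact show ∀ᶠ i in (G : Filter ι), ω i a ∈ Metric.closedBall 0 ‖a‖ from
          Filter.Eventually.of_forall fun i => by simpa using (hω i).norm_le a)
    exact ⟨z, hz⟩
  choose w hw using hlim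
  refine ⟨{ toFun := w, map_add' := fun a b => ?_, map_smul' := fun c a => ?_ }, ⟨?_, fun a => ?_⟩,
    hw⟩
  · refine tendsto_nhds_unique (hw _) ?_
    simpa using (hw a).add (hw b)
  · refine tendsto_nhds_unique (hw _) ?_
    simpa using (hw a).const_mul c
  · refine tendsto_nhds_unique (hw 1) ?_
    simp [(hω _).1]
  · exact ge_of_tendsto' (hw (star a * a)) fun i => (hω i).2 a

/-- A finite family of anticommuting elements has a common vacuum. -/
theorem exists_state_finset {K : Type*} (d : K → A) (hd : ∀ k l, d k * d l + d l * d k = 0)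
    (hA : ∃ ω : A →ₗ[ℂ] ℂ, IsState ω) (F : Finset K) :
    ∃ ω : A →ₗ[ℂ] ℂ, IsState ω ∧ ∀ k ∈ F, ω (star (d k) * d k) = 0 := by
  classical
  induction F using Finset.induction_on with
  | empty => obtain ⟨ω, h⟩ := hA; exact ⟨ω, h, by simp⟩
  | insert k F _ ih =>
    obtain ⟨ω, hω, hF⟩ := ih
    by_cases h0 : ω (star (d k) * d k) = 0
    · exact ⟨ω, hω, fun l hl => (Finset.mem_insert.1 hl).elim (fun h => h ▸ h0) (hF l)⟩
    have hpos : 0 < ω (star (d k) * d k) := lt_of_le_of_ne (hω.2 _) (Ne.symm h0)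
    have hsq : d k * d k = 0 := by
      have h := hd k k
      rwa [← two_smul ℂ, smul_eq_zero_iff_right two_ne_zero] at h
    -- In GNS terms this is the state of the normalized vector `d k Ω`. It is killed by `d k`
    -- because `(d k)² = 0`, and it is still killed by the earlier `d l` because they anticommute
    -- with `d k`.
    let ω' : A →ₗ[ℂ] ℂ := (ω (star (d k) * d k))⁻¹ •
      (ω ∘ₗ LinearMap.mulLeft ℂ (star (d k)) ∘ₗ LinearMap.mulRight ℂ (d k))
    have hω' : ∀ a, ω' a = (ω (star (d k) * d k))⁻¹ * ω (star (d k) * (a * d k)) := fun a => rfl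
    refine ⟨ω', ⟨?_, fun a => ?_⟩, fun l hl => ?_⟩
    · rw [hω', one_mul, inv_mul_cancel₀ h0]
    · rw [hω']
      have h := hω.2 (a * d k)
      rw [star_mul, mul_assoc, ← mul_assoc (star a)] at h
      exact mul_nonneg (inv_nonneg.2 hpos.le) h
    · rw [hω']
      rcases Finset.mem_insert.1 hl with rfl | hl
      · rw [mul_assoc (star (d l)), hsq]; simp
      · have h1 : d l * d k = - (d k * d l) := eq_neg_of_add_eq_zero_left (hd l k)
        rw [mul_assoc (star (d l)), h1, mul_neg, mul_neg, ← mul_assoc, ← mul_assoc, map_neg,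
          hω.mul_eq_zero (hF l hl)]
        simp

/-- A family of anticommuting elements has a common vacuum. -/
theorem exists_state_of_anticommute {K : Type*} (d : K → A)
    (hd : ∀ k l, d k * d l + d l * d k = 0) (hA : ∃ ω : A →ₗ[ℂ] ℂ, IsState ω) :
    ∃ ω : A →ₗ[ℂ] ℂ, IsState ω ∧ ∀ k, ω (star (d k) * d k) = 0 := by
  classical
  choose ω hω hF using exists_state_finset d hd hA
  -- A limit along an ultrafilter finer than inclusion of finite sets: each `k` belongs to all
  -- sufficiently large finite sets.
  obtain ⟨ω', hω', hlim⟩ := exists_tendsto_ultrafilter (Ultrafilter.of atTop) ω hω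
  refine ⟨ω', hω', fun k => tendsto_nhds_unique (hlim _) ?_⟩
  refine tendsto_const_nhds.congr' ?_
  refine Filter.Eventually.filter_mono (Ultrafilter.of_le _) ?_
  filter_upwards [Filter.eventually_ge_atTop ({k} : Finset K)] with F h
  exact (hF F k (h (Finset.mem_singleton_self k))).symm

end States

/-! ### Representations of the canonical anticommutation relations -/

/-- An element satisfying the anticommutation relations of a rescaled fermionic mode has the
corresponding norm bound. -/
theorem norm_sq_le_of_anticommute {A : Type*} [CStarAlgebra A] {x : A} {r : ℝ} (h0 : x * x = 0)
    (h1 : x * star x + star x * x = (r : ℂ) • (1 : A)) : ‖x‖ ^ 2 ≤ r ∨ x = 0 := by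
  by_cases hx : x = 0
  · exact Or.inr hx
  left
  have hpos : 0 < ‖x‖ := norm_pos_iff.2 hx
  -- Since `x² = 0`, the element `x† x` is `r` times an idempotent up to normalization; the
  -- C*-identity then gives `‖x‖² = |r|`.
  have h2 : star (star x * x) * (star x * x) = (r : ℂ) • (star x * x) := by
    have : x * star x = (r : ℂ) • (1 : A) - star x * x := eq_sub_of_add_eq h1
    calc star (star x * x) * (star x * x) = star x * (x * star x) * x := by
          simp [mul_assoc]
      _ = (r : ℂ) • (star x * x) - star x * star x * (x * x) := by
          rw [this, mul_sub, sub_mul]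
          simp [mul_assoc]
      _ = _ := by rw [h0]; simp
  have h3 := congrArg norm h2
  rw [CStarRing.norm_star_mul_self, norm_smul, CStarRing.norm_star_mul_self] at h3
  have h4 : ‖x‖ * ‖x‖ = ‖(r : ℂ)‖ := mul_right_cancel₀ (mul_pos hpos hpos).ne' h3
  have h5 : 0 ≤ r ∨ r < 0 := le_or_gt 0 r
  rcases h5 with h5 | h5
  · rw [Complex.norm_real, Real.norm_of_nonneg h5] at h4
    rw [sq, h4]
  -- For negative `r` the relation would make `x† x` at once nonnegative and nonpositive, hence `x =
  -- 0`.
  · exfalso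
    let _ := CStarAlgebra.spectralOrder A
    let _ := CStarAlgebra.spectralOrderedRing A
    have h6 : star x * x ≤ 0 := by
      have e1 : 0 ≤ x * star x := mul_star_self_nonneg x
      have e2 : (0 : A) ≤ ((-r : ℝ) : ℂ) • (1 : A) := by
        rw [Complex.coe_smul]
        exact smul_nonneg (by linarith) zero_le_one
      have e3 : star x * x = - (x * star x + ((-r : ℝ) : ℂ) • (1 : A)) := by
        rw [eq_sub_of_add_eq' h1]; push_cast; rw [neg_smul]; abel
      rw [e3]
      exact neg_nonpos.2 (add_nonneg e1 e2)
    have h7 : star x * x = 0 := le_antisymm h6 (star_mul_self_nonneg x)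
    exact hx ((CStarRing.star_mul_self_eq_zero_iff x).1 h7)

/-- Modes satisfying the canonical anticommutation relations. -/
structure IsCARModes {A : Type*} [CStarAlgebra A] {K : Type*} [DecidableEq K] (χ : K → A) :
    Prop where
  anti : ∀ k l, χ k * χ l + χ l * χ k = 0
  anti_star : ∀ k l, χ k * star (χ l) + star (χ l) * χ k = if k = l then 1 else 0

section Modes

variable {A : Type*} [CStarAlgebra A] {K : Type*} [DecidableEq K] {χ : K → A}

/-- A linear combination of modes again squares to zero and has anticommutator `∑ |c k|²` with its
adjoint, so it obeys the norm bound of a single rescaled mode. This is why smearing with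
square-summable coefficients converges in operator norm. -/
theorem IsCARModes.norm_sum_sq_le (hχ : IsCARModes χ) (c : K → ℂ) (F : Finset K) :
    ‖∑ k ∈ F, c k • χ k‖ ^ 2 ≤ ∑ k ∈ F, ‖c k‖ ^ 2 := by
  set x := ∑ k ∈ F, c k • χ k with hx
  have h0 : x * x = 0 := by
    have : x * x + x * x = 0 := by
      conv_lhs => rw [hx, Finset.sum_mul_sum]
      -- Exchanging the sums in the second copy pairs `χ k χ l` with `χ l χ k`.
      nth_rewrite 2 [Finset.sum_comm]
      rw [← Finset.sum_add_distrib]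
      refine Finset.sum_eq_zero fun k _ => ?_
      rw [← Finset.sum_add_distrib]
      refine Finset.sum_eq_zero fun l _ => ?_
      rw [smul_mul_smul_comm, smul_mul_smul_comm, mul_comm (c l), ← smul_add, hχ.anti, smul_zero]
    rwa [← two_smul ℂ, smul_eq_zero_iff_right two_ne_zero] at this
  have h1 : x * star x + star x * x = ((∑ k ∈ F, ‖c k‖ ^ 2 : ℝ) : ℂ) • (1 : A) := by
    have hs : star x = ∑ k ∈ F, star (c k) • star (χ k) := by simp [hx, star_sum]
    rw [hs, hx, Finset.sum_mul_sum, Finset.sum_mul_sum]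
    nth_rewrite 2 [Finset.sum_comm]
    rw [← Finset.sum_add_distrib, Complex.ofReal_sum, Finset.sum_smul]
    refine Finset.sum_congr rfl fun k hk => ?_
    rw [← Finset.sum_add_distrib]
    have : ∀ l ∈ F, c k • χ k * star (c l) • star (χ l) + star (c l) • star (χ l) * c k • χ k
        = if k = l then ((‖c k‖ ^ 2 : ℝ) : ℂ) • (1 : A) else 0 := by
      intro l _
      rw [smul_mul_smul_comm, smul_mul_smul_comm, mul_comm (star (c l)), ← smul_add, hχ.anti_star]
      split_ifs with h
      · subst h
        rw [Complex.star_def, Complex.mul_conj, Complex.normSq_eq_norm_sq]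
      · simp
    rw [Finset.sum_congr rfl this]
    simp [hk]
  rcases norm_sq_le_of_anticommute h0 h1 with h | h
  · exact h
  · rw [h]; simp; positivity

end Modes

/-! ### Smeared fields and normal ordering -/

section Smeared

variable {A : Type*} [CStarAlgebra A] {H : Type*} [NormedAddCommGroup H] [InnerProductSpace ℂ H]
  {K : Type*} [DecidableEq K] {χ : K → A}

theorem IsCARModes.summable (hχ : IsCARModes χ) (b : HilbertBasis K ℂ H) (f : H) :
    Summable fun k => b.repr f k • χ k := by
  have hs : Summable fun k => ‖b.repr f k‖ ^ 2 := by
    have := (lp.memℓp (b.repr f)).summable (by norm_num)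
    simpa using this
  rw [summable_iff_vanishing_norm] at hs ⊢
  intro ε hε
  obtain ⟨s, hs⟩ := hs (ε ^ 2) (by positivity)
  refine ⟨s, fun t ht => ?_⟩
  have h1 := hs t ht
  rw [Real.norm_of_nonneg (by positivity)] at h1
  exact lt_of_pow_lt_pow_left₀ 2 hε.le ((hχ.norm_sum_sq_le _ t).trans_lt h1)

/-- The field obtained by smearing modes with the coefficients of a vector in a Hilbert basis. -/
def smear (hχ : IsCARModes χ) (b : HilbertBasis K ℂ H) : H →ₗ[ℂ] A where
  toFun f := ∑' k, b.repr f k • χ k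
  map_add' f g := by
    rw [← (hχ.summable b f).tsum_add (hχ.summable b g)]
    simp [add_smul]
  map_smul' c f := by
    rw [RingHom.id_apply, ← (hχ.summable b f).tsum_const_smul c]
    simp [mul_smul]

/-- A linear map from a Hilbert space to a C*-algebra that satisfies the canonical anticommutation
relations and generates the algebra. -/
structure IsCAR (Ψ : H →ₗ[ℂ] A) : Prop where
  anti : ∀ f g, Ψ f * Ψ g + Ψ g * Ψ f = 0
  anti_star : ∀ f g, Ψ f * star (Ψ g) + star (Ψ g) * Ψ f = (inner ℂ g f : ℂ) • (1 : A)
  dense : (StarAlgebra.adjoin ℂ (Set.range Ψ)).topologicalClosure = ⊤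

theorem smear_hasSum (hχ : IsCARModes χ) (b : HilbertBasis K ℂ H) (f : H) :
    HasSum (fun k => b.repr f k • χ k) (smear hχ b f) := (hχ.summable b f).hasSum

theorem smear_anti (hχ : IsCARModes χ) (b : HilbertBasis K ℂ H) (f g : H) :
    smear hχ b f * smear hχ b g + smear hχ b g * smear hχ b f = 0 := by
  have h1 : ∀ k, χ k * smear hχ b g + smear hχ b g * χ k = 0 := by
    intro k
    have h := ((smear_hasSum hχ b g).mul_left (χ k)).add ((smear_hasSum hχ b g).mul_right (χ k))
    refine h.unique (hasSum_zero.congr_fun fun l => ?_)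
    rw [mul_smul_comm, smul_mul_assoc, ← smul_add, hχ.anti, smul_zero]
  have h := ((smear_hasSum hχ b f).mul_right (smear hχ b g)).add
    ((smear_hasSum hχ b f).mul_left (smear hχ b g))
  refine h.unique (hasSum_zero.congr_fun fun k => ?_)
  rw [smul_mul_assoc, mul_smul_comm, ← smul_add, h1, smul_zero]

theorem smear_anti_star (hχ : IsCARModes χ) (b : HilbertBasis K ℂ H) (f g : H) :
    smear hχ b f * star (smear hχ b g) + star (smear hχ b g) * smear hχ b f
      = (inner ℂ g f : ℂ) • (1 : A) := by
  have h1 : ∀ k, χ k * star (smear hχ b g) + star (smear hχ b g) * χ k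
      = star (b.repr g k) • (1 : A) := by
    intro k
    have hs := (smear_hasSum hχ b g).star
    have h := (hs.mul_left (χ k)).add (hs.mul_right (χ k))
    refine h.unique ((hasSum_ite_eq k (star (b.repr g k) • (1 : A))).congr_fun fun l => ?_)
    rw [star_smul, mul_smul_comm, smul_mul_assoc, ← smul_add, hχ.anti_star]
    by_cases hkl : k = l
    · subst hkl; simp
    · rw [if_neg hkl, if_neg (Ne.symm hkl), smul_zero]
  have h := ((smear_hasSum hχ b f).mul_right (star (smear hχ b g))).add
    ((smear_hasSum hχ b f).mul_left (star (smear hχ b g)))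
  refine h.unique (((b.hasSum_inner_mul_inner g f).smul_const (1 : A)).congr_fun
    fun k => ?_)
  rw [smul_mul_assoc, mul_smul_comm, ← smul_add, h1, smul_smul, mul_comm, b.repr_apply_apply,
    b.repr_apply_apply, Complex.star_def, inner_conj_symm]

namespace IsCAR

variable {Ψ : H →ₗ[ℂ] A}

theorem norm_le (hΨ : IsCAR Ψ) (f : H) : ‖Ψ f‖ ≤ ‖f‖ := by
  have h0 : Ψ f * Ψ f = 0 := by
    have h := hΨ.anti f f
    rwa [← two_smul ℂ, smul_eq_zero_iff_right two_ne_zero] at h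
  have h1 := hΨ.anti_star f f
  rw [inner_self_eq_norm_sq_to_K] at h1
  rcases norm_sq_le_of_anticommute (r := ‖f‖ ^ 2) h0 (by rw [h1]; simp) with h | h
  · exact (abs_le_of_sq_le_sq' h (norm_nonneg f)).2
  · rw [h]; simp

theorem continuous (hΨ : IsCAR Ψ) : Continuous Ψ :=
  (LinearMap.mkContinuous Ψ 1 fun f => by simpa using hΨ.norm_le f).continuous

end IsCAR

/-- The product `Ψ(f₁) ⋯ Ψ(fₙ)`. -/
def fieldProd (Ψ : H →ₗ[ℂ] A) {n : ℕ} (f : Fin n → H) : A := (List.ofFn fun i => Ψ (f i)).prod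

@[simp] theorem fieldProd_zero (Ψ : H →ₗ[ℂ] A) (f : Fin 0 → H) : fieldProd Ψ f = 1 := by
  simp [fieldProd]

theorem fieldProd_succ (Ψ : H →ₗ[ℂ] A) {n : ℕ} (f : Fin (n + 1) → H) :
    fieldProd Ψ f = Ψ (f 0) * fieldProd Ψ (fun i => f i.succ) := by
  simp [fieldProd, List.ofFn_succ]

namespace IsCAR

variable {Ψ : H →ₗ[ℂ] A}

theorem mul_fieldProd (hΨ : IsCAR Ψ) (h : H) {n : ℕ} (f : Fin n → H) :
    Ψ h * fieldProd Ψ f = ((-1 : ℂ) ^ n) • (fieldProd Ψ f * Ψ h) := by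
  induction n with
  | zero => simp
  | succ n ih =>
    rw [fieldProd_succ, ← mul_assoc, eq_neg_of_add_eq_zero_left (hΨ.anti h (f 0)), neg_mul,
      mul_assoc, ih, mul_smul_comm, pow_succ, mul_neg_one, neg_smul, mul_assoc]

/-- Moving a field through a product of adjoint fields. -/
theorem mul_star_fieldProd (hΨ : IsCAR Ψ) (h : H) {n : ℕ} (g : Fin (n + 1) → H) :
    Ψ h * star (fieldProd Ψ g) = ((-1 : ℂ) ^ (n + 1)) • (star (fieldProd Ψ g) * Ψ h)
      + ∑ j : Fin (n + 1), ((-1 : ℂ) ^ (n + (j : ℕ)) * inner ℂ (g j) h) •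
          star (fieldProd Ψ (fun i => g (j.succAbove i))) := by
  induction n with
  | zero =>
    simp [fieldProd_succ]
    rw [← hΨ.anti_star]; abel
  | succ n ih =>
    have h1 : Ψ h * star (Ψ (g 0)) = (inner ℂ (g 0) h : ℂ) • (1 : A) - star (Ψ (g 0)) * Ψ h :=
      eq_sub_of_add_eq (hΨ.anti_star h (g 0))
    rw [fieldProd_succ, star_mul, ← mul_assoc, ih (fun i => g i.succ), add_mul, smul_mul_assoc,
      mul_assoc _ (Ψ h), h1, mul_sub, smul_sub, Finset.sum_mul,
      Fin.sum_univ_succ (n := n + 1)]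
    -- Omitting an index other than the first keeps `g 0`, whose adjoint is the last factor.
    have h2 : ∀ j : Fin (n + 1), star (fieldProd Ψ fun i => g (j.succ.succAbove i))
        = star (fieldProd Ψ fun i => g (j.succAbove i).succ) * star (Ψ (g 0)) := by
      intro j
      rw [fieldProd_succ, star_mul]
      simp
    have h3 : ∀ j : Fin (n + 1),
        ((-1 : ℂ) ^ (n + (j : ℕ)) * inner ℂ (g j.succ) h) •
          star (fieldProd Ψ fun i => g (j.succAbove i).succ) * star (Ψ (g 0))
        = ((-1 : ℂ) ^ (n + 1 + (j.succ : ℕ)) * inner ℂ (g j.succ) h) •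
          star (fieldProd Ψ fun i => g (j.succ.succAbove i)) := by
      intro j
      rw [h2, smul_mul_assoc]
      congr 2
      rw [Fin.val_succ, show n + 1 + ((j : ℕ) + 1) = n + j + 2 by ring,
        pow_add _ _ 2, neg_one_sq, mul_one]
    rw [Finset.sum_congr rfl fun j _ => h3 j, mul_smul_comm, mul_one, smul_smul]
    simp only [Fin.succAbove_zero, Fin.val_zero, add_zero, pow_succ (-1 : ℂ) (n + 1), mul_neg_one,
      neg_smul, mul_assoc]
    abel

/-- The span of the normal ordered monomials. -/
def normalOrdered (Ψ : H →ₗ[ℂ] A) : Submodule ℂ A :=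
  Submodule.span ℂ {a | ∃ (n m : ℕ) (f : Fin n → H) (g : Fin m → H),
    a = fieldProd Ψ f * star (fieldProd Ψ g)}

theorem mem_normalOrdered (Ψ : H →ₗ[ℂ] A) {n m : ℕ} (f : Fin n → H) (g : Fin m → H) :
    fieldProd Ψ f * star (fieldProd Ψ g) ∈ normalOrdered Ψ :=
  Submodule.subset_span ⟨n, m, f, g, rfl⟩

theorem mul_mem_normalOrdered (h : H) {a : A} (ha : a ∈ normalOrdered Ψ) :
    Ψ h * a ∈ normalOrdered Ψ := by
  induction ha using Submodule.span_induction with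
  | mem x hx =>
    obtain ⟨n, m, f, g, rfl⟩ := hx
    have : Ψ h * (fieldProd Ψ f * star (fieldProd Ψ g))
        = fieldProd Ψ (Fin.cons h f : Fin (n + 1) → H) * star (fieldProd Ψ g) := by
      rw [fieldProd_succ, ← mul_assoc]; simp
    rw [this]
    exact mem_normalOrdered Ψ _ g
  | zero => simp
  | add x y _ _ hx hy => rw [mul_add]; exact add_mem hx hy
  | smul c x _ hx => rw [mul_smul_comm]; exact Submodule.smul_mem _ c hx

/-- The adjoint field is carried to the right through the fields. Each contraction leaves a shorter
normal ordered monomial, and on arrival the adjoint field joins the other adjoints up to a sign. -/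
theorem star_mul_mem_normalOrdered (hΨ : IsCAR Ψ) (h : H) {a : A} (ha : a ∈ normalOrdered Ψ) :
    star (Ψ h) * a ∈ normalOrdered Ψ := by
  induction ha using Submodule.span_induction with
  | mem x hx =>
    obtain ⟨n, m, f, g, rfl⟩ := hx
    have hcons : ∀ {n : ℕ} (f : Fin n → H),
        fieldProd Ψ f * star (Ψ h) * star (fieldProd Ψ g) ∈ normalOrdered Ψ := by
      intro n f
      have h1 := congrArg star (hΨ.mul_fieldProd h g)
      rw [star_mul, star_smul, star_mul] at h1
      have h2 : star (Ψ h) * star (fieldProd Ψ g)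
          = ((-1 : ℂ) ^ m) • star (fieldProd Ψ (Fin.cons h g : Fin (m + 1) → H)) := by
        rw [fieldProd_succ, star_mul]
        simp only [Fin.cons_zero, Fin.cons_succ]
        rw [h1, smul_smul]
        have : (-1 : ℂ) ^ m * star ((-1 : ℂ) ^ m) = 1 := by
          rw [star_pow, star_neg, star_one, ← mul_pow]; simp
        rw [this, one_smul]
      rw [mul_assoc, h2, mul_smul_comm]
      exact Submodule.smul_mem _ _ (mem_normalOrdered Ψ f _)
    cases n with
    | zero => simpa using hcons f
    | succ n =>
      have h1 := congrArg star (hΨ.mul_star_fieldProd h f)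
      simp only [star_mul, star_add, star_smul, star_star, star_sum] at h1
      have h2 : star (Ψ h) * fieldProd Ψ f = star ((-1 : ℂ) ^ (n + 1)) • (fieldProd Ψ f * star (Ψ h)
          - ∑ j : Fin (n + 1), (star (inner ℂ (f j) h : ℂ) * star ((-1 : ℂ) ^ (n + (j : ℕ)))) •
            fieldProd Ψ (fun i => f (j.succAbove i))) := by
        rw [h1, add_sub_cancel_right, smul_smul, star_pow, star_neg, star_one, ← mul_pow]
        simp
      rw [← mul_assoc, h2, smul_mul_assoc, sub_mul, Finset.sum_mul]
      refine Submodule.smul_mem _ _ (sub_mem (hcons f) (sum_mem fun j _ => ?_))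
      rw [smul_mul_assoc]
      exact Submodule.smul_mem _ _ (mem_normalOrdered Ψ _ g)
  | zero => simp
  | add x y _ _ hx hy => rw [mul_add]; exact add_mem hx hy
  | smul c x _ hx => rw [mul_smul_comm]; exact Submodule.smul_mem _ c hx

/-- The span of normal ordered monomials contains 1 and is stable under left multiplication by the
generators and their adjoints, hence by the whole algebra they generate. -/
theorem adjoin_le_normalOrdered (hΨ : IsCAR Ψ) {a : A}
    (ha : a ∈ StarAlgebra.adjoin ℂ (Set.range Ψ)) : a ∈ normalOrdered Ψ := by
  have key : ∀ x ∈ normalOrdered Ψ, a * x ∈ normalOrdered Ψ := by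
    rw [← StarSubalgebra.mem_toSubalgebra, StarAlgebra.adjoin_toSubalgebra] at ha
    induction ha using Algebra.adjoin_induction with
    | mem y hy =>
      intro x hx
      rcases hy with ⟨f, rfl⟩ | ⟨f, hf⟩
      · exact mul_mem_normalOrdered f hx
      · rw [← star_star y, ← hf]
        exact hΨ.star_mul_mem_normalOrdered f hx
    | algebraMap r =>
      intro x hx
      rw [Algebra.algebraMap_eq_smul_one, smul_mul_assoc, one_mul]
      exact Submodule.smul_mem _ _ hx
    | add y z _ _ hy hz => intro x hx; rw [add_mul]; exact add_mem (hy x hx) (hz x hx)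
    | mul y z _ _ hy hz => intro x hx; rw [mul_assoc]; exact hy _ (hz x hx)
  have h1 : (1 : A) ∈ normalOrdered Ψ := by
    simpa using mem_normalOrdered Ψ (Fin.elim0 : Fin 0 → H) (Fin.elim0 : Fin 0 → H)
  simpa using key 1 h1

/-- Continuous functionals are determined by their values on normal ordered monomials. -/
theorem functional_ext (hΨ : IsCAR Ψ) {ω ω' : A →ₗ[ℂ] ℂ} (hω : Continuous ω)
    (hω' : Continuous ω')
    (h : ∀ (n m : ℕ) (f : Fin n → H) (g : Fin m → H),
      ω (fieldProd Ψ f * star (fieldProd Ψ g)) = ω' (fieldProd Ψ f * star (fieldProd Ψ g))) :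
    ω = ω' := by
  have h1 : ∀ a ∈ normalOrdered Ψ, ω a = ω' a := by
    intro a ha
    induction ha using Submodule.span_induction with
    | mem x hx => obtain ⟨n, m, f, g, rfl⟩ := hx; exact h n m f g
    | zero => simp
    | add x y _ _ hx hy => rw [map_add, map_add, hx, hy]
    | smul c x _ hx => rw [map_smul, map_smul, hx]
  have h2 : Dense (StarAlgebra.adjoin ℂ (Set.range Ψ) : Set A) := by
    rw [dense_iff_closure_eq, ← StarSubalgebra.topologicalClosure_coe, hΨ.dense]; rfl
  have h3 : (ω : A → ℂ) = ω' :=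
    hω.ext_on h2 hω' fun a ha => h1 a (hΨ.adjoin_le_normalOrdered ha)
  exact LinearMap.ext fun a => congrFun h3 a

end IsCAR

end Smeared

/-! ### Wick's theorem, vacua and their mixtures -/

section Vacua

variable {A : Type*} [CStarAlgebra A] {H : Type*} [NormedAddCommGroup H] [InnerProductSpace ℂ H]
  {K : Type*} {Ψ : H →ₗ[ℂ] A} {ω ω' : A →ₗ[ℂ] ℂ}

/-- Functionals whose values on normal ordered monomials are the determinants of `G`. -/
def QuasiFreeWith (Ψ : H →ₗ[ℂ] A) (ω : A →ₗ[ℂ] ℂ) (G : H → H → ℂ) : Prop :=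
  (∀ (n : ℕ) (f g : Fin n → H),
    ω (fieldProd Ψ f * star (fieldProd Ψ g)) = (Matrix.of fun i j => G (f i) (g j)).det) ∧
  ∀ (n m : ℕ) (f : Fin n → H) (g : Fin m → H), n ≠ m →
    ω (fieldProd Ψ f * star (fieldProd Ψ g)) = 0

theorem QuasiFreeWith.twoPoint {G : H → H → ℂ} (h : QuasiFreeWith Ψ ω G) (f g : H) :
    ω (Ψ f * star (Ψ g)) = G f g := by
  simpa [fieldProd_succ] using h.1 1 (fun _ => f) (fun _ => g)

theorem IsCAR.quasiFree_ext (hΨ : IsCAR Ψ) {G G' : H → H → ℂ} (hω : IsState ω)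
    (hω' : IsState ω') (h : QuasiFreeWith Ψ ω G) (h' : QuasiFreeWith Ψ ω' G')
    (hG : ∀ f g, G f g = G' f g) : ω = ω' := by
  have hG : G = G' := funext fun f => funext fun g => hG f g
  subst hG
  refine hΨ.functional_ext hω.continuous hω'.continuous fun n m f g => ?_
  by_cases hnm : n = m
  · subst hnm; rw [h.1, h'.1]
  · rw [h.2 n m f g hnm, h'.2 n m f g hnm]

/-- Wick's theorem for a state that is annihilated by the fields `Ψ (T f)` and by the adjoints of
the fields `Ψ (f - T f)`. -/
theorem IsCAR.quasiFree_of_annihilates (hΨ : IsCAR Ψ) (hω : IsState ω) (T : H → H)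
    (h1 : ∀ f a, ω (a * Ψ (T f)) = 0) (h2 : ∀ f a, ω (Ψ f * a) = ω (Ψ (T f) * a)) :
    QuasiFreeWith Ψ ω fun f g => inner ℂ g (T f) := by
  -- The first field is replaced by its annihilating part `Ψ (T (f 0))` and moved to the far right,
  -- where the state kills it. Only its contractions with the adjoint fields remain.
  have hrec : ∀ (n m : ℕ) (f : Fin (n + 1) → H) (g : Fin (m + 1) → H),
      ω (fieldProd Ψ f * star (fieldProd Ψ g)) = (-1 : ℂ) ^ n * ∑ j : Fin (m + 1),
        ((-1 : ℂ) ^ (m + (j : ℕ)) * inner ℂ (g j) (T (f 0))) *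
          ω (fieldProd Ψ (fun i => f i.succ) * star (fieldProd Ψ fun i => g (j.succAbove i))) := by
    intro n m f g
    rw [fieldProd_succ, mul_assoc, h2, ← mul_assoc, hΨ.mul_fieldProd, smul_mul_assoc, mul_assoc,
      hΨ.mul_star_fieldProd, map_smul, smul_eq_mul, mul_add, map_add, mul_smul_comm, map_smul,
      ← mul_assoc, h1, smul_zero, zero_add, Finset.mul_sum, map_sum]
    simp only [mul_smul_comm, map_smul, smul_eq_mul]
  have hleft : ∀ (n : ℕ) (f : Fin (n + 1) → H), ω (fieldProd Ψ f) = 0 := by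
    intro n f
    rw [fieldProd_succ, h2, hΨ.mul_fieldProd, map_smul, h1, smul_zero]
  refine ⟨fun n => ?_, fun n => ?_⟩
  · induction n with
    | zero => intro f g; simp [hω.1]
    | succ n ih =>
      intro f g
      -- For equal lengths the signs `(-1)^n` and `(-1)^(n+j)` combine to `(-1)^j`, so the recursion
      -- is the Laplace expansion along the first row.
      rw [hrec, Matrix.det_succ_row_zero, Finset.mul_sum]
      refine Finset.sum_congr rfl fun j _ => ?_
      rw [ih, pow_add, ← mul_assoc, ← mul_assoc, ← mul_assoc, ← mul_pow]
      simp only [mul_neg, mul_one, neg_neg, one_pow, one_mul]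
      rfl
  -- For different lengths each contraction shortens both products by one, until one of them is
  -- exhausted and the other gives zero.
  · induction n with
    | zero =>
      intro m f g hm
      obtain ⟨m, rfl⟩ := Nat.exists_eq_succ_of_ne_zero (Ne.symm hm)
      rw [fieldProd_zero, one_mul, hω.map_star, hleft, star_zero]
    | succ n ih =>
      intro m f g hm
      cases m with
      | zero => rw [fieldProd_zero, star_one, mul_one, hleft]
      | succ m =>
        rw [hrec, Finset.sum_eq_zero, mul_zero]
        intro j _
        rw [ih m _ _ (by omega), mul_zero]

/-- The state `ω` is a vacuum for the annihilation operators `Ψ (e k)`, `k ∈ σ`, and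
`(Ψ (e k))†`, `k ∉ σ`. -/
structure IsVacuum (Ψ : H →ₗ[ℂ] A) (e : K → H) (σ : Set K) (ω : A →ₗ[ℂ] ℂ) : Prop where
  isState : IsState ω
  annihilates : ∀ k ∈ σ, ω (star (Ψ (e k)) * Ψ (e k)) = 0
  star_annihilates : ∀ k ∉ σ, ω (Ψ (e k) * star (Ψ (e k))) = 0

/-- Orthonormality makes fields of distinct vectors anticommute with one another's adjoints, so
choosing either the field or its adjoint for each `k` gives an anticommuting family, which has a
common vacuum. -/
theorem IsCAR.exists_isVacuum (hΨ : IsCAR Ψ) (hA : ∃ ω : A →ₗ[ℂ] ℂ, IsState ω) {e : K → H}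
    (he : Orthonormal ℂ e) (σ : Set K) : ∃ ω, IsVacuum Ψ e σ ω := by
  classical
  let d : K → A := fun k => if k ∈ σ then Ψ (e k) else star (Ψ (e k))
  have hd1 : ∀ k ∈ σ, d k = Ψ (e k) := fun k hk => if_pos hk
  have hd2 : ∀ k ∉ σ, d k = star (Ψ (e k)) := fun k hk => if_neg hk
  obtain ⟨ω, hω, h⟩ := exists_state_of_anticommute d (fun k l => by
    by_cases hk : k ∈ σ <;> by_cases hl : l ∈ σ
    · rw [hd1 k hk, hd1 l hl, hΨ.anti]
    · rw [hd1 k hk, hd2 l hl, hΨ.anti_star, he.2 (fun h : l = k => hl (h ▸ hk)), zero_smul]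
    · rw [hd2 k hk, hd1 l hl, add_comm, hΨ.anti_star, he.2 (fun h : k = l => hk (h ▸ hl)), zero_smul]
    · rw [hd2 k hk, hd2 l hl, ← star_mul, ← star_mul, ← star_add, hΨ.anti, star_zero]) hA
  refine ⟨ω, hω, fun k hk => ?_, fun k hk => ?_⟩
  · rw [← hd1 k hk, h]
  · have := h k
    rwa [hd2 k hk, star_star] at this

theorem ext_of_dense_span {F : Type*} [NormedAddCommGroup F] [NormedSpace ℂ F] {e : K → H}
    (hd : (Submodule.span ℂ (Set.range e)).topologicalClosure = ⊤) {S T : H →L[ℂ] F}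
    (h : ∀ k, S (e k) = T (e k)) : S = T := by
  refine ContinuousLinearMap.ext_on (s := Set.range e) ?_ ?_
  · rw [dense_iff_closure_eq, ← Submodule.topologicalClosure_coe, hd]; rfl
  · rintro _ ⟨k, rfl⟩; exact h k

/-- The determinant is affine along rank-one perturbations. -/
theorem det_add_smul_vecMulVec {n : Type*} [Fintype n] [DecidableEq n] (M : Matrix n n ℂ)
    (u v : n → ℂ) (s : ℂ) :
    (M + s • Matrix.vecMulVec u v).det
      = s * (M + Matrix.vecMulVec u v).det + (1 - s) * M.det := by
  -- A bordered matrix with this determinant contains `t` in a single row only; linearity of the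
  -- determinant in that row is the claim.
  have h : ∀ t : ℂ, (M + t • Matrix.vecMulVec u v).det
      = ((Matrix.fromBlocks 1 0 (Matrix.replicateCol Unit u) M).updateRow (Sum.inl ())
          (Sum.elim (1 : Unit → ℂ) (0 : n → ℂ) + t • Sum.elim (0 : Unit → ℂ) (-v))).det := by
    intro t
    have e1 : (Matrix.fromBlocks 1 0 (Matrix.replicateCol Unit u) M).updateRow (Sum.inl ())
          (Sum.elim (1 : Unit → ℂ) (0 : n → ℂ) + t • Sum.elim (0 : Unit → ℂ) (-v))
        = Matrix.fromBlocks 1 (Matrix.replicateRow Unit (-(t • v))) (Matrix.replicateCol Unit u) M := by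
      ext i j
      rcases i with i | i <;> rcases j with j | j <;>
        simp [Matrix.updateRow_apply]
    rw [e1, Matrix.det_fromBlocks_one₁₁]
    congr 1
    ext i j
    simp [Matrix.vecMulVec_apply, Matrix.mul_apply]
    ring
  have h0 := h 0
  have h1 := h 1
  rw [h s]
  rw [zero_smul, add_zero, zero_smul, add_zero] at h0
  rw [one_smul, one_smul] at h1
  rw [Matrix.det_updateRow_add] at h1 ⊢
  rw [Matrix.det_updateRow_smul, h1, h0]
  ring

/-- The state in which two modes are independently in one of two vacua with probabilities `p₁, p₂`
and the corresponding complementary probabilities. -/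
def mixture (p₁ p₂ : ℝ) (ω : Fin 2 → Fin 2 → A →ₗ[ℂ] ℂ) : A →ₗ[ℂ] ℂ :=
  (p₁ : ℂ) • ((p₂ : ℂ) • ω 1 1 + ((1 - p₂ : ℝ) : ℂ) • ω 1 0)
    + ((1 - p₁ : ℝ) : ℂ) • ((p₂ : ℂ) • ω 0 1 + ((1 - p₂ : ℝ) : ℂ) • ω 0 0)

/-- The two-point functions of the four states differ by rank-one terms, along which determinants
are affine. Hence the average of the determinants is the determinant of the averaged two-point
function, although convex combinations of quasi-free states are not quasi-free in general. -/
theorem quasiFree_mixture {w : Fin 2 → Fin 2 → A →ₗ[ℂ] ℂ} {G : H → H → ℂ}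
    {u₁ v₁ u₂ v₂ : H → ℂ} (p₁ p₂ : ℝ)
    (h : ∀ i j : Fin 2, QuasiFreeWith Ψ (w i j)
      fun f g => G f g + ((i : ℕ) : ℂ) * (u₁ f * v₁ g) + ((j : ℕ) : ℂ) * (u₂ f * v₂ g)) :
    QuasiFreeWith Ψ (mixture p₁ p₂ w)
      fun f g => G f g + p₁ * (u₁ f * v₁ g) + p₂ * (u₂ f * v₂ g) := by
  refine ⟨fun n f g => ?_, fun n m f g hnm => ?_⟩
  · have hD : ∀ s t : ℂ, (Matrix.of fun i j : Fin n => G (f i) (g j) + s * (u₁ (f i) * v₁ (g j))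
        + t * (u₂ (f i) * v₂ (g j)))
        = (Matrix.of fun i j => G (f i) (g j))
          + s • Matrix.vecMulVec (fun i => u₁ (f i)) (fun j => v₁ (g j))
          + t • Matrix.vecMulVec (fun i => u₂ (f i)) (fun j => v₂ (g j)) := by
      intro s t; ext i j; simp [Matrix.vecMulVec_apply]
    simp only [mixture, LinearMap.add_apply, LinearMap.smul_apply, (h _ _).1, hD, smul_eq_mul]
    generalize (Matrix.of fun i j => G (f i) (g j)) = M
    have e : ∀ t : ℂ, M + (p₁ : ℂ) • Matrix.vecMulVec (fun i => u₁ (f i)) (fun j => v₁ (g j))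
          + t • Matrix.vecMulVec (fun i => u₂ (f i)) (fun j => v₂ (g j))
        = M + t • Matrix.vecMulVec (fun i => u₂ (f i)) (fun j => v₂ (g j))
          + (p₁ : ℂ) • Matrix.vecMulVec (fun i => u₁ (f i)) (fun j => v₁ (g j)) :=
      fun t => add_right_comm _ _ _
    rw [e, det_add_smul_vecMulVec _ _ _ (p₁ : ℂ),
      add_right_comm M ((p₂ : ℂ) • _), det_add_smul_vecMulVec _ _ _ (p₂ : ℂ), det_add_smul_vecMulVec _ _ _ (p₂ : ℂ)]
    simp
  · simp [mixture, (h _ _).2 n m f g hnm]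

theorem isState_mixture {w : Fin 2 → Fin 2 → A →ₗ[ℂ] ℂ} (hw : ∀ i j, IsState (w i j)) {p₁ p₂ : ℝ}
    (h₁ : p₁ ∈ Set.Icc 0 1) (h₂ : p₂ ∈ Set.Icc 0 1) : IsState (mixture p₁ p₂ w) :=
  ((hw 1 1).convex_comb (hw 1 0) h₂.1 h₂.2).convex_comb
    ((hw 0 1).convex_comb (hw 0 0) h₂.1 h₂.2) h₁.1 h₁.2

variable [CompleteSpace H]

/-- The orthogonal projection onto the closed span of the vectors `e k`, `k ∈ σ`. -/
def modeProjection (e : K → H) (σ : Set K) : H →L[ℂ] H :=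
  (Submodule.span ℂ (e '' σ)).topologicalClosure.starProjection

theorem modeProjection_of_mem (e : K → H) {σ : Set K} {k : K} (hk : k ∈ σ) :
    modeProjection e σ (e k) = e k :=
  Submodule.starProjection_eq_self_iff.2
    (Submodule.le_topologicalClosure _ (Submodule.subset_span ⟨k, hk, rfl⟩))

theorem modeProjection_of_notMem {e : K → H} (he : Orthonormal ℂ e) {σ : Set K} {k : K}
    (hk : k ∉ σ) : modeProjection e σ (e k) = 0 := by
  rw [modeProjection, Submodule.starProjection_apply_eq_zero_iff,
    Submodule.orthogonal_closure, Submodule.mem_orthogonal]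
  intro u hu
  induction hu using Submodule.span_induction with
  | mem x hx =>
    obtain ⟨l, hl, rfl⟩ := hx
    exact he.2 fun h => hk (h ▸ hl)
  | zero => simp
  | add x y _ _ hx hy => rw [inner_add_left, hx, hy, add_zero]
  | smul c x _ hx => rw [inner_smul_left, hx, mul_zero]

theorem modeProjection_insert {e : K → H} (he : Orthonormal ℂ e)
    (hd : (Submodule.span ℂ (Set.range e)).topologicalClosure = ⊤) {σ : Set K} {k : K}
    (hk : k ∉ σ) (f : H) :
    modeProjection e (insert k σ) f = modeProjection e σ f + (inner ℂ (e k) f : ℂ) • e k := by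
  have : modeProjection e (insert k σ)
      = modeProjection e σ + (innerSL ℂ (e k)).smulRight (e k) := by
    refine ext_of_dense_span hd fun l => ?_
    simp only [add_apply, ContinuousLinearMap.smulRight_apply,
      innerSL_apply_apply]
    by_cases hl : l = k
    · subst hl
      rw [modeProjection_of_mem e (Set.mem_insert _ _), modeProjection_of_notMem he hk,
        inner_self_eq_norm_sq_to_K, he.1]
      simp
    · rw [he.2 (Ne.symm hl), zero_smul, add_zero]
      by_cases hl' : l ∈ σ
      · rw [modeProjection_of_mem e hl', modeProjection_of_mem e (Set.mem_insert_of_mem _ hl')]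
      · rw [modeProjection_of_notMem he hl',
          modeProjection_of_notMem he (by simp [hl, hl'])]
  rw [this]; rfl

namespace IsVacuum

variable {e : K → H} {σ : Set K}

/-- Vacua are quasi-free. -/
theorem quasiFree (h : IsVacuum Ψ e σ ω) (hΨ : IsCAR Ψ) (he : Orthonormal ℂ e)
    (hd : (Submodule.span ℂ (Set.range e)).topologicalClosure = ⊤) :
    QuasiFreeWith Ψ ω fun f g => inner ℂ g (modeProjection e σ f) := by
  let Ψc : H →L[ℂ] A := ⟨Ψ, hΨ.continuous⟩
  let ωc : A →L[ℂ] ℂ := ⟨ω, h.isState.continuous⟩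
  refine hΨ.quasiFree_of_annihilates h.isState _ (fun f a => ?_) (fun f a => ?_)
  -- Both hypotheses of Wick's theorem are continuous and linear in `f`, so they need checking only
  -- on the vectors `e k`.
  · have : (ωc ∘L (ContinuousLinearMap.mul ℂ A a)) ∘L (Ψc ∘L modeProjection e σ) = 0 := by
      refine ext_of_dense_span hd fun k => ?_
      by_cases hk : k ∈ σ
      · change ω (a * Ψ (modeProjection e σ (e k))) = 0
        rw [modeProjection_of_mem e hk, h.isState.mul_eq_zero (h.annihilates k hk)]
      · change ω (a * Ψ (modeProjection e σ (e k))) = 0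
        rw [modeProjection_of_notMem he hk]; simp
    exact congrArg (fun S => S f) this
  · have : (ωc ∘L (ContinuousLinearMap.mul ℂ A).flip a) ∘L Ψc
        = (ωc ∘L (ContinuousLinearMap.mul ℂ A).flip a) ∘L (Ψc ∘L modeProjection e σ) := by
      refine ext_of_dense_span hd fun k => ?_
      change ω (Ψ (e k) * a) = ω (Ψ (modeProjection e σ (e k)) * a)
      by_cases hk : k ∈ σ
      · rw [modeProjection_of_mem e hk]
      · rw [modeProjection_of_notMem he hk, map_zero, zero_mul, map_zero]
        have h0 := h.star_annihilates k hk
        have := h.isState.star_mul_eq_zero (d := star (Ψ (e k))) (by rwa [star_star]) a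
        rwa [star_star] at this
    exact congrArg (fun S => S f) this

/-- The two-point function is the projection determined by `e` and `σ` alone, and it fixes all other
values. -/
theorem unique (h : IsVacuum Ψ e σ ω) (h' : IsVacuum Ψ e σ ω') (hΨ : IsCAR Ψ)
    (he : Orthonormal ℂ e) (hd : (Submodule.span ℂ (Set.range e)).topologicalClosure = ⊤) :
    ω = ω' :=
  hΨ.quasiFree_ext h.isState h'.isState (h.quasiFree hΨ he hd) (h'.quasiFree hΨ he hd)
    fun _ _ => rfl

/-- States whose occupation numbers tend to those of a vacuum converge to it pointwise. -/
theorem tendsto (h : IsVacuum Ψ e σ ω) (hΨ : IsCAR Ψ) (he : Orthonormal ℂ e)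
    (hd : (Submodule.span ℂ (Set.range e)).topologicalClosure = ⊤) {ι : Type*} {l : Filter ι}
    {w : ι → A →ₗ[ℂ] ℂ} (hw : ∀ i, IsState (w i))
    (h1 : ∀ k ∈ σ, Tendsto (fun i => w i (star (Ψ (e k)) * Ψ (e k))) l (𝓝 0))
    (h2 : ∀ k ∉ σ, Tendsto (fun i => w i (Ψ (e k) * star (Ψ (e k)))) l (𝓝 0)) (a : A) :
    Tendsto (fun i => w i a) l (𝓝 (ω a)) := by
  -- Compactness and uniqueness: along every ultrafilter the states have a limit, this limit is a
  -- vacuum for the same modes, and so it equals `ω`.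
  rw [tendsto_iff_ultrafilter]
  intro G hG
  obtain ⟨ω', hω', hlim⟩ := exists_tendsto_ultrafilter G w hw
  have : IsVacuum Ψ e σ ω' := ⟨hω', fun k hk => tendsto_nhds_unique (hlim _) ((h1 k hk).mono_left hG),
    fun k hk => tendsto_nhds_unique (hlim _) ((h2 k hk).mono_left hG)⟩
  rw [h.unique this hΨ he hd]
  exact hlim a

end IsVacuum

end Vacua

/-! ### Anticommutation relations on Fock space -/

section FockCAR

variable {ι : Type} [LinearOrder ι]

/-- The sign that a mode picks up from the occupied states that precede it. -/
def occupationSign (i : ι) (S : Finset ι) : ℂ := (-1) ^ (S.filter (· < i)).card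

theorem occupationSign_insert {i j : ι} {S : Finset ι} (hj : j ∉ S) :
    occupationSign i (insert j S) = (if j < i then -1 else 1) * occupationSign i S := by
  unfold occupationSign
  rw [Finset.filter_insert]
  split_ifs with h
  · rw [Finset.card_insert_of_notMem (by simp [hj]), pow_succ, mul_comm]
  · rw [one_mul]

theorem occupationSign_mul_self (i : ι) (S : Finset ι) :
    occupationSign i S * occupationSign i S = 1 := by
  unfold occupationSign
  rw [← mul_pow]; simp

theorem star_occupationSign (i : ι) (S : Finset ι) :
    star (occupationSign i S) = occupationSign i S := by
  unfold occupationSign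
  simp

theorem annihilate_apply (i : ι) (v : Fock ι) (S : Finset ι) :
    annihilate i v S = if i ∈ S then 0 else occupationSign i S * v (insert i S) := rfl

theorem annihilate_single (i : ι) (S : Finset ι) :
    annihilate i (lp.single 2 S (1 : ℂ))
      = if i ∈ S then occupationSign i (S.erase i) • lp.single 2 (S.erase i) (1 : ℂ) else 0 := by
  ext T
  rw [annihilate_apply]
  by_cases hS : i ∈ S
  · rw [if_pos hS, lp.coeFn_smul, Pi.smul_apply, lp.single_apply, lp.single_apply, Pi.single_apply,
      Pi.single_apply]
    by_cases hT : i ∈ T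
    · rw [if_pos hT, if_neg, smul_zero]
      rintro rfl; simp at hT
    · rw [if_neg hT]
      by_cases h : T = S.erase i
      · subst h; simp [Finset.insert_erase hS]
      · rw [if_neg h, if_neg, mul_zero, smul_zero]
        rintro rfl
        exact h (Finset.erase_insert hT).symm
  · rw [if_neg hS]
    by_cases hT : i ∈ T
    · rw [if_pos hT]; rfl
    · rw [if_neg hT, lp.single_apply, Pi.single_apply, if_neg, mul_zero]
      · rfl
      · rintro rfl; simp at hS

theorem star_annihilate_apply (i : ι) (v : Fock ι) (S : Finset ι) :
    star (annihilate i) v S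
      = if i ∈ S then occupationSign i (S.erase i) * v (S.erase i) else 0 := by
  have h : star (annihilate i) v S
      = inner ℂ (lp.single 2 S (1 : ℂ)) (star (annihilate i) v) := by
    rw [lp.inner_single_left]; simp
  rw [h, ContinuousLinearMap.star_eq_adjoint, ContinuousLinearMap.adjoint_inner_right,
    annihilate_single]
  split_ifs
  · rw [inner_smul_left, lp.inner_single_left, ← Complex.star_def, star_occupationSign]; simp
  · simp

/-- The Jordan–Wigner sign at work: of two different modes exactly one precedes the other, so
exactly one of the two orders of the operators picks up an additional sign. -/
theorem annihilate_isCARModes :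
    IsCARModes (annihilate : ι → Fock ι →L[ℂ] Fock ι) where
  anti i j := by
    ext v S
    change annihilate i (annihilate j v) S + annihilate j (annihilate i v) S = 0
    simp only [annihilate_apply, Finset.mem_insert]
    by_cases hi : i ∈ S
    · simp [hi]
    by_cases hj : j ∈ S
    · simp [hj]
    by_cases hij : i = j
    · subst hij; simp
    simp only [hi, hj, hij, Ne.symm hij, or_false, if_false]
    rw [occupationSign_insert hi, occupationSign_insert hj, Finset.insert_comm j i]
    rcases lt_or_gt_of_ne hij with h | h
    · rw [if_pos h, if_neg h.le.not_gt]; ring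
    · rw [if_neg h.le.not_gt, if_pos h]; ring
  anti_star i j := by
    ext v S
    have key : annihilate i (star (annihilate j) v) S + star (annihilate j) (annihilate i v) S
        = if i = j then v S else 0 := by
      simp only [annihilate_apply, star_annihilate_apply, Finset.mem_insert, Finset.mem_erase]
      by_cases hij : i = j
      · subst hij
        by_cases hi : i ∈ S
        · simp only [hi, Finset.insert_erase hi]
          simp [← mul_assoc, occupationSign_mul_self]
        · simp only [hi, Finset.erase_insert hi]
          simp [← mul_assoc, occupationSign_mul_self]
      · by_cases hi : i ∈ S
        · simp [hi, hij]
        by_cases hj : j ∈ S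
        · simp only [hi, hj, hij, Ne.symm hij, or_true, and_false, if_true, if_false]
          have h1 : (insert i S).erase j = insert i (S.erase j) :=
            Finset.erase_insert_of_ne hij
          have h2 : i ∉ S.erase j := by simp [hi]
          have h3 : occupationSign i S
              = (if j < i then -1 else 1) * occupationSign i (S.erase j) := by
            rw [← occupationSign_insert (Finset.notMem_erase j S), Finset.insert_erase hj]
          rw [h1, h3, occupationSign_insert h2]
          rcases lt_or_gt_of_ne hij with h | h
          · rw [if_pos h, if_neg h.le.not_gt]; ring
          · rw [if_neg h.le.not_gt, if_pos h]; ring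
        · simp [hj, hij, Ne.symm hij]
    change annihilate i (star (annihilate j) v) S + star (annihilate j) (annihilate i v) S = _
    rw [key]
    split_ifs <;> rfl

end FockCAR

/-! ### Transformations of modes -/

section Transform

variable {A : Type*} [CStarAlgebra A] {J K : Type*} [DecidableEq J] [DecidableEq K]

/-- The relations are symmetric under exchanging a mode with its adjoint. Injectivity of the
labelling makes the mixed anticommutators vanish. -/
theorem IsCARModes.polarize {c : J → A} (hc : IsCARModes c) {l : K → J}
    (hl : Function.Injective l) (σ : K → Prop) [DecidablePred σ] :
    IsCARModes fun k => if σ k then c (l k) else star (c (l k)) where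
  anti k k' := by
    have h0 : ∀ k k', σ k → ¬ σ k' → c (l k) * star (c (l k')) + star (c (l k')) * c (l k) = 0 := by
      intro k k' hk hk'
      rw [hc.anti_star, if_neg]
      exact fun h => hk' (hl h ▸ hk)
    by_cases hk : σ k <;> by_cases hk' : σ k' <;> simp only [hk, hk', if_true, if_false]
    · rw [hc.anti]
    · exact h0 k k' hk hk'
    · rw [add_comm, h0 k' k hk' hk]
    · rw [← star_mul, ← star_mul, ← star_add, hc.anti, star_zero]
  anti_star k k' := by
    by_cases hk : σ k <;> by_cases hk' : σ k' <;> simp only [hk, hk', if_true, if_false]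
    · rw [hc.anti_star]; simp [hl.eq_iff]
    · rw [star_star, hc.anti, if_neg]; exact fun h => hk' (h ▸ hk)
    · rw [← star_mul, ← star_mul, ← star_add, hc.anti, star_zero, if_neg]
      exact fun h => hk (h ▸ hk')
    · rw [star_star, add_comm, hc.anti_star]; simp [hl.eq_iff, eq_comm]

/-- Mixing the two members of each pair of vectors `e (0, n), e (1, n)` by a matrix. -/
def blockRotate {N : Type*} {E : Type*} [AddCommMonoid E] [Module ℂ E]
    (U : N → Matrix (Fin 2) (Fin 2) ℂ) (e : Fin 2 × N → E) (q : Fin 2 × N) : E :=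
  ∑ b, U q.2 q.1 b • e (b, q.2)

theorem map_blockRotate {N E F : Type*} [AddCommGroup E] [Module ℂ E] [AddCommGroup F] [Module ℂ F]
    (Ψ : E →ₗ[ℂ] F) (U : N → Matrix (Fin 2) (Fin 2) ℂ) (e : Fin 2 × N → E) (q : Fin 2 × N) :
    Ψ (blockRotate U e q) = blockRotate U (fun q => Ψ (e q)) q := by
  simp [blockRotate]

theorem sum_mul_star_of_unitary {U : Matrix (Fin 2) (Fin 2) ℂ}
    (hU : U ∈ Matrix.unitaryGroup (Fin 2) ℂ) (a a' : Fin 2) :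
    ∑ b, U a b * star (U a' b) = if a = a' then 1 else 0 := by
  have h := congrFun (congrFun (Matrix.mem_unitaryGroup_iff.1 hU) a) a'
  rwa [Matrix.mul_apply, Matrix.one_apply] at h

theorem IsCARModes.blockRotate {N : Type*} [DecidableEq N] {χ : Fin 2 × N → A}
    (hχ : IsCARModes χ) {U : N → Matrix (Fin 2) (Fin 2) ℂ}
    (hU : ∀ n, U n ∈ Matrix.unitaryGroup (Fin 2) ℂ) : IsCARModes (blockRotate U χ) where
  anti q r := by
    simp only [DiracCylinder.blockRotate, Finset.sum_mul_sum]
    rw [Finset.sum_comm (s := Finset.univ (α := Fin 2)) (t := Finset.univ), ← Finset.sum_add_distrib]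
    refine Finset.sum_eq_zero fun b _ => ?_
    rw [← Finset.sum_add_distrib]
    refine Finset.sum_eq_zero fun b' _ => ?_
    rw [smul_mul_smul_comm, smul_mul_smul_comm, mul_comm (U r.2 _ _), ← smul_add, hχ.anti, smul_zero]
  anti_star q r := by
    simp only [DiracCylinder.blockRotate, star_sum, star_smul, Finset.sum_mul_sum]
    rw [Finset.sum_comm (s := Finset.univ (α := Fin 2)) (t := Finset.univ), ← Finset.sum_add_distrib]
    have h : ∀ b' b : Fin 2, U q.2 q.1 b • χ (b, q.2) * star (U r.2 r.1 b') • star (χ (b', r.2))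
        + star (U r.2 r.1 b') • star (χ (b', r.2)) * U q.2 q.1 b • χ (b, q.2)
        = if b = b' then (if q.2 = r.2 then (U q.2 q.1 b * star (U r.2 r.1 b)) • (1 : A) else 0)
          else 0 := by
      intro b' b
      rw [smul_mul_smul_comm, smul_mul_smul_comm, mul_comm (star _), ← smul_add, hχ.anti_star]
      by_cases h1 : b = b'
      · subst h1
        by_cases h2 : q.2 = r.2 <;> simp [h2]
      · simp [h1]
    simp only [← Finset.sum_add_distrib, h]
    simp only [Finset.sum_ite_eq', Finset.mem_univ, if_true]
    by_cases h2 : q.2 = r.2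
    · simp only [h2, if_true, ← Finset.sum_smul, sum_mul_star_of_unitary (hU r.2)]
      by_cases h1 : q.1 = r.1
      · rw [if_pos h1, if_pos (Prod.ext h1 h2), one_smul]
      · rw [if_neg h1, if_neg (fun h => h1 (congrArg Prod.fst h)), zero_smul]
    · simp only [h2, if_false, Finset.sum_const_zero]
      rw [if_neg (fun h => h2 (congrArg Prod.snd h))]

theorem Orthonormal.blockRotate {N H : Type*} [DecidableEq N] [NormedAddCommGroup H]
    [InnerProductSpace ℂ H] {e : Fin 2 × N → H} (he : Orthonormal ℂ e)
    {U : N → Matrix (Fin 2) (Fin 2) ℂ} (hU : ∀ n, U n ∈ Matrix.unitaryGroup (Fin 2) ℂ) :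
    Orthonormal ℂ (blockRotate U e) := by
  rw [orthonormal_iff_ite] at he ⊢
  intro q r
  simp only [DiracCylinder.blockRotate, sum_inner, inner_sum, inner_smul_left, inner_smul_right, he]
  by_cases h2 : q.2 = r.2
  · have h3 := sum_mul_star_of_unitary (hU r.2) r.1 q.1
    simp only [h2, and_true, mul_ite, mul_one, mul_zero,
      Finset.sum_ite_eq', Finset.mem_univ, if_true, Prod.ext_iff]
    simp only [eq_comm (a := r.1)] at h3
    exact h3
  · simp [h2, Prod.ext_iff]

theorem span_blockRotate {N H : Type*} [AddCommGroup H] [Module ℂ H] (e : Fin 2 × N → H)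
    {U : N → Matrix (Fin 2) (Fin 2) ℂ} (hU : ∀ n, U n ∈ Matrix.unitaryGroup (Fin 2) ℂ) :
    Submodule.span ℂ (Set.range e) ≤ Submodule.span ℂ (Set.range (blockRotate U e)) := by
  rw [Submodule.span_le]
  rintro _ ⟨⟨a, n⟩, rfl⟩
  have h : e (a, n) = ∑ c, star (U n c a) • blockRotate U e (c, n) := by
    simp only [blockRotate, Finset.smul_sum, smul_smul]
    rw [Finset.sum_comm]
    simp only [← Finset.sum_smul]
    have h1 : ∀ b, ∑ c, star (U n c a) * U n c b = if a = b then 1 else 0 := by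
      intro b
      have h := congrFun (congrFun (Matrix.mem_unitaryGroup_iff'.1 (hU n)) a) b
      rwa [Matrix.mul_apply, Matrix.one_apply] at h
    simp only [h1, ite_smul, one_smul, zero_smul, Finset.sum_ite_eq, Finset.mem_univ, if_true]
  rw [SetLike.mem_coe, h]
  exact sum_mem fun c _ => Submodule.smul_mem _ _ (Submodule.subset_span ⟨_, rfl⟩)

theorem dense_blockRotate {N H : Type*} [NormedAddCommGroup H] [InnerProductSpace ℂ H]
    {e : Fin 2 × N → H} (hd : (Submodule.span ℂ (Set.range e)).topologicalClosure = ⊤)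
    {U : N → Matrix (Fin 2) (Fin 2) ℂ} (hU : ∀ n, U n ∈ Matrix.unitaryGroup (Fin 2) ℂ) :
    (Submodule.span ℂ (Set.range (blockRotate U e))).topologicalClosure = ⊤ :=
  top_le_iff.1 (hd ▸ Submodule.topologicalClosure_mono (span_blockRotate e hU))

end Transform

/-! ### The basis of plane waves -/

theorem BC.mode_eq_add (bc : BC) : ∃ s : ℝ, ∀ n, bc.mode n = n + s := by
  cases bc
  · exact ⟨0, fun n => by simp [BC.mode]⟩
  · exact ⟨1 / 2, fun n => rfl⟩

theorem inner_planeWaveFun (L p : ℝ) (u : Lp ℂ 2 (circleMeasure L)) :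
    inner ℂ ((planeWaveFun_memLp L p).toLp) u = fourierCoefficient L p u := by
  rw [L2.inner_def, fourierCoefficient, ← integral_const_mul]
  refine integral_congr_ae ?_
  filter_upwards [(planeWaveFun_memLp L p).coeFn_toLp] with x hx
  rw [hx, RCLike.inner_apply, planeWaveFun]
  simp only [map_mul, Complex.conj_ofReal, ← Complex.exp_conj, map_neg, Complex.conj_I, neg_neg]
  ring

theorem integral_exp_period {L : ℝ} (hL : 0 < L) (k : ℤ) :
    ∫ x in Set.Icc 0 L, Complex.exp (Complex.I * ((2 * Real.pi * k / L * x : ℝ) : ℂ))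
      = if k = 0 then (L : ℂ) else 0 := by
  rw [integral_Icc_eq_integral_Ioc, ← intervalIntegral.integral_of_le hL.le]
  split_ifs with h
  · subst h; simp
  · have hc : (Complex.I * (2 * Real.pi * k / L : ℝ) : ℂ) ≠ 0 := by
      have : (2 * Real.pi * k / L : ℝ) ≠ 0 := by
        have : (k : ℝ) ≠ 0 := by exact_mod_cast h
        have := Real.pi_ne_zero
        positivity
      exact mul_ne_zero Complex.I_ne_zero (by exact_mod_cast this)
    have h1 : ∀ x : ℝ, Complex.I * ((2 * Real.pi * k / L * x : ℝ) : ℂ)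
        = (Complex.I * (2 * Real.pi * k / L : ℝ) : ℂ) * x := by
      intro x; push_cast; ring
    simp only [h1]
    rw [integral_exp_mul_complex hc]
    have h2 : (Complex.I * (2 * Real.pi * k / L : ℝ) : ℂ) * (L : ℂ)
        = k * (2 * Real.pi * Complex.I) := by
      have : (L : ℂ) ≠ 0 := by exact_mod_cast hL.ne'
      push_cast; field_simp
    rw [h2, Complex.exp_int_mul_two_pi_mul_I]
    simp

theorem fourierCoefficient_planeWaveFun {L : ℝ} (hL : 0 < L) (bc : BC) (n m : ℤ) :
    fourierCoefficient L (bc.mode n) ((planeWaveFun_memLp L (bc.mode m)).toLp)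
      = if n = m then 1 else 0 := by
  obtain ⟨s, hs⟩ := bc.mode_eq_add
  have h : ∫ x in Set.Icc 0 L,
        ((planeWaveFun_memLp L (bc.mode m)).toLp (planeWaveFun L (bc.mode m)) : ℝ → ℂ) x *
        Complex.exp (Complex.I * ((2 * Real.pi * bc.mode n / L * x : ℝ) : ℂ))
      = ((1 / √L : ℝ) : ℂ) * if n - m = 0 then (L : ℂ) else 0 := by
    rw [← integral_exp_period hL, ← integral_const_mul]
    refine integral_congr_ae ?_
    filter_upwards [(planeWaveFun_memLp L (bc.mode m)).coeFn_toLp] with x hx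
    rw [hx, planeWaveFun, mul_assoc, ← Complex.exp_add, hs, hs]
    congr 2
    push_cast; ring
  rw [fourierCoefficient, h]
  have hr : ((1 / √L : ℝ) : ℂ) * (((1 / √L : ℝ) : ℂ) * (L : ℂ)) = 1 := by
    have : (1 / √L) * ((1 / √L) * L) = 1 := by
      have := Real.sq_sqrt hL.le
      have h0 : √L ≠ 0 := (Real.sqrt_pos.2 hL).ne'
      field_simp; linarith
    exact_mod_cast this
  by_cases hnm : n = m
  · rw [if_pos hnm, if_pos (sub_eq_zero.2 hnm), hr]
  · rw [if_neg hnm, if_neg (sub_ne_zero.2 hnm)]; simp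

/-- Multiplication by the phase `e^{2πisx/L}`, with `s` the shift of the mode numbers, reduces
half-integer modes to integer ones and preserves moduli. Parseval for ordinary Fourier series then
gives completeness for both boundary conditions. -/
theorem eq_zero_of_fourierCoefficient {L : ℝ} (hL : 0 < L) (bc : BC)
    (u : Lp ℂ 2 (circleMeasure L)) (h : ∀ n, fourierCoefficient L (bc.mode n) u = 0) : u = 0 := by
  obtain ⟨s, hs⟩ := bc.mode_eq_add
  let v : ℝ → ℂ := fun x => u x * Complex.exp (Complex.I * ((2 * Real.pi * s / L * x : ℝ) : ℂ))
  have hnorm : ∀ x, ‖v x‖ = ‖u x‖ := by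
    intro x
    simp [v, Complex.norm_exp]
  have hmeas : circleMeasure L = volume.restrict (Set.Ioc 0 L) :=
    Measure.restrict_congr_set Ioc_ae_eq_Icc.symm
  have hv : MemLp v 2 (circleMeasure L) := by
    refine (Lp.memLp u).of_le ?_ (Eventually.of_forall fun x => (hnorm x).le)
    refine (Lp.aestronglyMeasurable u).mul (Continuous.aestronglyMeasurable ?_)
    fun_prop
  have h1 := hasSum_sq_fourierCoeffOn hL (hmeas ▸ hv)
  have h2 : ∀ n, fourierCoeffOn hL v n = 0 := by
    intro n
    rw [fourierCoeffOn_eq_integral, intervalIntegral.integral_of_le hL.le,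
      ← integral_Icc_eq_integral_Ioc]
    -- The coefficients here carry `e^{+2πinx/L}`, those of `fourierCoeffOn` the opposite sign.
    have h3 := h (-n)
    rw [fourierCoefficient, mul_eq_zero] at h3
    have h4 : ((1 / √L : ℝ) : ℂ) ≠ 0 := by
      have := Real.sqrt_pos.2 hL
      exact_mod_cast (by positivity : (0 : ℝ) < 1 / √L).ne'
    rw [show (∫ x in Set.Icc 0 L, fourier (-n) (x : AddCircle (L - 0)) • v x) = 0 from ?_, smul_zero]
    rw [← h3.resolve_left h4]
    refine integral_congr_ae (Eventually.of_forall fun x => ?_)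
    simp only [v, fourier_coe_apply, smul_eq_mul, hs]
    rw [mul_left_comm, ← Complex.exp_add]
    congr 2
    push_cast; ring
  simp only [h2, norm_zero, ne_eq, OfNat.ofNat_ne_zero, not_false_eq_true, zero_pow] at h1
  have h3 : ∫ x in (0 : ℝ)..L, ‖v x‖ ^ 2 = 0 := by
    have := h1.unique hasSum_zero
    rw [smul_eq_mul, mul_eq_zero] at this
    exact this.resolve_left (by simp [hL.ne'])
  rw [intervalIntegral.integral_of_le hL.le, ← integral_Icc_eq_integral_Ioc] at h3
  simp only [hnorm] at h3
  have h4 : (inner ℂ u u : ℂ) = 0 := by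
    rw [L2.inner_def]
    have : ∀ x, (inner ℂ (u x) (u x) : ℂ) = ((‖u x‖ ^ 2 : ℝ) : ℂ) := by
      intro x
      rw [inner_self_eq_norm_sq_to_K]; simp
    simp only [this]
    rw [integral_complex_ofReal, h3, Complex.ofReal_zero]
  exact inner_self_eq_zero.1 h4

/-- The plane waves as vectors indexed by chirality and mode label. -/
def waves (L : ℝ) (bc : BC) (q : Fin 2 × ℤ) : OneParticle L := planeWave L q.1 (bc.mode q.2)

theorem inner_waves (L : ℝ) (bc : BC) (q : Fin 2 × ℤ) (f : OneParticle L) :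
    inner ℂ (waves L bc q) f = fourierCoefficient L (bc.mode q.2) (f q.1) := by
  rw [PiLp.inner_apply, Finset.sum_eq_single q.1]
  · rw [← inner_planeWaveFun, waves, planeWave]
    simp
  · intro b _ hb
    simp [waves, planeWave, hb]
  · simp

theorem orthonormal_waves {L : ℝ} (hL : 0 < L) (bc : BC) : Orthonormal ℂ (waves L bc) := by
  rw [orthonormal_iff_ite]
  intro q r
  rw [inner_waves, waves, planeWave]
  by_cases h1 : q.1 = r.1
  · rw [h1]
    simp only [Pi.single_eq_same]
    rw [fourierCoefficient_planeWaveFun hL]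
    simp [Prod.ext_iff, h1]
  · rw [if_neg (fun h => h1 (congrArg Prod.fst h))]
    simp only [Pi.single_apply, h1, if_false]
    rw [← inner_planeWaveFun, inner_zero_right]

theorem orthogonal_waves {L : ℝ} (hL : 0 < L) (bc : BC) :
    (Submodule.span ℂ (Set.range (waves L bc)))ᗮ = ⊥ := by
  rw [eq_bot_iff]
  intro f hf
  rw [Submodule.mem_bot]
  ext1 a
  refine eq_zero_of_fourierCoefficient hL bc _ fun n => ?_
  rw [← inner_waves L bc (a, n) f]
  exact (Submodule.mem_orthogonal _ _).1 hf _ (Submodule.subset_span ⟨_, rfl⟩)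

/-- The Hilbert basis of plane waves. -/
def waveBasis {L : ℝ} (hL : 0 < L) (bc : BC) : HilbertBasis (Fin 2 × ℤ) ℂ (OneParticle L) :=
  HilbertBasis.mkOfOrthogonalEqBot (orthonormal_waves hL bc) (orthogonal_waves hL bc)

theorem coe_waveBasis {L : ℝ} (hL : 0 < L) (bc : BC) : ⇑(waveBasis hL bc) = waves L bc :=
  HilbertBasis.coe_mkOfOrthogonalEqBot _ _

theorem waveBasis_repr {L : ℝ} (hL : 0 < L) (bc : BC) (f : OneParticle L) (q : Fin 2 × ℤ) :
    (waveBasis hL bc).repr f q = fourierCoefficient L (bc.mode q.2) (f q.1) := by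
  rw [HilbertBasis.repr_apply_apply, coe_waveBasis, inner_waves]

theorem dense_waves {L : ℝ} (hL : 0 < L) (bc : BC) :
    (Submodule.span ℂ (Set.range (waves L bc))).topologicalClosure = ⊤ := by
  have := (waveBasis hL bc).dense_span
  rwa [coe_waveBasis] at this

/-! ### The modes on Fock space -/

/-- The one-particle labels of the modes. -/
def modeLabel (bc : BC) (q : Fin 2 × ℤ) : Label :=
  if (q.1 = 0 ∧ bc.mode q.2 ≤ 0) ∨ (q.1 = 1 ∧ 0 < bc.mode q.2) then toLex (0, q.2)
  else toLex (1, bc.neg q.2)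

/-- The modes that annihilate particles. -/
def particleModes (bc : BC) : Set (Fin 2 × ℤ) :=
  {q | (q.1 = 0 ∧ bc.mode q.2 ≤ 0) ∨ (q.1 = 1 ∧ 0 < bc.mode q.2)}

theorem BC.mode_neg (bc : BC) (n : ℤ) : bc.mode (bc.neg n) = - bc.mode n := by
  cases bc
  · simp [BC.mode, BC.neg]
  · simp [BC.mode, BC.neg]; ring

theorem BC.neg_neg (bc : BC) (n : ℤ) : bc.neg (bc.neg n) = n := by
  cases bc <;> simp [BC.neg]

theorem BC.neg_of_mode_eq_zero {bc : BC} {n : ℤ} (h : bc.mode n = 0) : bc.neg n = n := by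
  obtain ⟨s, hs⟩ := bc.mode_eq_add
  have h1 := bc.mode_neg n
  rw [h, neg_zero, hs] at h1
  rw [hs] at h
  exact_mod_cast add_right_cancel (h1.trans h.symm)

/-- Within each species a mode number occurs for one chirality only. The conditions `≤ 0` and `0 <`
are complementary, so that also the zero label is used once per species. -/
theorem modeLabel_injective (bc : BC) : Function.Injective (modeLabel bc) := by
  rintro ⟨a, n⟩ ⟨b, m⟩ h
  have hne : ∀ k l : ℤ, (toLex ((0 : Fin 2), k) : Label) ≠ toLex ((1 : Fin 2), l) := by
    intro k l h
    have := congrArg Prod.fst (toLex_inj.1 h)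
    simp at this
  unfold modeLabel at h
  split_ifs at h with h1 h2 h2
  · have h3 : n = m := congrArg Prod.snd (toLex_inj.1 h)
    subst h3
    rcases h1 with ⟨rfl, h1⟩ | ⟨rfl, h1⟩ <;> rcases h2 with ⟨rfl, h2⟩ | ⟨rfl, h2⟩ <;>
      first | rfl | (exfalso; simp only at h1 h2; linarith)
  · exact absurd h (hne _ _)
  · exact absurd h.symm (hne _ _)
  · have h3 : n = m := by
      have := congrArg Prod.snd (toLex_inj.1 h)
      simp only at this
      rw [← bc.neg_neg n, this, bc.neg_neg]
    subst h3
    simp only [not_or, not_and, not_le, not_lt] at h1 h2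
    fin_cases a <;> fin_cases b <;> simp_all
    all_goals linarith

open Classical in
/-- The annihilation operators of particles and the creation operators of antiparticles. -/
def bareModes (bc : BC) (q : Fin 2 × ℤ) : Op :=
  if q ∈ particleModes bc then annihilate (modeLabel bc q) else star (annihilate (modeLabel bc q))

theorem bareModes_isCARModes (bc : BC) : IsCARModes (bareModes bc) := by
  classical
  have := (annihilate_isCARModes (ι := Label)).polarize (modeLabel_injective bc)
    (· ∈ particleModes bc)
  convert! this

/-- The mixing of particles and antiparticles in the zero modes. -/
def zeroModeMatrix : Matrix (Fin 2) (Fin 2) ℂ :=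
  ((1 / √2 : ℝ) : ℂ) • !![1, 1; Complex.I, -Complex.I]

theorem inv_sqrt_two_mul_self : ((1 / √2 : ℝ) : ℂ) * ((1 / √2 : ℝ) : ℂ) = 1 / 2 := by
  have : (1 / √2) * (1 / √2) = (1 / 2 : ℝ) := by
    rw [div_mul_div_comm, one_mul, Real.mul_self_sqrt (by norm_num)]
  rw [← Complex.ofReal_mul, this]
  norm_num

theorem zeroModeMatrix_mem : zeroModeMatrix ∈ Matrix.unitaryGroup (Fin 2) ℂ := by
  rw [Matrix.mem_unitaryGroup_iff, zeroModeMatrix, star_smul, smul_mul_smul_comm,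
    Complex.star_def, Complex.conj_ofReal, inv_sqrt_two_mul_self]
  ext i j
  rw [Matrix.smul_apply, Matrix.mul_apply, Fin.sum_univ_two, Matrix.star_apply, Matrix.star_apply]
  fin_cases i <;> fin_cases j <;> simp <;> norm_num

/-- The mixing matrices of the modes. -/
def mixing (bc : BC) (n : ℤ) : Matrix (Fin 2) (Fin 2) ℂ :=
  if bc.mode n = 0 then zeroModeMatrix else 1

theorem mixing_mem (bc : BC) (n : ℤ) : mixing bc n ∈ Matrix.unitaryGroup (Fin 2) ℂ := by
  unfold mixing
  split_ifs
  · exact zeroModeMatrix_mem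
  · exact one_mem _

/-- Writes the field modes as a particle-hole exchange followed by a unitary mixing that is trivial
except at the zero modes; both operations preserve the anticommutation relations. -/
theorem fockPsi_eq (bc : BC) (q : Fin 2 × ℤ) :
    fockPsi bc q.1 q.2 = blockRotate (mixing bc) (bareModes bc) q := by
  obtain ⟨a, n⟩ := q
  rw [blockRotate, Fin.sum_univ_two]
  rcases lt_trichotomy (bc.mode n) 0 with h | h | h
  · have h1 : mixing bc n = 1 := if_neg h.ne
    have h2 := h.le
    have h3 := h.not_gt
    fin_cases a <;> simp [fockPsi, h1, h, bareModes, particleModes, modeLabel, h2, h3, fockA, fockB]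
  · have h1 : mixing bc n = zeroModeMatrix := if_pos h
    have h2 := BC.neg_of_mode_eq_zero h
    fin_cases a
    · simp [fockPsi, h1, h, bareModes, particleModes, modeLabel, h2, fockA, fockB, zeroModeMatrix]
    · simp [fockPsi, h1, h, bareModes, particleModes, modeLabel, h2, fockA, fockB, zeroModeMatrix,
        mul_comm, sub_eq_add_neg]
  · have h1 : mixing bc n = 1 := if_neg h.ne'
    have h2 := h.not_ge
    have h3 := h.not_gt
    fin_cases a <;>
      simp [fockPsi, h1, h, bareModes, particleModes, modeLabel, h2, h3, h.ne', fockA, fockB]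

theorem fockPsi_isCARModes (bc : BC) : IsCARModes fun q : Fin 2 × ℤ => fockPsi bc q.1 q.2 := by
  have := (bareModes_isCARModes bc).blockRotate (mixing_mem bc)
  rwa [← funext (fockPsi_eq bc)] at this

/-! ### The field algebra -/

instance isClosed_carAlgebra (L : ℝ) (bc : BC) : IsClosed (carAlgebra L bc : Set Op) :=
  StarSubalgebra.isClosed_topologicalClosure _

theorem fieldOp_eq_smear {L : ℝ} (hL : 0 < L) (bc : BC) (f : OneParticle L) :
    fieldOp L bc f = smear (fockPsi_isCARModes bc) (waveBasis hL bc) f := by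
  simp only [fieldOp, smear, LinearMap.coe_mk, AddHom.coe_mk, waveBasis_repr]

/-- The smeared field as a linear map into the field algebra. -/
def fieldMap {L : ℝ} (hL : 0 < L) (bc : BC) : OneParticle L →ₗ[ℂ] carAlgebra L bc where
  toFun := field L bc
  map_add' f g := Subtype.ext (by
    change fieldOp L bc (f + g) = fieldOp L bc f + fieldOp L bc g
    simp only [fieldOp_eq_smear hL, map_add])
  map_smul' c f := Subtype.ext (by
    change fieldOp L bc (c • f) = c • fieldOp L bc f
    simp only [fieldOp_eq_smear hL, map_smul])

theorem fieldMap_isCAR {L : ℝ} (hL : 0 < L) (bc : BC) : IsCAR (fieldMap hL bc) where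
  anti f g := Subtype.ext (by
    change fieldOp L bc f * fieldOp L bc g + fieldOp L bc g * fieldOp L bc f = 0
    simp only [fieldOp_eq_smear hL, smear_anti])
  anti_star f g := Subtype.ext (by
    change fieldOp L bc f * star (fieldOp L bc g) + star (fieldOp L bc g) * fieldOp L bc f
      = (inner ℂ g f : ℂ) • (1 : Op)
    simp only [fieldOp_eq_smear hL, smear_anti_star])
  dense := by
    rw [eq_top_iff]
    intro x _
    have hmap := StarAlgHom.map_adjoin (carAlgebra L bc).subtype (Set.range (fieldMap hL bc))
    rw [← Set.range_comp] at hmap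
    rw [← SetLike.mem_coe, StarSubalgebra.topologicalClosure_coe, closure_subtype]
    have hx : (x : Op) ∈ closure (StarAlgebra.adjoin ℂ (Set.range (fieldOp L bc)) : Set Op) := x.2
    have e : ((↑) '' (StarAlgebra.adjoin ℂ (Set.range (fieldMap hL bc)) : Set (carAlgebra L bc)))
        = (StarAlgebra.adjoin ℂ (Set.range (fieldOp L bc)) : Set Op) :=
      congrArg (fun S : StarSubalgebra ℂ Op => (S : Set Op)) hmap
    rw [e]
    exact hx

/-! ### States of the Dirac field and their energy -/

theorem isQuasiFree_iff {L : ℝ} (hL : 0 < L) {bc : BC} {ω : Functional L bc} :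
    IsQuasiFree ω ↔ QuasiFreeWith (fieldMap hL bc) ω (twoPoint ω) := Iff.rfl

theorem QuasiFreeWith.isQuasiFree {L : ℝ} {hL : 0 < L} {bc : BC} {ω : Functional L bc}
    {G : OneParticle L → OneParticle L → ℂ} (h : QuasiFreeWith (fieldMap hL bc) ω G) :
    IsQuasiFree ω := by
  have hG : G = DiracCylinder.twoPoint ω := funext fun f => funext fun g => (h.twoPoint f g).symm
  subst hG
  exact (isQuasiFree_iff hL).2 h

theorem coe_psi {L : ℝ} (hL : 0 < L) (bc : BC) (q : Fin 2 × ℤ) :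
    (psi L bc q.1 q.2 : Op) = fockPsi bc q.1 q.2 := by
  change fieldOp L bc (waves L bc q) = _
  rw [fieldOp_eq_smear hL]
  refine (smear_hasSum (fockPsi_isCARModes bc) (waveBasis hL bc) _).unique ?_
  refine (hasSum_ite_eq q (fockPsi bc q.1 q.2)).congr_fun fun r => ?_
  rw [HilbertBasis.repr_apply_apply, coe_waveBasis,
    orthonormal_iff_ite.1 (orthonormal_waves hL bc)]
  split_ifs with h
  · rw [one_smul, h]
  · rw [zero_smul]

/-- All modes of nonvanishing energy are in their ground states. -/
structure HasZeroEnergy {L : ℝ} {bc : BC} (ω : Functional L bc) : Prop where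
  isState : IsState ω
  annihilates : ∀ q ∈ particleModes bc, bc.mode q.2 ≠ 0 →
    ω (star (psi L bc q.1 q.2) * psi L bc q.1 q.2) = 0
  star_annihilates : ∀ q ∉ particleModes bc, bc.mode q.2 ≠ 0 →
    ω (psi L bc q.1 q.2 * star (psi L bc q.1 q.2)) = 0

/-- A sum of nonnegative terms vanishes only termwise. The rest translates the operators `a_n`,
`b_n` into the field modes. -/
theorem energy_eq_zero_iff {L : ℝ} (hL : 0 < L) {bc : BC} {ω : Functional L bc} (hω : IsState ω) :
    energy ω = 0 ↔ HasZeroEnergy ω := by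
  have h1 : energy ω = 0 ↔ ∀ n, bc.mode n ≠ 0 →
      ω (star (modeA L bc n) * modeA L bc n) = 0 ∧ ω (star (modeB L bc n) * modeB L bc n) = 0 := by
    rw [energy, ENNReal.tsum_eq_zero]
    refine forall_congr' fun n => ?_
    rw [ENNReal.ofReal_eq_zero, Complex.add_re]
    have ha := hω.re_nonneg (modeA L bc n)
    have hb := hω.re_nonneg (modeB L bc n)
    constructor
    · intro h hn
      have hpos : 0 < 2 * Real.pi / L * |bc.mode n| := by
        have := abs_pos.2 hn
        have := Real.pi_pos
        positivity
      have h2 := nonpos_of_mul_nonpos_right h hpos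
      exact ⟨hω.eq_zero_of_re (by linarith), hω.eq_zero_of_re (by linarith)⟩
    · intro h
      by_cases hn : bc.mode n = 0
      · rw [hn]; simp
      · rw [(h hn).1, (h hn).2]; simp
  rw [h1]
  constructor
  · intro h
    refine ⟨hω, ?_, ?_⟩
    · rintro ⟨a, n⟩ hq hn
      have h2 := (h n hn).1
      simp only [particleModes, Set.mem_ofPred_eq] at hq hn
      rcases hq with ⟨rfl, hq⟩ | ⟨rfl, hq⟩
      · rwa [modeA, if_pos (lt_of_le_of_ne hq hn)] at h2
      · rwa [modeA, if_neg hq.not_gt, if_neg hn] at h2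
    · rintro ⟨a, n⟩ hq hn
      have hm := bc.mode_neg n
      simp only at hn
      -- The antiparticle in the field mode `n` has the opposite label.
      have h2 := (h (bc.neg n) (by rw [hm]; exact neg_ne_zero.2 hn)).2
      simp only [particleModes, Set.mem_ofPred_eq, not_or, not_and, not_le, not_lt] at hq
      rcases Fin.exists_fin_two.1 ⟨a, rfl⟩ with rfl | rfl
      · have := hq.1 rfl
        rwa [modeB, if_pos (by linarith), bc.neg_neg, star_star] at h2
      · have := lt_of_le_of_ne (hq.2 rfl) hn
        rwa [modeB, if_neg (by linarith), if_neg (by linarith), bc.neg_neg, star_star] at h2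
  · rintro ⟨-, h2, h3⟩ n hn
    have hm := bc.mode_neg n
    rcases lt_or_gt_of_ne hn with h | h
    · rw [modeA, if_pos h, modeB, if_pos h, star_star]
      refine ⟨h2 (0, n) (Or.inl ⟨rfl, h.le⟩) hn, h3 (0, bc.neg n) ?_ ?_⟩
      · simp [particleModes, hm, h]
      · rw [hm]; exact neg_ne_zero.2 hn
    · rw [modeA, if_neg h.not_gt, if_neg hn, modeB, if_neg h.not_gt, if_neg hn, star_star]
      refine ⟨h2 (1, n) (Or.inr ⟨rfl, h⟩) hn, h3 (1, bc.neg n) ?_ ?_⟩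
      · simp [particleModes, hm, h.le]
      · rw [hm]; exact neg_ne_zero.2 hn

/-- The expectation values in a vector of Fock space. -/
def vectorState (L : ℝ) (bc : BC) (v : Fock Label) : Functional L bc where
  toFun A := inner ℂ v ((A : Op) v)
  map_add' A B := by
    change inner ℂ v ((A : Op) v + (B : Op) v) = _
    rw [inner_add_right]
  map_smul' c A := by
    change inner ℂ v (c • (A : Op) v) = _
    rw [inner_smul_right]; rfl

theorem vectorState_star_mul_self (L : ℝ) (bc : BC) (v : Fock Label) (A : carAlgebra L bc) :
    vectorState L bc v (star A * A) = ((‖(A : Op) v‖ ^ 2 : ℝ) : ℂ) := by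
  change inner ℂ v (star (A : Op) ((A : Op) v)) = _
  rw [ContinuousLinearMap.star_eq_adjoint, ContinuousLinearMap.adjoint_inner_right,
    inner_self_eq_norm_sq_to_K]
  simp

theorem isState_vectorState (L : ℝ) (bc : BC) {v : Fock Label} (hv : ‖v‖ = 1) :
    IsState (vectorState L bc v) := by
  refine ⟨?_, fun A => ?_⟩
  · change inner ℂ v v = (1 : ℂ)
    rw [inner_self_eq_norm_sq_to_K, hv]; simp
  · rw [vectorState_star_mul_self]
    exact Complex.zero_le_real.2 (sq_nonneg _)

theorem norm_configVector (S : Finset Label) : ‖configVector S‖ = 1 := by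
  rw [configVector, lp.norm_single (by norm_num)]; simp

theorem exists_isState (L : ℝ) (bc : BC) : ∃ ω : Functional L bc, IsState ω :=
  ⟨_, isState_vectorState L bc (norm_configVector ∅)⟩

theorem IsVacuum.hasZeroEnergy {L : ℝ} {hL : 0 < L} {bc : BC} {ω : Functional L bc}
    (h : IsVacuum (fieldMap hL bc) (waves L bc) (particleModes bc) ω) : HasZeroEnergy ω :=
  ⟨h.isState, fun q hq _ => h.annihilates q hq, fun q hq _ => h.star_annihilates q hq⟩

/-- The common vacuum of all modes has energy zero, so the lowest energy is zero. -/
theorem isGroundState_iff {L : ℝ} (hL : 0 < L) {bc : BC} {ω : Functional L bc} :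
    IsGroundState ω ↔ HasZeroEnergy ω := by
  constructor
  · rintro ⟨h1, h2⟩
    obtain ⟨ω', h⟩ := (fieldMap_isCAR hL bc).exists_isVacuum (exists_isState L bc)
      (orthonormal_waves hL bc) (particleModes bc)
    have h3 := h2 ω' h.isState
    rw [(energy_eq_zero_iff hL h.isState).2 h.hasZeroEnergy] at h3
    exact (energy_eq_zero_iff hL h1).1 (le_antisymm h3 zero_le)
  · intro h
    refine ⟨h.isState, fun ω' _ => ?_⟩
    rw [(energy_eq_zero_iff hL h.isState).2 h]
    exact zero_le

theorem BC.antiperiodic_mode_ne_zero (n : ℤ) : BC.antiperiodic.mode n ≠ 0 := by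
  intro hn
  have h1 : ((2 * n + 1 : ℤ) : ℝ) = 0 := by
    simp only [BC.mode] at hn
    push_cast; linarith
  have h2 : 2 * n + 1 = 0 := by exact_mod_cast h1
  omega

/-- No half-odd mode number vanishes, so zero energy prescribes every mode and leaves no freedom. -/
theorem hasZeroEnergy_antiperiodic_iff {L : ℝ} (hL : 0 < L) {ω : Functional L .antiperiodic} :
    HasZeroEnergy ω ↔
      IsVacuum (fieldMap hL .antiperiodic) (waves L .antiperiodic) (particleModes .antiperiodic) ω := by
  refine ⟨fun h => ?_, fun h => h.hasZeroEnergy⟩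
  exact ⟨h.isState, fun q hq => h.annihilates q hq (BC.antiperiodic_mode_ne_zero _),
    fun q hq => h.star_annihilates q hq (BC.antiperiodic_mode_ne_zero _)⟩

/-! ### Two-point functions of ground states -/

/-- The two-point function as a continuous linear map in its first argument. -/
def twoPointLeft {L : ℝ} (hL : 0 < L) {bc : BC} {ω : Functional L bc} (hω : IsState ω)
    (g : OneParticle L) : OneParticle L →L[ℂ] ℂ where
  toFun f := twoPoint ω f g
  map_add' f f' := by
    change ω (fieldMap hL bc (f + f') * _) = _
    rw [map_add, add_mul, map_add]; rfl
  map_smul' c f := by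
    change ω (fieldMap hL bc (c • f) * _) = _
    rw [map_smul, smul_mul_assoc, map_smul]; rfl
  cont := hω.continuous.comp (((fieldMap_isCAR hL bc).continuous).mul continuous_const)

theorem twoPoint_swap {L : ℝ} {bc : BC} {ω : Functional L bc} (hω : IsState ω)
    (f g : OneParticle L) : twoPoint ω g f = star (twoPoint ω f g) := by
  have := hω.map_star (field L bc f * star (field L bc g))
  rw [star_mul, star_star] at this
  exact this

theorem twoPoint_add_swap {L : ℝ} (hL : 0 < L) {bc : BC} {ω : Functional L bc} (hω : IsState ω)
    (f g : OneParticle L) :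
    twoPoint ω f g + ω (star (field L bc g) * field L bc f) = inner ℂ g f := by
  have h := congrArg ω ((fieldMap_isCAR hL bc).anti_star f g)
  rw [map_add, map_smul, hω.1, smul_eq_mul, mul_one] at h
  exact h

-- A particle mode annihilates the state when it stands on the right, which leaves only the
-- anticommutator; an antiparticle mode gives zero when it stands on the left.
open Classical in
theorem HasZeroEnergy.twoPoint_wave_left {L : ℝ} (hL : 0 < L) {bc : BC} {ω : Functional L bc}
    (h : HasZeroEnergy ω) {q : Fin 2 × ℤ} (hq : bc.mode q.2 ≠ 0) (g : OneParticle L) :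
    twoPoint ω (waves L bc q) g
      = if q ∈ particleModes bc then inner ℂ g (waves L bc q) else 0 := by
  split_ifs with hp
  · have h1 := twoPoint_add_swap hL h.isState (waves L bc q) g
    have h2 := h.isState.mul_eq_zero (h.annihilates q hp hq) (star (field L bc g))
    change ω (star (field L bc g) * field L bc (waves L bc q)) = 0 at h2
    rw [← h1, h2, add_zero]
  · have h2 := h.isState.star_mul_eq_zero (d := star (psi L bc q.1 q.2))
      (by rw [star_star]; exact h.star_annihilates q hp hq) (star (field L bc g))
    rw [star_star] at h2
    exact h2

/-- Ground states with the same zero-mode two-point functions have the same two-point function. -/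
theorem HasZeroEnergy.twoPoint_ext {L : ℝ} (hL : 0 < L) {bc : BC} {ω ω' : Functional L bc}
    (h : HasZeroEnergy ω) (h' : HasZeroEnergy ω')
    (h0 : ∀ q r : Fin 2 × ℤ, bc.mode q.2 = 0 → bc.mode r.2 = 0 →
      twoPoint ω (waves L bc q) (waves L bc r) = twoPoint ω' (waves L bc q) (waves L bc r))
    (f g : OneParticle L) : twoPoint ω f g = twoPoint ω' f g := by
  have h1 : ∀ q r, twoPoint ω (waves L bc q) (waves L bc r)
      = twoPoint ω' (waves L bc q) (waves L bc r) := by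
    intro q r
    by_cases hq : bc.mode q.2 = 0
    · by_cases hr : bc.mode r.2 = 0
      · exact h0 q r hq hr
      -- Hermitian symmetry brings the mode of nonzero energy to the left.
      · rw [twoPoint_swap h.isState, twoPoint_swap h'.isState, h.twoPoint_wave_left hL hr,
          h'.twoPoint_wave_left hL hr]
    · rw [h.twoPoint_wave_left hL hq, h'.twoPoint_wave_left hL hq]
  have h2 : ∀ f r, twoPoint ω f (waves L bc r) = twoPoint ω' f (waves L bc r) := by
    intro f r
    have : twoPointLeft hL h.isState (waves L bc r) = twoPointLeft hL h'.isState (waves L bc r) :=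
      ext_of_dense_span (dense_waves hL bc) fun q => h1 q r
    exact congrArg (fun S => S f) this
  have h3 : twoPointLeft hL h.isState f = twoPointLeft hL h'.isState f :=
    ext_of_dense_span (dense_waves hL bc) fun r => by
      change twoPoint ω _ f = twoPoint ω' _ f
      rw [twoPoint_swap h.isState, twoPoint_swap h'.isState, h2]
  rw [twoPoint_swap h.isState, twoPoint_swap h'.isState]
  exact congrArg (fun S => star (S g)) h3

/-! ### Integral kernels as Fourier series -/

/-- The kernel `1 / sin` for antiperiodic and `1 / tan` for periodic boundary conditions. -/
def trigKernel : BC → ℂ → ℂ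
  | .antiperiodic, θ => 1 / Complex.sin θ
  | .periodic, θ => 1 / Complex.tan θ

theorem exp_neg_two_I_mul_norm_lt {θ : ℂ} (hθ : θ.im < 0) :
    ‖Complex.exp (-(2 * Complex.I * θ))‖ < 1 := by
  rw [Complex.norm_exp, Real.exp_lt_one_iff]
  simp
  linarith

theorem sin_eq_exp (θ : ℂ) : 2 * Complex.I * Complex.sin θ
    = Complex.exp (Complex.I * θ) - Complex.exp (-(Complex.I * θ)) := by
  rw [Complex.sin, mul_comm θ, show -θ * Complex.I = -(Complex.I * θ) by ring]
  linear_combination (Complex.exp (-(Complex.I * θ)) - Complex.exp (Complex.I * θ)) * Complex.I_sq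

theorem cos_eq_exp (θ : ℂ) : 2 * Complex.cos θ
    = Complex.exp (Complex.I * θ) + Complex.exp (-(Complex.I * θ)) := by
  rw [Complex.cos, mul_comm θ, mul_comm (-θ), ← neg_mul_eq_mul_neg]
  ring

/-- Geometric series in `z = e^{-2iθ}`, with `|z| < 1` in the lower half plane: `1/(2i sin θ) =
e^{-iθ}/(1 - z)` and `cot θ/(2i) = 1/(1 - z) - 1/2`. The subtracted half is the origin of the weight
1/2 of the zero mode. -/
theorem hasSum_trigKernel (bc : BC) {θ : ℂ} (hθ : θ.im < 0) :
    HasSum (fun j : ℕ => (if bc.mode j = 0 then 1 / 2 else 1 : ℂ)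
      * Complex.exp (-(2 * Complex.I * (bc.mode j : ℝ) * θ))) (1 / (2 * Complex.I) * trigKernel bc θ) := by
  set z := Complex.exp (-(2 * Complex.I * θ)) with hz
  have hlt : ‖z‖ < 1 := exp_neg_two_I_mul_norm_lt hθ
  have h1 : 1 - z ≠ 0 := by
    intro h
    rw [← sub_eq_zero.1 h] at hlt
    simp at hlt
  have hgeo := hasSum_geometric_of_norm_lt_one hlt
  set E := Complex.exp (Complex.I * θ) with hE
  set E' := Complex.exp (-(Complex.I * θ)) with hE'
  have hEE : E * E' = 1 := by rw [hE, hE', ← Complex.exp_add]; simp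
  have hzE : z = E' * E' := by rw [hz, hE', ← Complex.exp_add]; congr 1; ring
  have hsin : 2 * Complex.I * Complex.sin θ = E - E' := sin_eq_exp θ
  have hcos : 2 * Complex.cos θ = E + E' := cos_eq_exp θ
  have hE0 : E' ≠ 0 := Complex.exp_ne_zero _
  have hfac : E' * (E - E') = 1 - z := by rw [hzE]; linear_combination hEE
  have hdiff : E - E' ≠ 0 := by
    intro h; rw [h, mul_zero] at hfac; exact h1 hfac.symm
  have hsin0 : Complex.sin θ ≠ 0 := by
    intro h; rw [h, mul_zero] at hsin; exact hdiff hsin.symm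
  cases bc with
  | antiperiodic =>
    have h2 := hgeo.mul_left E'
    have h3 : E' * (1 - z)⁻¹ = 1 / (2 * Complex.I) * trigKernel .antiperiodic θ := by
      rw [trigKernel, div_mul_div_comm, one_mul, hsin, ← hfac]
      field_simp
    rw [h3] at h2
    refine h2.congr_fun fun j => ?_
    have hj : BC.antiperiodic.mode (j : ℤ) ≠ 0 := by
      simp only [BC.mode]; positivity
    rw [if_neg hj, one_mul, hE', hz, ← Complex.exp_nat_mul, ← Complex.exp_add]
    congr 1
    simp only [BC.mode]; push_cast; ring
  | periodic =>
    have h2 := (hgeo).sub (hasSum_ite_eq (0 : ℕ) (1 / 2 : ℂ))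
    have h3 : (1 - z)⁻¹ - 1 / 2 = 1 / (2 * Complex.I) * trigKernel .periodic θ := by
      have e1 : 1 / (2 * Complex.I) * (1 / Complex.tan θ)
          = 2 * Complex.cos θ / (2 * (2 * Complex.I * Complex.sin θ)) := by
        rw [Complex.tan_eq_sin_div_cos]
        have := Complex.I_ne_zero
        field_simp
      rw [trigKernel, e1, hcos, hsin, ← hfac]
      field_simp
      linear_combination -2 * hEE
    rw [h3] at h2
    refine h2.congr_fun fun j => ?_
    have hj : BC.periodic.mode (j : ℤ) = 0 ↔ j = 0 := by simp [BC.mode]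
    rw [hz, ← Complex.exp_nat_mul]
    by_cases h0 : j = 0
    · subst h0; simp [BC.mode]; norm_num
    · rw [if_neg (fun h => h0 (hj.1 h)), if_neg h0, one_mul, sub_zero]
      congr 1
      simp only [BC.mode]; push_cast; ring

open Classical in
/-- The occupation weights of the modes in the kernels. -/
def modeWeight (bc : BC) (q : Fin 2 × ℤ) : ℂ :=
  if bc.mode q.2 = 0 then 1 / 2 else if q ∈ particleModes bc then 1 else 0

/-- The regularized occupation weights. -/
def dampedWeight (L ε : ℝ) (bc : BC) (q : Fin 2 × ℤ) : ℂ :=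
  modeWeight bc q * ((Real.exp (-(2 * Real.pi / L * |bc.mode q.2| * ε)) : ℝ) : ℂ)

/-- The phase `e^{2πi p t / L}`. -/
def phase (L p t : ℝ) : ℂ := Complex.exp (Complex.I * ((2 * Real.pi * p / L * t : ℝ) : ℂ))

theorem norm_phase (L p t : ℝ) : ‖phase L p t‖ = 1 := by
  simp [phase, Complex.norm_exp]

theorem BC.mode_natCast_nonneg (bc : BC) (j : ℕ) : 0 ≤ bc.mode j := by
  cases bc <;> simp only [BC.mode] <;> push_cast <;> positivity

theorem BC.mode_neg_of_neg (bc : BC) {k : ℤ} (hk : k < 0) : bc.mode k < 0 := by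
  have h : (k : ℝ) ≤ -1 := by exact_mod_cast Int.le_sub_one_of_lt hk
  cases bc <;> simp only [BC.mode] <;> linarith

/-- Each chirality contributes one geometric series. The second one is evaluated at the reflected
argument `-(π/L)(t + iε)`, which lies in the lower half plane too, and oddness of the kernel
produces the relative minus sign. -/
theorem hasSum_dampedWeight {L : ℝ} (hL : 0 < L) (bc : BC) {ε : ℝ} (hε : 0 < ε) (t : ℝ)
    (A : Fin 2 → ℂ) :
    HasSum (fun q : Fin 2 × ℤ => dampedWeight L ε bc q * (A q.1 * phase L (bc.mode q.2) t))
      (1 / (2 * Complex.I) * (A 0 * trigKernel bc (Real.pi / L * (t - Complex.I * ε))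
        - A 1 * trigKernel bc (Real.pi / L * (t + Complex.I * ε)))) := by
  have hodd : ∀ θ, trigKernel bc (-θ) = - trigKernel bc θ := by
    intro θ; cases bc <;> simp [trigKernel, div_neg]
  have him : ∀ s : ℝ, (Real.pi / L * (s - Complex.I * ε) : ℂ).im < 0 := by
    intro s
    have : (Real.pi / L * (s - Complex.I * ε) : ℂ) = ((Real.pi / L * s : ℝ) : ℂ)
        - ((Real.pi / L * ε : ℝ) : ℂ) * Complex.I := by push_cast; ring
    rw [this]
    simp only [Complex.sub_im, Complex.ofReal_im, Complex.mul_I_im, Complex.ofReal_re]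
    have := Real.pi_pos
    have : 0 < Real.pi / L * ε := by positivity
    linarith
  have h0 := (hasSum_trigKernel bc (him t)).mul_left (A 0)
  have h1 := (hasSum_trigKernel bc (him (-t))).mul_left (A 1)
  have e1 : (Real.pi / L * (((-t : ℝ) : ℂ) - Complex.I * ε) : ℂ)
      = -(Real.pi / L * (t + Complex.I * ε)) := by push_cast; ring
  rw [e1, hodd] at h1
  set F := fun q : Fin 2 × ℤ => dampedWeight L ε bc q * (A q.1 * phase L (bc.mode q.2) t) with hF
  -- The nonvanishing weights sit at nonpositive mode numbers for chirality `0` and at nonnegative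
  -- ones for chirality `1`; natural numbers index both sets.
  let i₀ : ℕ → Fin 2 × ℤ := fun j => (0, bc.neg j)
  let i₁ : ℕ → Fin 2 × ℤ := fun j => (1, j)
  have hi₀ : Function.Injective i₀ := by
    intro j k h
    have h2 : bc.neg j = bc.neg k := congrArg Prod.snd h
    have h3 := congrArg bc.neg h2
    rw [bc.neg_neg, bc.neg_neg] at h3
    exact_mod_cast h3
  have hi₁ : Function.Injective i₁ := by
    intro j k h
    have h2 : (j : ℤ) = k := congrArg Prod.snd h
    exact_mod_cast h2
  have hexp : ∀ (μ s : ℝ), Complex.exp (-(2 * Complex.I * (μ : ℝ) * (Real.pi / L * (s - Complex.I * ε))))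
      = ((Real.exp (-(2 * Real.pi / L * μ * ε)) : ℝ) : ℂ) * phase L (-μ) s := by
    intro μ s
    rw [phase, Complex.ofReal_exp, ← Complex.exp_add]
    congr 1
    push_cast
    linear_combination (2 * μ * (Real.pi / L) * ε : ℂ) * Complex.I_sq
  have h0' : HasSum (fun q : Fin 2 × ℤ => if q.1 = 0 then F q else 0)
      (A 0 * (1 / (2 * Complex.I) * trigKernel bc (Real.pi / L * (t - Complex.I * ε)))) := by
    rw [← hi₀.hasSum_iff]
    · refine h0.congr_fun fun j => ?_
      have hm := bc.mode_neg j
      have hp := bc.mode_natCast_nonneg j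
      simp only [Function.comp_apply, i₀, if_true, hF, dampedWeight, modeWeight, hm, neg_eq_zero,
        abs_neg, abs_of_nonneg hp, hexp, particleModes, Set.mem_ofPred_eq, neg_nonpos, hp]
      simp only [true_and, true_or, if_true]
      ring
    · rintro ⟨a, n⟩ hn
      by_cases ha : a = 0
      · subst ha
        have hlt : bc.neg n < 0 := by
          by_contra hge
          refine hn ⟨(bc.neg n).toNat, ?_⟩
          simp [i₀, Int.toNat_of_nonneg (not_lt.1 hge), bc.neg_neg]
        have h2 := bc.mode_neg_of_neg hlt
        rw [bc.mode_neg] at h2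
        have h3 : 0 < bc.mode n := by linarith
        simp [hF, dampedWeight, modeWeight, h3.ne', particleModes, h3.not_ge]
      · simp [ha]
  have h1' : HasSum (fun q : Fin 2 × ℤ => if q.1 = 1 then F q else 0)
      (A 1 * (1 / (2 * Complex.I) * -trigKernel bc (Real.pi / L * (t + Complex.I * ε)))) := by
    rw [← hi₁.hasSum_iff]
    · refine h1.congr_fun fun j => ?_
      have hp := bc.mode_natCast_nonneg j
      have hph : phase L (-bc.mode j) (-t) = phase L (bc.mode j) t := by
        simp only [phase]; congr 3; ring
      rw [← e1, hexp, hph]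
      simp only [Function.comp_apply, i₁, if_true, hF, dampedWeight, modeWeight,
        abs_of_nonneg hp, particleModes, Set.mem_ofPred_eq]
      by_cases hz : bc.mode j = 0
      · simp only [hz, if_true]; ring
      · have : 0 < bc.mode j := lt_of_le_of_ne hp (Ne.symm hz)
        simp only [hz, this, if_false, true_and, or_true, if_true]; ring
    · rintro ⟨a, n⟩ hn
      by_cases ha : a = 1
      · subst ha
        have hlt : n < 0 := by
          by_contra hge
          refine hn ⟨n.toNat, ?_⟩
          simp [i₁, Int.toNat_of_nonneg (not_lt.1 hge)]
        have h2 := bc.mode_neg_of_neg hlt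
        simp [hF, dampedWeight, modeWeight, h2.ne, particleModes, h2.le]
      · simp [ha]
  convert! (h0'.add h1').congr_fun (g := F) fun q => ?_ using 1
  · ring
  · obtain ⟨a, n⟩ := q
    rcases Fin.exists_fin_two.1 ⟨a, rfl⟩ with rfl | rfl <;> simp

theorem fourierCoefficient_eq (L p : ℝ) (u : Lp ℂ 2 (circleMeasure L)) :
    fourierCoefficient L p u = ((1 / √L : ℝ) : ℂ) * ∫ x in Set.Icc 0 L, u x * phase L p x := rfl

theorem star_fourierCoefficient (L p : ℝ) (u : Lp ℂ 2 (circleMeasure L)) :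
    star (fourierCoefficient L p u)
      = ((1 / √L : ℝ) : ℂ) * ∫ x in Set.Icc 0 L, star (u x) * phase L p (-x) := by
  rw [fourierCoefficient_eq, star_mul', Complex.star_def, Complex.conj_ofReal, ← integral_conj]
  congr 2
  ext x
  rw [map_mul]
  congr 1
  rw [phase, ← Complex.exp_conj, phase]
  congr 1
  rw [map_mul, Complex.conj_I, Complex.conj_ofReal]
  push_cast; ring

theorem integrable_of_Lp {L : ℝ} (u : Lp ℂ 2 (circleMeasure L)) :
    Integrable u (circleMeasure L) :=
  (Lp.memLp u).integrable (by norm_num)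

theorem continuous_phase (L p : ℝ) : Continuous (phase L p) := by
  unfold phase; fun_prop

theorem integrable_mul_phase {L : ℝ} (u : Lp ℂ 2 (circleMeasure L)) (p : ℝ) :
    Integrable (fun x => u x * phase L p x) (circleMeasure L) :=
  (integrable_of_Lp u).mul_bdd (c := 1) (continuous_phase L p).aestronglyMeasurable
    (Eventually.of_forall fun x => (norm_phase L p x).le)

theorem integrable_star_mul_phase {L : ℝ} (u : Lp ℂ 2 (circleMeasure L)) (p : ℝ) :
    Integrable (fun x => star (u x) * phase L p (-x)) (circleMeasure L) := by
  have h : Integrable (fun x => star (u x)) (circleMeasure L) :=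
    (integrable_of_Lp u).congr' (continuous_star.comp_aestronglyMeasurable
      (integrable_of_Lp u).aestronglyMeasurable) (Eventually.of_forall fun x => by simp)
  exact h.mul_bdd (c := 1) ((continuous_phase L p).comp continuous_neg).aestronglyMeasurable
    (Eventually.of_forall fun x => (norm_phase L p (-x)).le)

theorem phase_add (L p s t : ℝ) : phase L p (s + t) = phase L p s * phase L p t := by
  rw [phase, phase, phase, ← Complex.exp_add]
  congr 1; push_cast; ring

/-- Double integrals against a kernel with an absolutely convergent Fourier series. -/
theorem hasSum_integral_kernel {L : ℝ} (hL : 0 < L) (bc : BC) {k : Fin 2 × ℤ → ℂ}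
    (hk : Summable fun q => ‖k q‖) (f g : OneParticle L) {Φ : ℝ → ℝ → ℂ}
    (hΦ : ∀ x y, HasSum (fun q : Fin 2 × ℤ =>
      k q * (f q.1 x * star (g q.1 y) * phase L (bc.mode q.2) (x - y))) (Φ x y)) :
    HasSum (fun q : Fin 2 × ℤ => (L : ℂ) * (k q * (fourierCoefficient L (bc.mode q.2) (f q.1) *
        star (fourierCoefficient L (bc.mode q.2) (g q.1)))))
      (∫ x in Set.Icc 0 L, ∫ y in Set.Icc 0 L, Φ x y) := by
  have hΦ' : ∀ x y, HasSum (fun q : Fin 2 × ℤ => (k q * (f q.1 x * phase L (bc.mode q.2) x)) *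
      (star (g q.1 y) * phase L (bc.mode q.2) (-y))) (Φ x y) := by
    intro x y
    refine (hΦ x y).congr_fun fun q => ?_
    rw [sub_eq_add_neg, phase_add]; ring
  -- The L¹ norms, finite because the interval has finite measure. Together with summability of `‖k
  -- q‖` they justify integrating the series term by term, first in `y` and then in `x`.
  let N : (Lp ℂ 2 (circleMeasure L)) → ℝ := fun u => ∫ x in Set.Icc 0 L, ‖u x‖
  have hN0 : ∀ u, 0 ≤ N u := fun u => integral_nonneg fun x => norm_nonneg _
  have hinner : ∀ x, HasSum (fun q : Fin 2 × ℤ => (k q * (f q.1 x * phase L (bc.mode q.2) x)) *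
      ∫ y in Set.Icc 0 L, star (g q.1 y) * phase L (bc.mode q.2) (-y))
      (∫ y in Set.Icc 0 L, Φ x y) := by
    intro x
    have h := hasSum_integral_of_summable_integral_norm (μ := circleMeasure L)
      (F := fun (q : Fin 2 × ℤ) y => (k q * (f q.1 x * phase L (bc.mode q.2) x)) *
        (star (g q.1 y) * phase L (bc.mode q.2) (-y)))
      (fun q => (integrable_star_mul_phase _ _).const_mul _) ?_
    · rw [show (∫ y in Set.Icc 0 L, Φ x y) = ∫ y in Set.Icc 0 L, ∑' q : Fin 2 × ℤ,
        (k q * (f q.1 x * phase L (bc.mode q.2) x)) *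
        (star (g q.1 y) * phase L (bc.mode q.2) (-y)) from
        integral_congr_ae (Eventually.of_forall fun y => (hΦ' x y).tsum_eq.symm)]
      simpa only [integral_const_mul] using h
    · have hb : ∀ q : Fin 2 × ℤ, (∫ y in Set.Icc 0 L, ‖(k q * (f q.1 x * phase L (bc.mode q.2) x)) *
          (star (g q.1 y) * phase L (bc.mode q.2) (-y))‖) = ‖k q‖ * (‖f q.1 x‖ * N (g q.1)) := by
        intro q
        simp only [norm_mul, norm_phase, mul_one, norm_star, integral_const_mul, N]
        ring
      simp only [hb]
      refine Summable.of_nonneg_of_le (fun q => by have := hN0 (g q.1); positivity) (fun q => ?_)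
        (hk.mul_right (∑ a, ‖f a x‖ * N (g a)))
      exact mul_le_mul_of_nonneg_left (Finset.single_le_sum
        (f := fun a => ‖f a x‖ * N (g a))
        (fun a _ => mul_nonneg (norm_nonneg _) (hN0 _)) (Finset.mem_univ q.1)) (norm_nonneg _)
  have houter := hasSum_integral_of_summable_integral_norm (μ := circleMeasure L)
      (F := fun (q : Fin 2 × ℤ) x => (k q * (f q.1 x * phase L (bc.mode q.2) x)) *
      ∫ y in Set.Icc 0 L, star (g q.1 y) * phase L (bc.mode q.2) (-y))
      (fun q => ((integrable_mul_phase _ _).const_mul _).mul_const _) ?_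
  · rw [show (∫ x in Set.Icc 0 L, ∫ y in Set.Icc 0 L, Φ x y) = ∫ x in Set.Icc 0 L, ∑' q : Fin 2 × ℤ,
        (k q * (f q.1 x * phase L (bc.mode q.2) x)) *
        ∫ y in Set.Icc 0 L, star (g q.1 y) * phase L (bc.mode q.2) (-y) from
        integral_congr_ae (Eventually.of_forall fun x => (hinner x).tsum_eq.symm)]
    refine houter.congr_fun fun q => ?_
    rw [integral_mul_const, integral_const_mul, star_fourierCoefficient, fourierCoefficient_eq]
    have hr : (L : ℂ) * (((1 / √L : ℝ) : ℂ) * ((1 / √L : ℝ) : ℂ)) = 1 := by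
      have : L * ((1 / √L) * (1 / √L)) = 1 := by
        have := Real.sq_sqrt hL.le
        have h0 : √L ≠ 0 := (Real.sqrt_pos.2 hL).ne'
        field_simp; linarith
      exact_mod_cast this
    linear_combination (k q * (∫ x in Set.Icc 0 L, f q.1 x * phase L (bc.mode q.2) x) *
      (∫ x in Set.Icc 0 L, star (g q.1 x) * phase L (bc.mode q.2) (-x))) * hr
  · have hb : ∀ q : Fin 2 × ℤ, (∫ x in Set.Icc 0 L, ‖(k q * (f q.1 x * phase L (bc.mode q.2) x)) *
        ∫ y in Set.Icc 0 L, star (g q.1 y) * phase L (bc.mode q.2) (-y)‖)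
        ≤ ‖k q‖ * (N (f q.1) * N (g q.1)) := by
      intro q
      simp only [norm_mul, norm_phase, mul_one, integral_const_mul, integral_mul_const]
      rw [mul_assoc]
      refine mul_le_mul_of_nonneg_left (mul_le_mul_of_nonneg_left ?_ (hN0 _)) (norm_nonneg _)
      refine (norm_integral_le_integral_norm _).trans_eq ?_
      simp only [norm_mul, norm_phase, mul_one, norm_star, N]
    refine Summable.of_nonneg_of_le (fun q => integral_nonneg fun x => norm_nonneg _)
      (fun q => (hb q).trans ?_) (hk.mul_right (∑ a, N (f a) * N (g a)))
    exact mul_le_mul_of_nonneg_left (Finset.single_le_sum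
      (f := fun a => N (f a) * N (g a))
      (fun a _ => mul_nonneg (hN0 _) (hN0 _)) (Finset.mem_univ q.1)) (norm_nonneg _)

/-- The regularized two-point functions for both boundary conditions. -/
def regKernel (L ε : ℝ) (bc : BC) (f g : OneParticle L) : ℂ :=
  1 / (2 * Complex.I * L) * ∫ x in Set.Icc 0 L, ∫ y in Set.Icc 0 L,
    (f 0 x * star (g 0 y) * trigKernel bc (Real.pi / L * (x - y - Complex.I * ε))
      - f 1 x * star (g 1 y) * trigKernel bc (Real.pi / L * (x - y + Complex.I * ε)))

theorem sinKernel_eq (L ε : ℝ) (f g : OneParticle L) :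
    sinKernel L ε f g = regKernel L ε .antiperiodic f g := by
  simp only [sinKernel, regKernel, trigKernel, mul_one_div]

theorem cotKernel_eq (L ε : ℝ) (f g : OneParticle L) :
    cotKernel L ε f g = regKernel L ε .periodic f g := by
  simp only [cotKernel, regKernel, trigKernel, mul_one_div]

theorem hasSum_regKernel {L : ℝ} (hL : 0 < L) (bc : BC) {ε : ℝ} (hε : 0 < ε) (f g : OneParticle L) :
    HasSum (fun q : Fin 2 × ℤ => dampedWeight L ε bc q *
      (fourierCoefficient L (bc.mode q.2) (f q.1) *
        star (fourierCoefficient L (bc.mode q.2) (g q.1)))) (regKernel L ε bc f g) := by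
  have hk : Summable fun q => ‖dampedWeight L ε bc q‖ := by
    -- The case `t = 0`, `A = 1` controls all moduli, since phases have modulus 1 and summable
    -- complex families are absolutely summable.
    have := (hasSum_dampedWeight hL bc hε 0 1).summable.norm
    simpa [norm_phase] using this
  have hLc : (L : ℂ) ≠ 0 := by exact_mod_cast hL.ne'
  have h := (hasSum_integral_kernel hL bc hk f g (fun x y =>
    hasSum_dampedWeight hL bc hε (x - y) (fun a => f a x * star (g a y)))).mul_left (1 / (L : ℂ))
  convert! h.congr_fun (fun q => ?_) using 1
  · simp only [integral_const_mul, regKernel]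
    push_cast
    rw [← mul_assoc]
    congr 1
    field_simp
  · field_simp

/-- The Fourier series of the two-point kernels without regularization. -/
def kernelSeries (L : ℝ) (bc : BC) (f g : OneParticle L) : ℂ :=
  ∑' q : Fin 2 × ℤ, modeWeight bc q * (fourierCoefficient L (bc.mode q.2) (f q.1) *
    star (fourierCoefficient L (bc.mode q.2) (g q.1)))

theorem summable_coefficients {L : ℝ} (hL : 0 < L) (bc : BC) (f g : OneParticle L) :
    Summable fun q : Fin 2 × ℤ => ‖fourierCoefficient L (bc.mode q.2) (f q.1) *
      star (fourierCoefficient L (bc.mode q.2) (g q.1))‖ := by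
  have := ((waveBasis hL bc).hasSum_inner_mul_inner g f).summable.norm
  refine this.congr fun q => ?_
  rw [coe_waveBasis, ← inner_waves, ← inner_waves, Complex.star_def, inner_conj_symm, mul_comm]

theorem norm_modeWeight_le (bc : BC) (q : Fin 2 × ℤ) : ‖modeWeight bc q‖ ≤ 1 := by
  unfold modeWeight
  split_ifs <;> norm_num

theorem summable_kernelSeries {L : ℝ} (hL : 0 < L) (bc : BC) (f g : OneParticle L) :
    Summable fun q : Fin 2 × ℤ => modeWeight bc q * (fourierCoefficient L (bc.mode q.2) (f q.1) *
      star (fourierCoefficient L (bc.mode q.2) (g q.1))) :=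
  Summable.of_norm_bounded (summable_coefficients hL bc f g) fun q => by
    rw [norm_mul]
    exact mul_le_of_le_one_left (norm_nonneg _) (norm_modeWeight_le bc q)

/-- The damped weights are bounded by 1, so the products of Fourier coefficients, absolutely
summable by Parseval, dominate the series uniformly in ε > 0. -/
theorem tendsto_regKernel {L : ℝ} (hL : 0 < L) (bc : BC) (f g : OneParticle L) :
    Tendsto (fun ε => regKernel L ε bc f g) (𝓝[>] 0) (𝓝 (kernelSeries L bc f g)) := by
  have h : Tendsto (fun ε => ∑' q : Fin 2 × ℤ, dampedWeight L ε bc q *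
      (fourierCoefficient L (bc.mode q.2) (f q.1) *
        star (fourierCoefficient L (bc.mode q.2) (g q.1)))) (𝓝[>] 0)
      (𝓝 (kernelSeries L bc f g)) := by
    refine tendsto_tsum_of_dominated_convergence (summable_coefficients hL bc f g) (fun q => ?_) ?_
    · refine Tendsto.mul_const _ ?_
      have hc : Continuous fun ε : ℝ => dampedWeight L ε bc q := by
        unfold dampedWeight; fun_prop
      have := (hc.tendsto 0).mono_left (nhdsWithin_le_nhds (s := Set.Ioi 0))
      simpa [dampedWeight] using this
    · filter_upwards [self_mem_nhdsWithin] with ε hε q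
      rw [norm_mul]
      refine mul_le_of_le_one_left (norm_nonneg _) ?_
      rw [dampedWeight, norm_mul]
      refine mul_le_one₀ (norm_modeWeight_le bc q) (norm_nonneg _) ?_
      rw [Complex.norm_real, Real.norm_of_nonneg (Real.exp_pos _).le, Real.exp_le_one_iff]
      have := Real.pi_pos
      have hε' : 0 < ε := hε
      exact neg_nonpos.2 (by positivity)
  refine h.congr' ?_
  filter_upwards [self_mem_nhdsWithin] with ε hε
  exact (hasSum_regKernel hL bc hε f g).tsum_eq

/-! ### The parameter space -/

theorem pauliMatrix_eq (x : R4) : pauliMatrix x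
    = !![(x.1 : ℂ) + x.2 2, (x.2 0 : ℂ) - Complex.I * x.2 1;
        (x.2 0 : ℂ) + Complex.I * x.2 1, (x.1 : ℂ) - x.2 2] := by
  ext i j
  fin_cases i <;> fin_cases j <;> simp [pauliMatrix] <;> ring

theorem hMatrix_eq (h₁ h₂ φ ψ : ℝ) : hMatrix h₁ h₂ φ ψ
    = !![((h₁ + h₂) / 2 + (h₁ - h₂) / 2 * Real.cos ψ : ℂ),
          (h₁ - h₂) / 2 * (Real.sin ψ * Complex.exp (Complex.I * φ));
        (h₁ - h₂) / 2 * (Real.sin ψ * Complex.exp (-(Complex.I * φ))),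
          (h₁ + h₂) / 2 - (h₁ - h₂) / 2 * Real.cos ψ] := by
  ext i j
  fin_cases i <;> fin_cases j <;> simp [hMatrix]
  ring

theorem hMatrix_charpoly (h₁ h₂ φ ψ : ℝ) : (hMatrix h₁ h₂ φ ψ).charpoly =
    (Polynomial.X - Polynomial.C (h₁ : ℂ)) * (Polynomial.X - Polynomial.C (h₂ : ℂ)) := by
  have hcs : (Real.sin ψ : ℂ) ^ 2 + (Real.cos ψ : ℂ) ^ 2 = 1 := by
    exact_mod_cast Real.sin_sq_add_cos_sq ψ
  have he : Complex.exp (Complex.I * φ) * Complex.exp (-(Complex.I * φ)) = 1 := by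
    rw [← Complex.exp_add]; simp
  have ht : (hMatrix h₁ h₂ φ ψ).trace = h₁ + h₂ := by
    rw [hMatrix_eq, Matrix.trace_fin_two_of]; ring
  have hd : (hMatrix h₁ h₂ φ ψ).det = h₁ * h₂ := by
    rw [hMatrix_eq, Matrix.det_fin_two_of]
    linear_combination (-((h₁ - h₂) / 2 : ℂ) ^ 2 * (Real.sin ψ : ℂ) ^ 2) * he
      - ((h₁ - h₂) / 2 : ℂ) ^ 2 * hcs
  rw [Matrix.charpoly_fin_two, ht, hd]
  simp only [map_add, map_mul]
  ring

/-- The point of the parameter space with the parameters `h₁, h₂, φ, ψ`. -/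
def conePoint (h₁ h₂ φ ψ : ℝ) : R4 :=
  ((h₁ + h₂) / 2, ((h₁ - h₂) / 2) • !₂[Real.sin ψ * Real.cos φ, -(Real.sin ψ * Real.sin φ), Real.cos ψ])

/-- The minus sign in the second coordinate of `conePoint` is due to the upper right entry `-i` of
σ_y, where `hMatrix` has `e^{iφ}`. -/
theorem pauliMatrix_conePoint (h₁ h₂ φ ψ : ℝ) :
    pauliMatrix (conePoint h₁ h₂ φ ψ) = hMatrix h₁ h₂ φ ψ := by
  have e1 : Complex.exp (Complex.I * φ) = Real.cos φ + Real.sin φ * Complex.I := by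
    rw [mul_comm, Complex.exp_mul_I]; simp
  have e2 : Complex.exp (-(Complex.I * φ)) = Real.cos φ - Real.sin φ * Complex.I := by
    rw [← mul_neg, mul_comm, Complex.exp_mul_I]; simp [sub_eq_add_neg]
  rw [pauliMatrix_eq, hMatrix_eq, e1, e2]
  ext i j
  fin_cases i <;> fin_cases j <;> simp [conePoint] <;> ring

theorem norm_conePoint_snd (h₁ h₂ φ ψ : ℝ) : ‖(conePoint h₁ h₂ φ ψ).2‖ = |(h₁ - h₂) / 2| := by
  have h : ‖!₂[Real.sin ψ * Real.cos φ, -(Real.sin ψ * Real.sin φ), Real.cos ψ]‖ = 1 := by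
    rw [EuclideanSpace.norm_eq, Real.sqrt_eq_one, Fin.sum_univ_three]
    simp only [Real.norm_eq_abs, sq_abs]
    simp
    nlinarith [Real.sin_sq_add_cos_sq ψ, Real.sin_sq_add_cos_sq φ]
  simp only [conePoint]
  rw [norm_smul, h, mul_one, Real.norm_eq_abs]

theorem pauliMatrix_injective : Function.Injective pauliMatrix := by
  intro x y h
  rw [pauliMatrix_eq, pauliMatrix_eq] at h
  have h00 := congrFun (congrFun h 0) 0
  have h01 := congrFun (congrFun h 0) 1
  have h11 := congrFun (congrFun h 1) 1
  have h10 := congrFun (congrFun h 1) 0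
  simp at h00 h01 h11 h10
  have a1 : (x.1 : ℂ) = y.1 := by linear_combination (h00 + h11) / 2
  have a2 : (x.2 2 : ℂ) = y.2 2 := by linear_combination (h00 - h11) / 2
  have a3 : (x.2 0 : ℂ) = y.2 0 := by linear_combination (h01 + h10) / 2
  have a4 : (x.2 1 : ℂ) = y.2 1 :=
    mul_left_cancel₀ Complex.I_ne_zero (by linear_combination (h10 - h01) / 2)
  refine Prod.ext (by exact_mod_cast a1) ?_
  ext i
  fin_cases i
  · exact_mod_cast a3
  · exact_mod_cast a4
  · exact_mod_cast a2

theorem exists_unit_angle (a b : ℝ) : ∃ φ ∈ Set.Ico 0 (2 * Real.pi),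
    a = √(a ^ 2 + b ^ 2) * Real.cos φ ∧ b = √(a ^ 2 + b ^ 2) * Real.sin φ := by
  set z : ℂ := ⟨a, b⟩ with hz
  have hn : ‖z‖ = √(a ^ 2 + b ^ 2) := by
    rw [Complex.norm_def, Complex.normSq_apply, hz]; congr 1; ring
  -- The principal argument lies in (-π, π] and is shifted into [0, 2π).
  refine ⟨toIcoMod Real.two_pi_pos 0 z.arg, by simpa using toIcoMod_mem_Ico Real.two_pi_pos 0 z.arg,
    ?_, ?_⟩
  · rw [toIcoMod, zsmul_eq_mul, Real.cos_sub_int_mul_two_pi, ← hn, Complex.norm_mul_cos_arg]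
  · rw [toIcoMod, zsmul_eq_mul, Real.sin_sub_int_mul_two_pi, ← hn, Complex.norm_mul_sin_arg]

/-- Spherical coordinates for `β`, with the eigenvalues `α ± |β|` as `h₁` and `h₂`. The polar angle
is the argument of a complex number in the closed upper half plane, so it lies in [0, π]. -/
theorem exists_conePoint (x : R4) : ∃ φ ∈ Set.Ico 0 (2 * Real.pi), ∃ ψ ∈ Set.Icc 0 Real.pi,
    x = conePoint (x.1 + ‖x.2‖) (x.1 - ‖x.2‖) φ ψ := by
  obtain ⟨φ, hφ, h0, h1⟩ := exists_unit_angle (x.2 0) (-x.2 1)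
  set s := √(x.2 0 ^ 2 + (-x.2 1) ^ 2) with hs
  have hnorm : ‖x.2‖ = √(x.2 2 ^ 2 + s ^ 2) := by
    rw [EuclideanSpace.norm_eq, Fin.sum_univ_three, hs, Real.sq_sqrt (by positivity)]
    simp only [Real.norm_eq_abs, sq_abs]
    congr 1; ring
  set z : ℂ := ⟨x.2 2, s⟩ with hz
  have hzn : ‖z‖ = ‖x.2‖ := by
    rw [Complex.norm_def, Complex.normSq_apply, hnorm, hz]; congr 1; ring
  have hψ0 : 0 ≤ z.arg := Complex.arg_nonneg_iff.2 (Real.sqrt_nonneg _)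
  refine ⟨φ, hφ, z.arg, ⟨hψ0, Complex.arg_le_pi z⟩, ?_⟩
  have hc : ‖x.2‖ * Real.cos z.arg = x.2 2 := by rw [← hzn, Complex.norm_mul_cos_arg]
  have hsn : ‖x.2‖ * Real.sin z.arg = s := by rw [← hzn, Complex.norm_mul_sin_arg]
  have hh : (x.1 + ‖x.2‖ - (x.1 - ‖x.2‖)) / 2 = ‖x.2‖ := by ring
  refine Prod.ext ?_ ?_
  · simp [conePoint]
  · ext i
    simp only [conePoint, hh]
    fin_cases i
    · simp; rw [← mul_assoc, hsn]; exact h0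
    · simp; rw [← mul_assoc, hsn, ← h1, neg_neg]
    · simp [hc]

/-- The cone condition bounds both eigenvalues `α ± |β|` of the associated matrix. -/
theorem mem_doubleCone_iff {r : ℝ} {x : R4} :
    x ∈ doubleCone r ↔ |x.1 + ‖x.2‖| ≤ r ∧ |x.1 - ‖x.2‖| ≤ r := by
  have hn := norm_nonneg x.2
  change |x.1| + ‖x.2‖ ≤ r ↔ _
  rw [abs_le, abs_le]
  constructor
  · intro h
    have := le_abs_self x.1
    have := neg_abs_le x.1
    refine ⟨⟨?_, ?_⟩, ?_, ?_⟩ <;> linarith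
  · rintro ⟨⟨h1, h2⟩, h3, h4⟩
    rcases abs_cases x.1 with ⟨h, -⟩ | ⟨h, -⟩ <;> rw [h] <;> linarith

theorem conePoint_mem_doubleCone {r h₁ h₂ : ℝ} (φ ψ : ℝ) (h1 : |h₁| ≤ r) (h2 : |h₂| ≤ r) :
    conePoint h₁ h₂ φ ψ ∈ doubleCone r := by
  change |(h₁ + h₂) / 2| + ‖(conePoint h₁ h₂ φ ψ).2‖ ≤ r
  rw [norm_conePoint_snd]
  rw [abs_le] at h1 h2
  rcases abs_cases ((h₁ + h₂) / 2) with ⟨h, -⟩ | ⟨h, -⟩ <;>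
    rcases abs_cases ((h₁ - h₂) / 2) with ⟨h', -⟩ | ⟨h', -⟩ <;> rw [h, h'] <;> linarith

theorem bijOn_pauliMatrix (L : ℝ) :
    Set.BijOn pauliMatrix (doubleCone (1 / (2 * L))) (hSet L) := by
  refine ⟨fun x hx => ?_, pauliMatrix_injective.injOn, ?_⟩
  · obtain ⟨φ, hφ, ψ, hψ, h⟩ := exists_conePoint x
    obtain ⟨h1, h2⟩ := mem_doubleCone_iff.1 hx
    refine ⟨_, _, φ, ψ, ⟨h1, h2, hφ, hψ⟩, ?_⟩
    rw [← pauliMatrix_conePoint, ← h]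
  · rintro _ ⟨h₁, h₂, φ, ψ, ⟨h1, h2, -, -⟩, rfl⟩
    exact ⟨conePoint h₁ h₂ φ ψ, conePoint_mem_doubleCone φ ψ h1 h2, pauliMatrix_conePoint _ _ _ _⟩

theorem isHermitian_pauliMatrix (x : R4) : (pauliMatrix x).IsHermitian := by
  rw [pauliMatrix_eq]
  ext i j
  rw [Matrix.conjTranspose_apply]
  fin_cases i <;> fin_cases j <;> simp [sub_eq_add_neg]

theorem exists_pauliMatrix_eq {h : Matrix (Fin 2) (Fin 2) ℂ} (hh : h.IsHermitian) :
    ∃ x, h = pauliMatrix x := by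
  have h00 := hh.apply 0 0
  have h11 := hh.apply 1 1
  have h10 := hh.apply 1 0
  refine ⟨(((h 0 0).re + (h 1 1).re) / 2,
    !₂[(h 0 1).re, -(h 0 1).im, ((h 0 0).re - (h 1 1).re) / 2]), ?_⟩
  rw [Complex.star_def, Complex.conj_eq_iff_re] at h00 h11
  rw [pauliMatrix_eq]
  ext i j
  fin_cases i <;> fin_cases j
  · simp; rw [← h00]; simp; ring
  · simp
    rw [mul_comm, Complex.re_add_im]
  · simp
    rw [← h10]
    apply Complex.ext <;> simp
  · simp; rw [← h11]; simp; ring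

/-- The eigenvalues and `h₁, h₂` are compared as roots of the same characteristic polynomial, so
their order plays no role. -/
theorem mem_hSet_iff (L : ℝ) (h : Matrix (Fin 2) (Fin 2) ℂ) : h ∈ hSet L ↔
    ∃ hh : h.IsHermitian, ∀ i, |hh.eigenvalues i| ≤ 1 / (2 * L) := by
  have key : ∀ (h₁ h₂ φ ψ : ℝ) (M : Matrix (Fin 2) (Fin 2) ℂ) (hh : M.IsHermitian)
      (_ : M = hMatrix h₁ h₂ φ ψ) (t : ℝ), (∃ i, hh.eigenvalues i = t) ↔ t = h₁ ∨ t = h₂ := by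
    intro h₁ h₂ φ ψ M hh hM t
    have h1 := hMatrix_charpoly h₁ h₂ φ ψ
    rw [← hM, hh.charpoly_eq] at h1
    have h2 := congrArg (Polynomial.eval (t : ℂ)) h1
    rw [Polynomial.eval_prod] at h2
    simp only [Polynomial.eval_mul, Polynomial.eval_sub, Polynomial.eval_X, Polynomial.eval_C] at h2
    have h3 : (∃ i, hh.eigenvalues i = t)
        ↔ (∏ i, ((t : ℂ) - (hh.eigenvalues i : ℂ))) = 0 := by
      rw [Finset.prod_eq_zero_iff]
      simp only [Finset.mem_univ, true_and, sub_eq_zero]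
      refine exists_congr fun i => ?_
      rw [eq_comm, Complex.ofReal_inj]
    rw [h3]
    erw [h2]
    rw [mul_eq_zero, sub_eq_zero, sub_eq_zero, Complex.ofReal_inj, Complex.ofReal_inj]
  constructor
  · rintro ⟨h₁, h₂, φ, ψ, ⟨b1, b2, -, -⟩, rfl⟩
    have hh : (hMatrix h₁ h₂ φ ψ).IsHermitian := by
      rw [← pauliMatrix_conePoint]; exact isHermitian_pauliMatrix _
    refine ⟨hh, fun i => ?_⟩
    rcases (key h₁ h₂ φ ψ _ hh rfl _).1 ⟨i, rfl⟩ with h | h <;> rw [h] <;> assumption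
  · rintro ⟨hh, hb⟩
    obtain ⟨x, rfl⟩ := exists_pauliMatrix_eq hh
    obtain ⟨φ, hφ, ψ, hψ, hx⟩ := exists_conePoint x
    have e := pauliMatrix_conePoint (x.1 + ‖x.2‖) (x.1 - ‖x.2‖) φ ψ
    rw [← hx] at e
    refine ⟨_, _, φ, ψ, ⟨?_, ?_, hφ, hψ⟩, e⟩
    · obtain ⟨i, hi⟩ := (key _ _ φ ψ _ hh e (x.1 + ‖x.2‖)).2 (Or.inl rfl)
      rw [← hi]; exact hb i
    · obtain ⟨i, hi⟩ := (key _ _ φ ψ _ hh e (x.1 - ‖x.2‖)).2 (Or.inr rfl)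
      rw [← hi]; exact hb i

theorem norm_snd_le_of_mem {r : ℝ} {x : R4} (hx : x ∈ doubleCone r) : ‖x.2‖ ≤ r := by
  have h1 : |x.1| + ‖x.2‖ ≤ r := hx
  linarith [abs_nonneg x.1]

/-- Interior points move along the axis, and boundary points off tips and rim lie on a segment from
a tip to the rim. A tip is extreme since equality must hold in the triangle inequality; a rim point
is extreme since the Euclidean norm is strictly convex. -/
theorem extremePoints_doubleCone {r : ℝ} (hr : 0 < r) :
    Set.extremePoints ℝ (doubleCone r) = tips r ∪ rim r := by
  ext x
  rw [mem_extremePoints]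
  constructor
  · rintro ⟨hx, hext⟩
    have hx' : |x.1| + ‖x.2‖ ≤ r := hx
    have heq : |x.1| + ‖x.2‖ = r := by
      by_contra hne
      have hlt : 0 < r - (|x.1| + ‖x.2‖) := sub_pos.2 (lt_of_le_of_ne hx' hne)
      set δ := r - (|x.1| + ‖x.2‖) with hδ
      -- The slack `δ` in the inequality permits a displacement by `±δ` along the axis.
      have hm : ∀ t : ℝ, |t| ≤ δ → ((x.1 + t, x.2) : R4) ∈ doubleCone r := by
        intro t ht
        change |x.1 + t| + ‖x.2‖ ≤ r
        have := abs_add_le x.1 t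
        linarith
      have h1 := hext _ (hm δ (by rw [abs_of_pos hlt])) _
        (hm (-δ) (by rw [abs_neg, abs_of_pos hlt])) ?_
      · have := congrArg Prod.fst h1.1
        simp at this
        linarith
      · refine ⟨1 / 2, 1 / 2, by norm_num, by norm_num, by norm_num, ?_⟩
        refine Prod.ext ?_ ?_
        · simp; ring
        · simp only [Prod.snd_add, Prod.smul_snd]
          rw [← add_smul]; norm_num
    by_cases h1 : x.1 = 0
    · right
      exact ⟨h1, by rw [h1, abs_zero, zero_add] at heq; exact heq⟩
    by_cases h2 : x.2 = 0
    · left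
      rw [h2, norm_zero, add_zero] at heq
      rcases (abs_eq hr.le).1 heq with h | h
      · exact Or.inl (Prod.ext h h2)
      · exact Or.inr (Prod.ext h h2)
    exfalso
    have hp1 : 0 < |x.1| := abs_pos.2 h1
    have hp2 : 0 < ‖x.2‖ := norm_pos_iff.2 h2
    -- The tip on the side of `x.1` and the rim point in the direction of `x.2` combine to `x` with
    -- weights `|x.1|/r` and `‖x.2‖/r`, which add up to 1.
    have hy : (((x.1 / |x.1|) * r, 0) : R4) ∈ doubleCone r := by
      change |(x.1 / |x.1|) * r| + ‖(0 : EuclideanSpace ℝ (Fin 3))‖ ≤ r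
      rw [abs_mul, abs_div, abs_abs, div_self hp1.ne', norm_zero, abs_of_pos hr]; simp
    have hz : ((0, (r / ‖x.2‖) • x.2) : R4) ∈ doubleCone r := by
      change |(0 : ℝ)| + ‖(r / ‖x.2‖) • x.2‖ ≤ r
      rw [norm_smul, Real.norm_of_nonneg (by positivity), div_mul_cancel₀ _ hp2.ne']; simp
    have h3 := hext _ hy _ hz ⟨|x.1| / r, ‖x.2‖ / r, by positivity, by positivity, ?_, ?_⟩
    · exact h2 (congrArg Prod.snd h3.1).symm
    · rw [← add_div, heq, div_self hr.ne']
    · refine Prod.ext ?_ ?_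
      · simp; field_simp
      · simp only [Prod.snd_add, Prod.smul_snd, smul_zero, zero_add, smul_smul]
        rw [show ‖x.2‖ / r * (r / ‖x.2‖) = 1 by field_simp, one_smul]
  · rintro (hx | ⟨h1, h2⟩)
    · have htip : ∀ s : ℝ, |s| = r → ∀ y ∈ doubleCone r, ∀ z ∈ doubleCone r,
          ((s, 0) : R4) ∈ openSegment ℝ y z → y = (s, 0) ∧ z = (s, 0) := by
        rintro s hs y hy z hz ⟨a, b, ha, hb, hab, h⟩
        have hy' : |y.1| + ‖y.2‖ ≤ r := hy
        have hz' : |z.1| + ‖z.2‖ ≤ r := hz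
        have h1 : a * y.1 + b * z.1 = s := congrArg Prod.fst h
        have hny := norm_nonneg y.2
        have hnz := norm_nonneg z.2
        have h2 : r ≤ a * |y.1| + b * |z.1| := by
          rw [← hs, ← h1]
          refine (abs_add_le _ _).trans_eq ?_
          rw [abs_mul, abs_mul, abs_of_pos ha, abs_of_pos hb]
        have h3 : a * |y.1| + a * ‖y.2‖ ≤ a * r := by nlinarith
        have h4 : b * |z.1| + b * ‖z.2‖ ≤ b * r := by nlinarith
        have h5 : a * r + b * r = r := by rw [← add_mul, hab, one_mul]
        have h6 : 0 ≤ a * ‖y.2‖ := by positivity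
        have h7 : 0 ≤ b * ‖z.2‖ := by positivity
        have hy2 : ‖y.2‖ = 0 := by
          have : a * ‖y.2‖ = 0 := by linarith
          exact (mul_eq_zero.1 this).resolve_left ha.ne'
        have hz2 : ‖z.2‖ = 0 := by
          have : b * ‖z.2‖ = 0 := by linarith
          exact (mul_eq_zero.1 this).resolve_left hb.ne'
        have hy1 : |y.1| ≤ r := by linarith
        have hz1 : |z.1| ≤ r := by linarith
        have hyz : y.1 = s ∧ z.1 = s := by
          rw [abs_le] at hy1 hz1
          have hab' : b = 1 - a := by linarith
          subst hab'
          rcases (abs_eq hr.le).1 hs with rfl | rfl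
          · constructor <;> nlinarith
          · constructor <;> nlinarith
        exact ⟨Prod.ext hyz.1 (norm_eq_zero.1 hy2), Prod.ext hyz.2 (norm_eq_zero.1 hz2)⟩
      rcases hx with rfl | rfl
      · refine ⟨?_, fun y hy z hz h => htip r (abs_of_pos hr) y hy z hz h⟩
        change |r| + ‖(0 : EuclideanSpace ℝ (Fin 3))‖ ≤ r
        rw [abs_of_pos hr]; simp
      · refine ⟨?_, fun y hy z hz h => htip (-r) (by rw [abs_neg, abs_of_pos hr]) y hy z hz h⟩
        change |-r| + ‖(0 : EuclideanSpace ℝ (Fin 3))‖ ≤ r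
        rw [abs_neg, abs_of_pos hr]; simp
    · refine ⟨?_, fun y hy z hz h => ?_⟩
      · change |x.1| + ‖x.2‖ ≤ r
        rw [h1, h2]; simp
      · have hyr := norm_snd_le_of_mem hy
        have hzr := norm_snd_le_of_mem hz
        obtain ⟨a, b, ha, hb, hab, h⟩ := h
        have hs : a • y.2 + b • z.2 = x.2 := congrArg Prod.snd h
        -- By strict convexity, a proper combination of distinct vectors in the ball has norm less
        -- than `r`. Once the `β` components agree with that of `x`, no room is left for `α`.
        have hyz : y.2 = z.2 := by
          by_contra hne
          have := norm_combo_lt_of_ne hyr hzr hne ha hb hab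
          rw [hs, h2] at this
          exact lt_irrefl _ this
        have hyx : y.2 = x.2 := by rw [← hs, ← hyz, ← add_smul, hab, one_smul]
        have hzx : z.2 = x.2 := by rw [← hyz, hyx]
        have hy' : |y.1| + ‖y.2‖ ≤ r := hy
        have hz' : |z.1| + ‖z.2‖ ≤ r := hz
        rw [hyx, h2] at hy'
        rw [hzx, h2] at hz'
        have hy1 : y.1 = 0 := abs_nonpos_iff.1 (by linarith)
        have hz1 : z.1 = 0 := abs_nonpos_iff.1 (by linarith)
        exact ⟨Prod.ext (hy1.trans h1.symm) hyx, Prod.ext (hz1.trans h1.symm) hzx⟩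

theorem pauliMatrix_eq_hMatrix_iff {h₁ h₂ φ ψ : ℝ} {x : R4} :
    pauliMatrix x = hMatrix h₁ h₂ φ ψ ↔ x = conePoint h₁ h₂ φ ψ := by
  rw [← pauliMatrix_conePoint, pauliMatrix_injective.eq_iff]

theorem conePoint_eq_tip_iff {h₁ h₂ φ ψ r : ℝ} :
    conePoint h₁ h₂ φ ψ = (r, 0) ↔ h₁ = r ∧ h₂ = r := by
  have h : (conePoint h₁ h₂ φ ψ).2 = 0 ↔ h₁ = h₂ := by
    rw [← norm_eq_zero, norm_conePoint_snd, abs_eq_zero]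
    constructor <;> intro h <;> linarith
  rw [Prod.ext_iff, h]
  change (h₁ + h₂) / 2 = r ∧ h₁ = h₂ ↔ _
  constructor
  · rintro ⟨h1, h2⟩; constructor <;> linarith
  · rintro ⟨h1, h2⟩; constructor <;> linarith

theorem conePoint_mem_rim_iff {h₁ h₂ φ ψ r : ℝ} (hr : 0 ≤ r) :
    conePoint h₁ h₂ φ ψ ∈ rim r ↔ (h₁ = r ∧ h₂ = -r) ∨ (h₁ = -r ∧ h₂ = r) := by
  change (h₁ + h₂) / 2 = 0 ∧ ‖(conePoint h₁ h₂ φ ψ).2‖ = r ↔ _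
  rw [norm_conePoint_snd, abs_eq hr]
  constructor
  · rintro ⟨h1, h2 | h2⟩
    · left; constructor <;> linarith
    · right; constructor <;> linarith
  · rintro (⟨h1, h2⟩ | ⟨h1, h2⟩)
    · exact ⟨by linarith, Or.inl (by linarith)⟩
    · exact ⟨by linarith, Or.inr (by linarith)⟩

/-- The extreme points of the double cone in terms of the eigenvalues. -/
theorem conePoint_mem_extremePoints_iff {h₁ h₂ φ ψ r : ℝ} (hr : 0 < r) :
    conePoint h₁ h₂ φ ψ ∈ Set.extremePoints ℝ (doubleCone r) ↔ |h₁| = r ∧ |h₂| = r := by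
  rw [extremePoints_doubleCone hr, Set.mem_union, conePoint_mem_rim_iff hr.le, tips,
    Set.mem_insert_iff, Set.mem_singleton_iff, conePoint_eq_tip_iff, conePoint_eq_tip_iff,
    abs_eq hr.le, abs_eq hr.le]
  tauto

/-! ### Fourier expansion of two-point functions -/

theorem hasSum_twoPoint {L : ℝ} (hL : 0 < L) {bc : BC} {ω : Functional L bc} (hω : IsState ω)
    (f g : OneParticle L) :
    HasSum (fun q : Fin 2 × ℤ => fourierCoefficient L (bc.mode q.2) (f q.1) *
      twoPoint ω (waves L bc q) g) (twoPoint ω f g) := by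
  have h := ((waveBasis hL bc).hasSum_repr f).mapL (twoPointLeft hL hω g)
  refine h.congr_fun fun q => ?_
  rw [map_smul, waveBasis_repr, coe_waveBasis]
  rfl

theorem HasZeroEnergy.mul_twoPoint_wave {L : ℝ} (hL : 0 < L) {bc : BC} {ω : Functional L bc}
    (h : HasZeroEnergy ω) {q : Fin 2 × ℤ} (hq : bc.mode q.2 ≠ 0) (f g : OneParticle L) :
    fourierCoefficient L (bc.mode q.2) (f q.1) * twoPoint ω (waves L bc q) g
      = modeWeight bc q * (fourierCoefficient L (bc.mode q.2) (f q.1) *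
        star (fourierCoefficient L (bc.mode q.2) (g q.1))) := by
  rw [h.twoPoint_wave_left hL hq, modeWeight, if_neg hq, ← inner_waves L bc q g, Complex.star_def,
    inner_conj_symm]
  split_ifs <;> simp

theorem HasZeroEnergy.twoPoint_antiperiodic {L : ℝ} (hL : 0 < L) {ω : Functional L .antiperiodic}
    (h : HasZeroEnergy ω) (f g : OneParticle L) :
    twoPoint ω f g = kernelSeries L .antiperiodic f g := by
  refine (hasSum_twoPoint hL h.isState f g).unique ?_
  refine (summable_kernelSeries hL .antiperiodic f g).hasSum.congr_fun fun q => ?_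
  exact h.mul_twoPoint_wave hL (BC.antiperiodic_mode_ne_zero _) f g

/-- The matrix of two-point functions of the zero modes. -/
def zeroModePair {L : ℝ} (ω : Functional L .periodic) (a b : Fin 2) : ℂ :=
  twoPoint ω (waves L .periodic (a, 0)) (waves L .periodic (b, 0))

@[simp] theorem periodic_mode (n : ℤ) : BC.periodic.mode n = n := rfl

theorem hasSum_zeroModes {F : Fin 2 × ℤ → ℂ} (hF : ∀ q, q.2 ≠ 0 → F q = 0) :
    HasSum F (∑ a, F (a, 0)) := by
  have h := hasSum_sum_of_ne_finset_zero (L := SummationFilter.unconditional _) (f := F)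
    (s := Finset.univ.map ⟨fun a : Fin 2 => (a, (0 : ℤ)), fun a b h => congrArg Prod.fst h⟩)
    (fun q hq => hF q fun h0 => hq (by
      rw [Finset.mem_map]; exact ⟨q.1, Finset.mem_univ _, Prod.ext rfl h0.symm⟩))
  rwa [Finset.sum_map] at h

/-- Zero modes are uncorrelated with modes of nonzero energy, so only zero modes survive in the
expansion of `g`. -/
theorem HasZeroEnergy.twoPoint_zero_left {L : ℝ} (hL : 0 < L) {ω : Functional L .periodic}
    (h : HasZeroEnergy ω) (a : Fin 2) (g : OneParticle L) :
    twoPoint ω (waves L .periodic (a, 0)) g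
      = ∑ b, zeroModePair ω a b * star (fourierCoefficient L 0 (g b)) := by
  rw [twoPoint_swap h.isState]
  have h1 := (hasSum_twoPoint hL h.isState g (waves L .periodic (a, 0))).unique
    (hasSum_zeroModes fun q hq => ?_)
  · rw [h1, star_sum]
    refine Finset.sum_congr rfl fun b _ => ?_
    rw [star_mul', mul_comm, zeroModePair, twoPoint_swap h.isState]
    simp
  · have hq' : BC.periodic.mode q.2 ≠ 0 := by simpa using hq
    rw [h.twoPoint_wave_left hL hq', (orthonormal_waves hL .periodic).2]
    · simp
    · rintro rfl; exact hq rfl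

theorem fourierCoefficient_zero (L : ℝ) (u : Lp ℂ 2 (circleMeasure L)) :
    fourierCoefficient L 0 u = ((1 / √L : ℝ) : ℂ) * ∫ x in Set.Icc 0 L, u x := by
  simp [fourierCoefficient]

/-- Modes of nonzero energy cancel against the kernel series. At the zero modes its weight 1/2
cancels the 1/2 in `hM`, and the factor `L` is absorbed by the two normalizations `1/√L`. -/
theorem HasZeroEnergy.twoPoint_periodic {L : ℝ} (hL : 0 < L) {ω : Functional L .periodic}
    (h : HasZeroEnergy ω) {M : Matrix (Fin 2) (Fin 2) ℂ}
    (hM : ∀ a b, zeroModePair ω a b = (if a = b then 1 / 2 else 0) + L * M a b)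
    (f g : OneParticle L) :
    twoPoint ω f g = kernelSeries L .periodic f g + zeroModeTerm L M f g := by
  have h1 := (hasSum_twoPoint hL h.isState f g).sub
    (summable_kernelSeries hL .periodic f g).hasSum
  have h2 := h1.unique (hasSum_zeroModes fun q hq => ?_)
  · refine (eq_add_of_sub_eq' h2).trans (congrArg (kernelSeries L .periodic f g + ·) ?_)
    have hw : ∀ a : Fin 2, modeWeight .periodic (a, 0) = 1 / 2 := by
      intro a; simp [modeWeight]
    have hr : (L : ℂ) * (((1 / √L : ℝ) : ℂ) * ((1 / √L : ℝ) : ℂ)) = 1 := by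
      have : L * ((1 / √L) * (1 / √L)) = 1 := by
        have := Real.sq_sqrt hL.le
        have h0 : √L ≠ 0 := (Real.sqrt_pos.2 hL).ne'
        field_simp; linarith
      exact_mod_cast this
    have hs : ∀ b, star (fourierCoefficient L 0 (g b))
        = ((1 / √L : ℝ) : ℂ) * ∫ y in Set.Icc 0 L, star (g b y) := by
      intro b; rw [star_fourierCoefficient]; simp [phase]
    simp only [periodic_mode, Int.cast_zero, h.twoPoint_zero_left hL, hw, hM, zeroModeTerm,
      Fin.sum_univ_two]
    simp only [hs]
    simp only [fourierCoefficient_zero, if_true, Fin.zero_eq_one_iff, Fin.one_eq_zero_iff, OfNat.ofNat_ne_one, if_false]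
    linear_combination (M 0 0 * (∫ x in Set.Icc 0 L, f 0 x) * (∫ y in Set.Icc 0 L, star (g 0 y))
      + M 0 1 * (∫ x in Set.Icc 0 L, f 0 x) * (∫ y in Set.Icc 0 L, star (g 1 y))
      + M 1 0 * (∫ x in Set.Icc 0 L, f 1 x) * (∫ y in Set.Icc 0 L, star (g 0 y))
      + M 1 1 * (∫ x in Set.Icc 0 L, f 1 x) * (∫ y in Set.Icc 0 L, star (g 1 y))) * hr
  · have hq' : BC.periodic.mode q.2 ≠ 0 := by simpa using hq
    rw [h.mul_twoPoint_wave hL hq', sub_self]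

/-- Quasi-free ground states are determined by their zero modes. -/
theorem HasZeroEnergy.ext {L : ℝ} (hL : 0 < L) {ω ω' : Functional L .periodic}
    (h : HasZeroEnergy ω) (h' : HasZeroEnergy ω') (hq : IsQuasiFree ω) (hq' : IsQuasiFree ω')
    (h0 : ∀ a b, zeroModePair ω a b = zeroModePair ω' a b) : ω = ω' := by
  refine (fieldMap_isCAR hL .periodic).quasiFree_ext h.isState h'.isState
    ((isQuasiFree_iff hL).1 hq) ((isQuasiFree_iff hL).1 hq') (h.twoPoint_ext hL h' ?_)
  rintro ⟨a, n⟩ ⟨b, m⟩ hn hm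
  have hn' : n = 0 := by simpa using hn
  have hm' : m = 0 := by simpa using hm
  subst hn' hm'
  exact h0 a b

/-! ### Zero-mode states -/

/-- Rotation of the zero modes by `W`. -/
def zeroRotation (W : Matrix (Fin 2) (Fin 2) ℂ) (n : ℤ) : Matrix (Fin 2) (Fin 2) ℂ :=
  if n = 0 then W else 1

theorem zeroRotation_mem {W : Matrix (Fin 2) (Fin 2) ℂ} (hW : W ∈ Matrix.unitaryGroup (Fin 2) ℂ)
    (n : ℤ) : zeroRotation W n ∈ Matrix.unitaryGroup (Fin 2) ℂ := by
  unfold zeroRotation; split_ifs; exacts [hW, one_mem _]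

/-- Plane waves with rotated zero modes. -/
def rotatedWaves (L : ℝ) (W : Matrix (Fin 2) (Fin 2) ℂ) : Fin 2 × ℤ → OneParticle L :=
  blockRotate (zeroRotation W) (waves L .periodic)

theorem rotatedWaves_of_ne (L : ℝ) (W : Matrix (Fin 2) (Fin 2) ℂ) {q : Fin 2 × ℤ} (hq : q.2 ≠ 0) :
    rotatedWaves L W q = waves L .periodic q := by
  obtain ⟨a, n⟩ := q
  simp only [rotatedWaves, blockRotate, zeroRotation, hq, if_false, Matrix.one_apply]
  simp

theorem rotatedWaves_zero (L : ℝ) (W : Matrix (Fin 2) (Fin 2) ℂ) (i : Fin 2) :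
    rotatedWaves L W (i, 0) = ∑ a, W i a • waves L .periodic (a, 0) := by
  simp [rotatedWaves, blockRotate, zeroRotation]

theorem orthonormal_rotatedWaves {L : ℝ} (hL : 0 < L) {W : Matrix (Fin 2) (Fin 2) ℂ}
    (hW : W ∈ Matrix.unitaryGroup (Fin 2) ℂ) : Orthonormal ℂ (rotatedWaves L W) :=
  Orthonormal.blockRotate (orthonormal_waves hL .periodic) (zeroRotation_mem hW)

theorem dense_rotatedWaves {L : ℝ} (hL : 0 < L) {W : Matrix (Fin 2) (Fin 2) ℂ}
    (hW : W ∈ Matrix.unitaryGroup (Fin 2) ℂ) :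
    (Submodule.span ℂ (Set.range (rotatedWaves L W))).topologicalClosure = ⊤ :=
  dense_blockRotate (dense_waves hL .periodic) (zeroRotation_mem hW)

/-- The modes that annihilate the vacuum in which the zero modes `0` and `1` are annihilated if
`i = 1` and `j = 1`, respectively, and their adjoints otherwise. -/
def vacuumModes (i j : Fin 2) : Set (Fin 2 × ℤ) :=
  {q | (q ∈ particleModes .periodic ∧ q.2 ≠ 0) ∨ (i = 1 ∧ q = (0, 0)) ∨ (j = 1 ∧ q = (1, 0))}

theorem exists_zeroModeVacuum {L : ℝ} (hL : 0 < L) {W : Matrix (Fin 2) (Fin 2) ℂ}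
    (hW : W ∈ Matrix.unitaryGroup (Fin 2) ℂ) (i j : Fin 2) :
    ∃ ω, IsVacuum (fieldMap hL .periodic) (rotatedWaves L W) (vacuumModes i j) ω :=
  (fieldMap_isCAR hL .periodic).exists_isVacuum (exists_isState L .periodic)
    (orthonormal_rotatedWaves hL hW) _

/-- The vacua with prescribed zero modes. -/
def zeroModeVacuum {L : ℝ} (hL : 0 < L) {W : Matrix (Fin 2) (Fin 2) ℂ}
    (hW : W ∈ Matrix.unitaryGroup (Fin 2) ℂ) (i j : Fin 2) : Functional L .periodic :=
  (exists_zeroModeVacuum hL hW i j).choose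

section ZeroMode

variable {L : ℝ} (hL : 0 < L) {W : Matrix (Fin 2) (Fin 2) ℂ}
  (hW : W ∈ Matrix.unitaryGroup (Fin 2) ℂ)

theorem isVacuum_zeroModeVacuum (i j : Fin 2) : IsVacuum (fieldMap hL .periodic)
    (rotatedWaves L W) (vacuumModes i j) (zeroModeVacuum hL hW i j) :=
  (exists_zeroModeVacuum hL hW i j).choose_spec

theorem IsVacuum.hasZeroEnergy_of_rotated {i j : Fin 2} {ω : Functional L .periodic}
    (h : IsVacuum (fieldMap hL .periodic) (rotatedWaves L W) (vacuumModes i j) ω) :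
    HasZeroEnergy ω := by
  refine ⟨h.isState, fun q hq hn => ?_, fun q hq hn => ?_⟩
  · have hn' : q.2 ≠ 0 := by simpa using hn
    have := h.annihilates q (Or.inl ⟨hq, hn'⟩)
    rwa [rotatedWaves_of_ne L W hn'] at this
  · have hn' : q.2 ≠ 0 := by simpa using hn
    have := h.star_annihilates q (by
      rintro (⟨h1, -⟩ | ⟨-, rfl⟩ | ⟨-, rfl⟩)
      · exact hq h1
      · exact hn' rfl
      · exact hn' rfl)
    rwa [rotatedWaves_of_ne L W hn'] at this

theorem HasZeroEnergy.mixture {w : Fin 2 → Fin 2 → Functional L .periodic}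
    (hw : ∀ i j, HasZeroEnergy (w i j)) {p₁ p₂ : ℝ} (h₁ : p₁ ∈ Set.Icc 0 1)
    (h₂ : p₂ ∈ Set.Icc 0 1) : HasZeroEnergy (mixture p₁ p₂ w) := by
  refine ⟨isState_mixture (fun i j => (hw i j).isState) h₁ h₂, fun q hq hn => ?_,
    fun q hq hn => ?_⟩
  · simp only [DiracCylinder.mixture, LinearMap.add_apply, LinearMap.smul_apply,
      (hw _ _).annihilates q hq hn]
    simp
  · simp only [DiracCylinder.mixture, LinearMap.add_apply, LinearMap.smul_apply,
      (hw _ _).star_annihilates q hq hn]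
    simp

/-- The four vacua differ by rank-one projections onto the rotated zero modes, as
`quasiFree_mixture` requires. -/
theorem modeProjection_vacuumModes (hL : 0 < L) (hW : W ∈ Matrix.unitaryGroup (Fin 2) ℂ) (i j : Fin 2) (f : OneParticle L) :
    modeProjection (rotatedWaves L W) (vacuumModes i j) f
      = modeProjection (rotatedWaves L W) (vacuumModes 0 0) f
        + (((i : ℕ) : ℂ) * inner ℂ (rotatedWaves L W (0, 0)) f) • rotatedWaves L W (0, 0)
        + (((j : ℕ) : ℂ) * inner ℂ (rotatedWaves L W (1, 0)) f) • rotatedWaves L W (1, 0) := by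
  have he := orthonormal_rotatedWaves hL hW
  have hd := dense_rotatedWaves hL hW
  have h1 : ∀ i, vacuumModes i 1 = insert (1, 0) (vacuumModes i 0) := by
    intro i; ext q; simp [vacuumModes]; tauto
  have h2 : vacuumModes 1 0 = insert (0, 0) (vacuumModes 0 0) := by
    ext q; simp [vacuumModes]; tauto
  have h3 : ∀ i, ((1 : Fin 2), (0 : ℤ)) ∉ vacuumModes i 0 := by intro i; simp [vacuumModes]
  have h4 : ((0 : Fin 2), (0 : ℤ)) ∉ vacuumModes 0 0 := by simp [vacuumModes]
  rcases Fin.exists_fin_two.1 ⟨i, rfl⟩ with rfl | rfl <;>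
    rcases Fin.exists_fin_two.1 ⟨j, rfl⟩ with rfl | rfl
  · simp
  · rw [h1, modeProjection_insert he hd (h3 _)]; simp
  · rw [h2, modeProjection_insert he hd h4]; simp
  · rw [h1, modeProjection_insert he hd (h3 _), h2, modeProjection_insert he hd h4]; simp

theorem quasiFree_mixture_vacua {w : Fin 2 → Fin 2 → Functional L .periodic}
    (hw : ∀ i j, IsVacuum (fieldMap hL .periodic) (rotatedWaves L W) (vacuumModes i j) (w i j))
    (hW : W ∈ Matrix.unitaryGroup (Fin 2) ℂ) (p₁ p₂ : ℝ) :
    QuasiFreeWith (fieldMap hL .periodic) (mixture p₁ p₂ w)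
      fun f g => inner ℂ g (modeProjection (rotatedWaves L W) (vacuumModes 0 0) f)
        + p₁ * (inner ℂ (rotatedWaves L W (0, 0)) f * inner ℂ g (rotatedWaves L W (0, 0)))
        + p₂ * (inner ℂ (rotatedWaves L W (1, 0)) f * inner ℂ g (rotatedWaves L W (1, 0))) := by
  refine quasiFree_mixture (G := fun f g =>
      inner ℂ g (modeProjection (rotatedWaves L W) (vacuumModes 0 0) f))
    (u₁ := fun f => inner ℂ (rotatedWaves L W (0, 0)) f)
    (v₁ := fun g => inner ℂ g (rotatedWaves L W (0, 0)))
    (u₂ := fun f => inner ℂ (rotatedWaves L W (1, 0)) f)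
    (v₂ := fun g => inner ℂ g (rotatedWaves L W (1, 0))) p₁ p₂ fun i j => ?_
  have h := (hw i j).quasiFree (fieldMap_isCAR hL .periodic) (orthonormal_rotatedWaves hL hW)
    (dense_rotatedWaves hL hW)
  convert h using 3 with f g
  rw [modeProjection_vacuumModes hL hW i j f, inner_add_right, inner_add_right, inner_smul_right,
    inner_smul_right, mul_assoc, mul_assoc]

theorem twoPoint_mixture_rotated {w : Fin 2 → Fin 2 → Functional L .periodic}
    (hw : ∀ i j, IsVacuum (fieldMap hL .periodic) (rotatedWaves L W) (vacuumModes i j) (w i j))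
    (hW : W ∈ Matrix.unitaryGroup (Fin 2) ℂ) (p₁ p₂ : ℝ) (i : Fin 2) (g : OneParticle L) :
    twoPoint (mixture p₁ p₂ w) (rotatedWaves L W (i, 0)) g
      = (![p₁, p₂] i : ℝ) * inner ℂ g (rotatedWaves L W (i, 0)) := by
  have h := (quasiFree_mixture_vacua hL hw hW p₁ p₂).twoPoint (rotatedWaves L W (i, 0)) g
  have he := orthonormal_rotatedWaves hL hW
  have h0 : (i, (0 : ℤ)) ∉ vacuumModes 0 0 := by simp [vacuumModes]
  rw [modeProjection_of_notMem he h0, orthonormal_iff_ite.1 he, orthonormal_iff_ite.1 he] at h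
  refine h.trans ?_
  fin_cases i <;> simp

/-- The right-hand side is the spectral decomposition `W† diag(p₁, p₂) W`: the rotated zero modes
diagonalize the two-point function. -/
theorem zeroModePair_mixture {w : Fin 2 → Fin 2 → Functional L .periodic}
    (hw : ∀ i j, IsVacuum (fieldMap hL .periodic) (rotatedWaves L W) (vacuumModes i j) (w i j))
    (hW : W ∈ Matrix.unitaryGroup (Fin 2) ℂ) {p₁ p₂ : ℝ}
    (h₁ : p₁ ∈ Set.Icc 0 1) (h₂ : p₂ ∈ Set.Icc 0 1) (a b : Fin 2) :
    zeroModePair (mixture p₁ p₂ w) a b = ∑ i, (![p₁, p₂] i : ℝ) * (star (W i a) * W i b) := by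
  have hs := isState_mixture (fun i j => (hw i j).isState) h₁ h₂
  have h1 : waves L .periodic (a, 0) = ∑ i, star (W i a) • rotatedWaves L W (i, 0) := by
    have hU : ∀ b, ∑ c, star (W c a) * W c b = if a = b then 1 else 0 := by
      intro b
      have h := congrFun (congrFun (Matrix.mem_unitaryGroup_iff'.1 hW) a) b
      rwa [Matrix.mul_apply, Matrix.one_apply] at h
    simp only [rotatedWaves_zero, Finset.smul_sum, smul_smul]
    rw [Finset.sum_comm]
    simp only [← Finset.sum_smul, hU, ite_smul, one_smul, zero_smul, Finset.sum_ite_eq,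
      Finset.mem_univ, if_true]
  change twoPointLeft hL hs (waves L .periodic (b, 0)) (waves L .periodic (a, 0)) = _
  rw [h1, map_sum]
  refine Finset.sum_congr rfl fun i _ => ?_
  rw [map_smul]
  change star (W i a) • twoPoint (mixture p₁ p₂ w) (rotatedWaves L W (i, 0)) _ = _
  have h2 : inner ℂ (waves L .periodic (b, 0)) (rotatedWaves L W (i, 0)) = W i b := by
    simp only [rotatedWaves_zero, inner_sum, inner_smul_right,
      orthonormal_iff_ite.1 (orthonormal_waves hL .periodic), Prod.mk.injEq, and_true]
    simp only [mul_ite, mul_one, mul_zero, Finset.sum_ite_eq, Finset.mem_univ, if_true]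
  rw [twoPoint_mixture_rotated hL hw hW, h2, smul_eq_mul]
  ring

end ZeroMode

/-! ### Pure states -/

/-- If a convex combination vanishes on a positive element, so does each component. Hence each
component is a vacuum for the same modes and equals `ω` by uniqueness. -/
theorem IsVacuum.isPure {L : ℝ} {hL : 0 < L} {bc : BC} {K : Type*} {e : K → OneParticle L}
    {σ : Set K} {ω : Functional L bc} (h : IsVacuum (fieldMap hL bc) e σ ω)
    (he : Orthonormal ℂ e) (hd : (Submodule.span ℂ (Set.range e)).topologicalClosure = ⊤) :
    IsPure ω := by
  have key : ∀ (ω₁ ω₂ : Functional L bc) (a b : ℝ), IsState ω₁ → IsState ω₂ → 0 < a → 0 < b →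
      a • ω₁ + b • ω₂ = ω → ω₁ = ω := by
    intro ω₁ ω₂ a b h1 h2 ha hb hab
    have hz : ∀ A : carAlgebra L bc, ω (star A * A) = 0 → ω₁ (star A * A) = 0 := by
      intro A hA
      have h3 : (a * (ω₁ (star A * A)).re + b * (ω₂ (star A * A)).re : ℝ) = 0 := by
        have := congrArg Complex.re hA
        rw [← hab] at this
        simpa using this
      have h4 := h1.re_nonneg A
      have h5 := h2.re_nonneg A
      have h6 : a * (ω₁ (star A * A)).re = 0 := by
        have := mul_nonneg ha.le h4
        have := mul_nonneg hb.le h5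
        linarith
      exact h1.eq_zero_of_re ((mul_eq_zero.1 h6).resolve_left ha.ne')
    refine IsVacuum.unique (hΨ := fieldMap_isCAR hL bc) (he := he) (hd := hd) (σ := σ)
      ⟨h1, fun k hk => hz _ (h.annihilates k hk), fun k hk => ?_⟩ h
    have := hz (star (fieldMap hL bc (e k))) (by rw [star_star]; exact h.star_annihilates k hk)
    rwa [star_star] at this
  refine mem_extremePoints.2 ⟨h.isState, fun ω₁ h1 ω₂ h2 ⟨a, b, ha, hb, _, hω⟩ =>
    ⟨key ω₁ ω₂ a b h1 h2 ha hb hω, key ω₂ ω₁ b a h2 h1 hb ha ?_⟩⟩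
  rw [add_comm]; exact hω

theorem IsPure.eq_of_convex_comb {L : ℝ} {bc : BC} {ω₁ ω₂ : Functional L bc} {p : ℝ}
    (h : IsPure ((p : ℂ) • ω₁ + ((1 - p : ℝ) : ℂ) • ω₂)) (h1 : IsState ω₁) (h2 : IsState ω₂)
    (hp : 0 < p) (hp' : p < 1) : ω₁ = ω₂ := by
  have h3 := (mem_extremePoints.1 h).2 ω₁ h1 ω₂ h2
    ⟨p, 1 - p, hp, sub_pos.2 hp', by ring, by ext A; simp⟩
  exact h3.1.trans h3.2.symm

theorem mixture_eq_left {A : Type*} [CStarAlgebra A] (p₁ p₂ : ℝ) (w : Fin 2 → Fin 2 → A →ₗ[ℂ] ℂ) :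
    mixture p₁ p₂ w = (p₁ : ℂ) • mixture 1 p₂ w + ((1 - p₁ : ℝ) : ℂ) • mixture 0 p₂ w := by
  simp [mixture]

theorem mixture_eq_right {A : Type*} [CStarAlgebra A] (p₁ p₂ : ℝ)
    (w : Fin 2 → Fin 2 → A →ₗ[ℂ] ℂ) :
    mixture p₁ p₂ w = (p₂ : ℂ) • mixture p₁ 1 w + ((1 - p₂ : ℝ) : ℂ) • mixture p₁ 0 w := by
  ext a
  simp [mixture]
  ring

/-- A probability strictly inside (0, 1) splits the state into those with probabilities 1 and 0,
which the two-point function of the rotated zero mode distinguishes. At the corners the mixture is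
one of the four vacua. -/
theorem isPure_mixture_iff {L : ℝ} (hL : 0 < L) {W : Matrix (Fin 2) (Fin 2) ℂ}
    {w : Fin 2 → Fin 2 → Functional L .periodic}
    (hw : ∀ i j, IsVacuum (fieldMap hL .periodic) (rotatedWaves L W) (vacuumModes i j) (w i j))
    (hW : W ∈ Matrix.unitaryGroup (Fin 2) ℂ) {p₁ p₂ : ℝ}
    (h₁ : p₁ ∈ Set.Icc 0 1) (h₂ : p₂ ∈ Set.Icc 0 1) :
    IsPure (mixture p₁ p₂ w) ↔ (p₁ = 0 ∨ p₁ = 1) ∧ (p₂ = 0 ∨ p₂ = 1) := by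
  have he := orthonormal_rotatedWaves hL hW
  have hd := dense_rotatedWaves hL hW
  have m0 : (0 : ℝ) ∈ Set.Icc 0 1 := by simp
  have m1 : (1 : ℝ) ∈ Set.Icc 0 1 := by simp
  have hst : ∀ {p q : ℝ}, p ∈ Set.Icc 0 1 → q ∈ Set.Icc 0 1 → IsState (mixture p q w) :=
    fun hp hq => isState_mixture (fun i j => (hw i j).isState) hp hq
  have h2p : ∀ (p q : ℝ) (i : Fin 2), twoPoint (mixture p q w) (rotatedWaves L W (i, 0))
      (rotatedWaves L W (i, 0)) = (![p, q] i : ℝ) := by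
    intro p q i
    rw [twoPoint_mixture_rotated hL hw hW, orthonormal_iff_ite.1 he]
    simp
  constructor
  · intro h
    constructor
    · by_contra hp
      rw [not_or] at hp
      rw [mixture_eq_left] at h
      have := h.eq_of_convex_comb (hst m1 h₂) (hst m0 h₂) (lt_of_le_of_ne h₁.1 (Ne.symm hp.1))
        (lt_of_le_of_ne h₁.2 hp.2)
      have h3 := h2p 1 p₂ 0
      rw [this, h2p] at h3
      simp at h3
    · by_contra hp
      rw [not_or] at hp
      rw [mixture_eq_right] at h
      have := h.eq_of_convex_comb (hst h₁ m1) (hst h₁ m0) (lt_of_le_of_ne h₂.1 (Ne.symm hp.1))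
        (lt_of_le_of_ne h₂.2 hp.2)
      have h3 := h2p p₁ 1 1
      rw [this, h2p] at h3
      simp at h3
  · rintro ⟨rfl | rfl, rfl | rfl⟩
    · simpa [mixture] using (hw 0 0).isPure he hd
    · simpa [mixture] using (hw 0 1).isPure he hd
    · simpa [mixture] using (hw 1 0).isPure he hd
    · simpa [mixture] using (hw 1 1).isPure he hd

/-! ### The family of quasi-free ground states -/

/-- The rotation to the eigenvectors of `hMatrix`. -/
def paramRotation (φ ψ : ℝ) : Matrix (Fin 2) (Fin 2) ℂ :=
  !![(Real.cos (ψ / 2) : ℂ), Real.sin (ψ / 2) * Complex.exp (Complex.I * φ);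
    -(Real.sin (ψ / 2) * Complex.exp (-(Complex.I * φ))), (Real.cos (ψ / 2) : ℂ)]

theorem star_exp_I_mul (φ : ℝ) :
    star (Complex.exp (Complex.I * φ)) = Complex.exp (-(Complex.I * φ)) := by
  rw [Complex.star_def, ← Complex.exp_conj]; simp

theorem star_exp_neg_I_mul (φ : ℝ) :
    star (Complex.exp (-(Complex.I * φ))) = Complex.exp (Complex.I * φ) := by
  rw [← star_exp_I_mul, star_star]

theorem exp_mul_exp_neg (z : ℂ) : Complex.exp z * Complex.exp (-z) = 1 := by
  rw [← Complex.exp_add]; simp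

theorem paramRotation_mem (φ ψ : ℝ) : paramRotation φ ψ ∈ Matrix.unitaryGroup (Fin 2) ℂ := by
  have hcs : (Real.sin (ψ / 2) : ℂ) ^ 2 + (Real.cos (ψ / 2) : ℂ) ^ 2 = 1 := by
    exact_mod_cast Real.sin_sq_add_cos_sq (ψ / 2)
  have he := exp_mul_exp_neg (Complex.I * φ)
  have hr : ∀ x : ℝ, star (x : ℂ) = x := Complex.conj_ofReal
  rw [Matrix.mem_unitaryGroup_iff, paramRotation]
  ext i j
  rw [Matrix.mul_apply, Fin.sum_univ_two, Matrix.star_apply, Matrix.star_apply]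
  fin_cases i <;> fin_cases j <;>
    simp only [Fin.zero_eta, Fin.mk_one, Matrix.of_apply, Matrix.cons_val', Matrix.cons_val_zero,
      Matrix.cons_val_one, Matrix.cons_val_fin_one, star_neg, star_mul', star_exp_I_mul,
      star_exp_neg_I_mul, hr]
  · rw [Matrix.one_apply_eq]; linear_combination (Real.sin (ψ / 2) : ℂ) ^ 2 * he + hcs
  · rw [Matrix.one_apply_ne (by decide)]; ring
  · rw [Matrix.one_apply_ne (by decide)]; ring
  · rw [Matrix.one_apply_eq]; linear_combination (Real.sin (ψ / 2) : ℂ) ^ 2 * he + hcs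

/-- The conjugated rows of the half-angle rotation are eigenvectors of `hMatrix`; with eigenvalues
`1/2 + L h₁` and `1/2 + L h₂` the spectral decomposition yields `1/2 + L h`. -/
theorem sum_paramRotation (L h₁ h₂ φ ψ : ℝ) (a b : Fin 2) :
    ∑ i, ((![1 / 2 + L * h₁, 1 / 2 + L * h₂] i : ℝ) : ℂ) *
      (star (paramRotation φ ψ i a) * paramRotation φ ψ i b)
      = (if a = b then 1 / 2 else 0) + L * hMatrix h₁ h₂ φ ψ a b := by
  have hcs : (Real.sin (ψ / 2) : ℂ) ^ 2 + (Real.cos (ψ / 2) : ℂ) ^ 2 = 1 := by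
    exact_mod_cast Real.sin_sq_add_cos_sq (ψ / 2)
  have he := exp_mul_exp_neg (Complex.I * φ)
  have hr : ∀ x : ℝ, star (x : ℂ) = x := Complex.conj_ofReal
  have hψ : ψ = 2 * (ψ / 2) := by ring
  have hc : (Real.cos ψ : ℂ) = 2 * (Real.cos (ψ / 2) : ℂ) ^ 2 - 1 := by
    conv_lhs => rw [hψ, Real.cos_two_mul]
    push_cast; ring
  have hs : (Real.sin ψ : ℂ) = 2 * Real.sin (ψ / 2) * Real.cos (ψ / 2) := by
    conv_lhs => rw [hψ, Real.sin_two_mul]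
    push_cast; ring
  rw [hMatrix_eq, hc, hs, paramRotation, Fin.sum_univ_two]
  push_cast at hcs
  fin_cases a <;> fin_cases b <;>
    simp only [Fin.zero_eta, Fin.mk_one, Matrix.of_apply, Matrix.cons_val', Matrix.cons_val_zero,
      Matrix.cons_val_one, Matrix.cons_val_fin_one, star_neg, star_mul', star_exp_I_mul,
      star_exp_neg_I_mul, hr] <;> push_cast
  · linear_combination ((1 / 2 + L * h₂) * Complex.sin (ψ / 2) ^ 2) * he + (1 / 2 + L * h₂) * hcs
  · ring
  · ring
  · linear_combination ((1 / 2 + L * h₁) * Complex.sin (ψ / 2) ^ 2) * he + (1 / 2 + L * h₁) * hcs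

/-- The quasi-free ground state with the parameters `h₁, h₂, φ, ψ`. -/
def paramState {L : ℝ} (hL : 0 < L) (h₁ h₂ φ ψ : ℝ) : Functional L .periodic :=
  mixture (1 / 2 + L * h₁) (1 / 2 + L * h₂) (zeroModeVacuum hL (paramRotation_mem φ ψ))

theorem half_add_mem_Icc {L h : ℝ} (hL : 0 < L) (hh : |h| ≤ 1 / (2 * L)) :
    1 / 2 + L * h ∈ Set.Icc (0 : ℝ) 1 := by
  have h1 : |L * h| ≤ 1 / 2 := by
    rw [abs_mul, abs_of_pos hL]
    calc L * |h| ≤ L * (1 / (2 * L)) := mul_le_mul_of_nonneg_left hh hL.le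
      _ = 1 / 2 := by field_simp
  rw [abs_le] at h1
  exact ⟨by linarith, by linarith⟩

section ParamState

variable {L : ℝ} (hL : 0 < L) {h₁ h₂ φ ψ : ℝ}

theorem hasZeroEnergy_paramState (hb₁ : |h₁| ≤ 1 / (2 * L)) (hb₂ : |h₂| ≤ 1 / (2 * L)) :
    HasZeroEnergy (paramState hL h₁ h₂ φ ψ) :=
  HasZeroEnergy.mixture (fun i j => (isVacuum_zeroModeVacuum hL _ i j).hasZeroEnergy_of_rotated)
    (half_add_mem_Icc hL hb₁) (half_add_mem_Icc hL hb₂)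

theorem isQuasiFree_paramState : IsQuasiFree (paramState hL h₁ h₂ φ ψ) :=
  (quasiFree_mixture_vacua hL (isVacuum_zeroModeVacuum hL _) (paramRotation_mem φ ψ) _ _).isQuasiFree

theorem zeroModePair_paramState (hb₁ : |h₁| ≤ 1 / (2 * L)) (hb₂ : |h₂| ≤ 1 / (2 * L))
    (a b : Fin 2) : zeroModePair (paramState hL h₁ h₂ φ ψ) a b
      = (if a = b then 1 / 2 else 0) + L * hMatrix h₁ h₂ φ ψ a b := by
  rw [← sum_paramRotation]
  exact zeroModePair_mixture hL (isVacuum_zeroModeVacuum hL _) (paramRotation_mem φ ψ)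
    (half_add_mem_Icc hL hb₁) (half_add_mem_Icc hL hb₂) a b

theorem isPure_paramState_iff (hb₁ : |h₁| ≤ 1 / (2 * L)) (hb₂ : |h₂| ≤ 1 / (2 * L)) :
    IsPure (paramState hL h₁ h₂ φ ψ) ↔ |h₁| = 1 / (2 * L) ∧ |h₂| = 1 / (2 * L) := by
  have h : ∀ h : ℝ, (1 / 2 + L * h = 0 ∨ 1 / 2 + L * h = 1) ↔ |h| = 1 / (2 * L) := by
    intro h
    rw [abs_eq (by positivity), or_comm]
    refine or_congr ?_ ?_
    · rw [eq_div_iff (by positivity)]; constructor <;> intro h <;> linarith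
    · rw [← neg_div, eq_div_iff (by positivity)]; constructor <;> intro h <;> linarith
  rw [paramState, isPure_mixture_iff hL (isVacuum_zeroModeVacuum hL _) (paramRotation_mem φ ψ)
    (half_add_mem_Icc hL hb₁) (half_add_mem_Icc hL hb₂), h, h]

end ParamState

open Classical in
/-- The quasi-free ground states as a function of the matrix `h`. -/
def groundFamily {L : ℝ} (hL : 0 < L) (h : Matrix (Fin 2) (Fin 2) ℂ) : Functional L .periodic :=
  -- The parameters of a matrix are not unique, for instance when `h₁ = h₂`. Any choice will do,
  -- because the matrix alone determines the quasi-free ground state; the value 0 for other matrices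
  -- is a mere default.
  if H : ∃ x : ℝ × ℝ × ℝ × ℝ, |x.1| ≤ 1 / (2 * L) ∧ |x.2.1| ≤ 1 / (2 * L) ∧
      h = hMatrix x.1 x.2.1 x.2.2.1 x.2.2.2 then
    paramState hL H.choose.1 H.choose.2.1 H.choose.2.2.1 H.choose.2.2.2
  else 0

theorem groundFamily_spec {L : ℝ} (hL : 0 < L) {h : Matrix (Fin 2) (Fin 2) ℂ} (hh : h ∈ hSet L) :
    HasZeroEnergy (groundFamily hL h) ∧ IsQuasiFree (groundFamily hL h) ∧
      ∀ a b, zeroModePair (groundFamily hL h) a b = (if a = b then 1 / 2 else 0) + L * h a b := by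
  obtain ⟨h₁, h₂, φ, ψ, hp, he⟩ := hh
  have H : ∃ x : ℝ × ℝ × ℝ × ℝ, |x.1| ≤ 1 / (2 * L) ∧ |x.2.1| ≤ 1 / (2 * L) ∧
      h = hMatrix x.1 x.2.1 x.2.2.1 x.2.2.2 := ⟨(h₁, h₂, φ, ψ), hp.1, hp.2.1, he⟩
  obtain ⟨hb₁, hb₂, he'⟩ := H.choose_spec
  rw [groundFamily, dif_pos H]
  refine ⟨hasZeroEnergy_paramState hL hb₁ hb₂, isQuasiFree_paramState hL, fun a b => ?_⟩
  rw [zeroModePair_paramState hL hb₁ hb₂, ← he']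

theorem eq_groundFamily {L : ℝ} (hL : 0 < L) {h : Matrix (Fin 2) (Fin 2) ℂ} (hh : h ∈ hSet L)
    {ω : Functional L .periodic} (hω : HasZeroEnergy ω) (hq : IsQuasiFree ω)
    (hp : ∀ a b, zeroModePair ω a b = (if a = b then 1 / 2 else 0) + L * h a b) :
    ω = groundFamily hL h := by
  obtain ⟨h1, h2, h3⟩ := groundFamily_spec hL hh
  exact hω.ext hL h1 hq h2 fun a b => by rw [hp, h3]

theorem groundFamily_hMatrix {L : ℝ} (hL : 0 < L) {h₁ h₂ φ ψ : ℝ} (hp : ParamRange L h₁ h₂ φ ψ) :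
    groundFamily hL (hMatrix h₁ h₂ φ ψ) = paramState hL h₁ h₂ φ ψ :=
  (eq_groundFamily hL ⟨h₁, h₂, φ, ψ, hp, rfl⟩ (hasZeroEnergy_paramState hL hp.1 hp.2.1)
    (isQuasiFree_paramState hL) (zeroModePair_paramState hL hp.1 hp.2.1)).symm

theorem injOn_groundFamily {L : ℝ} (hL : 0 < L) : Set.InjOn (groundFamily hL) (hSet L) := by
  intro h hh h' hh' heq
  ext a b
  have h1 := (groundFamily_spec hL hh).2.2 a b
  rw [heq, (groundFamily_spec hL hh').2.2 a b] at h1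
  have hLc : (L : ℂ) ≠ 0 := by exact_mod_cast hL.ne'
  exact (mul_left_cancel₀ hLc (add_left_cancel h1)).symm

/-- The zero modes of a state define a matrix in the allowed range. -/
theorem exists_mem_hSet {L : ℝ} (hL : 0 < L) {ω : Functional L .periodic} (hω : IsState ω) :
    ∃ h ∈ hSet L, ∀ a b, zeroModePair ω a b = (if a = b then 1 / 2 else 0) + L * h a b := by
  have hLc : (L : ℂ) ≠ 0 := by exact_mod_cast hL.ne'
  let M : Matrix (Fin 2) (Fin 2) ℂ := Matrix.of fun a b =>
    (zeroModePair ω a b - if a = b then 1 / 2 else 0) / L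
  have hM : ∀ a b, zeroModePair ω a b = (if a = b then 1 / 2 else 0) + L * M a b := by
    intro a b
    simp only [M, Matrix.of_apply]
    field_simp
    ring
  have hherm : M.IsHermitian := by
    ext a b
    rw [Matrix.conjTranspose_apply]
    simp only [M, Matrix.of_apply, star_div₀, star_sub, Complex.star_def, Complex.conj_ofReal]
    rw [← Complex.star_def, zeroModePair, ← twoPoint_swap hω, zeroModePair]
    by_cases hab : a = b
    · subst hab; simp
    · simp [hab, Ne.symm hab]
  obtain ⟨x, hx⟩ := exists_pauliMatrix_eq hherm
  obtain ⟨φ, hφ, ψ, hψ, hc⟩ := exists_conePoint x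
  generalize x.1 + ‖x.2‖ = h₁ at hc
  generalize x.1 - ‖x.2‖ = h₂ at hc
  rw [hc, pauliMatrix_conePoint] at hx
  refine ⟨M, ⟨h₁, h₂, φ, ψ, ?_, hx⟩, hM⟩
  have hW := paramRotation_mem φ ψ
  have he := orthonormal_rotatedWaves hL hW
  -- In the eigenbasis of `M` the diagonal two-point functions are the eigenvalues `1/2 + L h₁` and
  -- `1/2 + L h₂`.
  have key : ∀ i : Fin 2, twoPoint ω (rotatedWaves L (paramRotation φ ψ) (i, 0))
      (rotatedWaves L (paramRotation φ ψ) (i, 0)) = ((![1 / 2 + L * h₁, 1 / 2 + L * h₂] i : ℝ) : ℂ) := by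
    intro i
    have e1 : twoPoint ω (rotatedWaves L (paramRotation φ ψ) (i, 0))
        (rotatedWaves L (paramRotation φ ψ) (i, 0))
        = ∑ a, ∑ b, paramRotation φ ψ i a * star (paramRotation φ ψ i b) * zeroModePair ω a b := by
      change ω (fieldMap hL .periodic _ * star (fieldMap hL .periodic _)) = _
      rw [rotatedWaves_zero, map_sum, star_sum, Finset.sum_mul_sum, map_sum]
      refine Finset.sum_congr rfl fun a _ => ?_
      rw [map_sum]
      refine Finset.sum_congr rfl fun b _ => ?_
      rw [map_smul, map_smul, star_smul, smul_mul_smul_comm, map_smul, smul_eq_mul]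
      rfl
    rw [e1]
    simp only [hM, hx, ← sum_paramRotation]
    have h0 := sum_mul_star_of_unitary hW i 0
    have h1 := sum_mul_star_of_unitary hW i 1
    have h0' := sum_mul_star_of_unitary hW 0 i
    have h1' := sum_mul_star_of_unitary hW 1 i
    simp only [Fin.sum_univ_two] at h0 h1 h0' h1' ⊢
    generalize paramRotation φ ψ = W at *
    generalize 1 / 2 + L * h₁ = p at *
    generalize 1 / 2 + L * h₂ = q at *
    -- The fourfold products are regrouped into inner products of rows of `W`, to which unitarity
    -- applies.
    trans (p : ℂ) * ((W i 0 * star (W 0 0) + W i 1 * star (W 0 1)) *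
        (W 0 0 * star (W i 0) + W 0 1 * star (W i 1))) +
      (q : ℂ) * ((W i 0 * star (W 1 0) + W i 1 * star (W 1 1)) *
        (W 1 0 * star (W i 0) + W 1 1 * star (W i 1)))
    · simp only [Matrix.cons_val_zero, Matrix.cons_val_one, Matrix.cons_val_fin_one]
      ring
    · rw [h0, h1, h0', h1']
      fin_cases i <;> simp
  -- For a unit vector `ω(ψ ψ†)` and `ω(ψ† ψ)` are nonnegative and add up to 1, so each lies in [0,
  -- 1].
  have bound : ∀ {p : ℝ} {f : OneParticle L}, inner ℂ f f = (1 : ℂ) → twoPoint ω f f = (p : ℂ) →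
      0 ≤ p ∧ p ≤ 1 := by
    intro p f hf hp
    have h1 := twoPoint_add_swap hL hω f f
    have h2 := hω.re_nonneg (star (field L .periodic f))
    have h3 := hω.re_nonneg (field L .periodic f)
    have h4 : (ω (star (star (field L .periodic f)) * star (field L .periodic f))).re = p := by
      rw [star_star]
      exact congrArg Complex.re hp
    have h5 := congrArg Complex.re h1
    rw [hf, hp, Complex.add_re, Complex.ofReal_re, Complex.one_re] at h5
    exact ⟨by linarith, by linarith⟩
  have b : ∀ i : Fin 2, 0 ≤ ![1 / 2 + L * h₁, 1 / 2 + L * h₂] i ∧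
      ![1 / 2 + L * h₁, 1 / 2 + L * h₂] i ≤ 1 := fun i =>
    bound ((orthonormal_iff_ite.1 he _ _).trans (if_pos rfl)) (key i)
  have abs_bound : ∀ h : ℝ, 0 ≤ 1 / 2 + L * h ∧ 1 / 2 + L * h ≤ 1 → |h| ≤ 1 / (2 * L) := by
    rintro h ⟨h1, h2⟩
    rw [abs_le, ← neg_div, div_le_iff₀ (by positivity), le_div_iff₀ (by positivity)]
    constructor <;> linarith
  exact ⟨abs_bound _ (b 0), abs_bound _ (b 1), hφ, hψ⟩

/-! ### Occupation-number states of the zero modes -/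

theorem star_annihilate_single_of_mem {ι : Type} [LinearOrder ι] {i : ι} {S : Finset ι}
    (hi : i ∈ S) : star (annihilate i) (lp.single 2 S (1 : ℂ)) = 0 := by
  ext T
  rw [star_annihilate_apply, lp.single_apply, Pi.single_apply,
    if_neg (fun h : T.erase i = S => Finset.notMem_erase i T (h ▸ hi))]
  simp

theorem annihilate_single_of_notMem {ι : Type} [LinearOrder ι] {i : ι} {S : Finset ι}
    (hi : i ∉ S) : annihilate i (lp.single 2 S (1 : ℂ)) = 0 := by
  rw [annihilate_single, if_neg hi]

theorem blockRotate_star_blockRotate {N E : Type*} [AddCommGroup E] [Module ℂ E]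
    {U : N → Matrix (Fin 2) (Fin 2) ℂ} (hU : ∀ n, U n ∈ Matrix.unitaryGroup (Fin 2) ℂ)
    (e : Fin 2 × N → E) : blockRotate (fun n => star (U n)) (blockRotate U e) = e := by
  funext ⟨a, n⟩
  simp only [blockRotate, Finset.smul_sum, smul_smul]
  rw [Finset.sum_comm]
  have h1 : ∀ b, ∑ c, star (U n) a c * U n c b = if a = b then 1 else 0 := by
    intro b
    have h := congrFun (congrFun (Matrix.mem_unitaryGroup_iff'.1 (hU n)) a) b
    rwa [Matrix.mul_apply, Matrix.one_apply] at h
  simp only [← Finset.sum_smul, h1, ite_smul, one_smul, zero_smul, Finset.sum_ite_eq,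
    Finset.mem_univ, if_true]

theorem star_zeroModeMatrix_mem : star zeroModeMatrix ∈ Matrix.unitaryGroup (Fin 2) ℂ :=
  Unitary.star_mem zeroModeMatrix_mem

/-- The adjoint rotation undoes the mixing of the zero modes, so the rotated waves give back `a_0`
and `b_0†`. -/
theorem coe_fieldMap_rotatedWaves {L : ℝ} (hL : 0 < L) (q : Fin 2 × ℤ) :
    (fieldMap hL .periodic (rotatedWaves L (star zeroModeMatrix) q) : Op) = bareModes .periodic q := by
  have h1 : zeroRotation (star zeroModeMatrix) = fun n => star (mixing .periodic n) := by
    funext n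
    by_cases hn : n = 0 <;> simp [zeroRotation, mixing, hn]
  have h2 : (carAlgebra L .periodic).subtype.toLinearMap (fieldMap hL .periodic
      (rotatedWaves L (star zeroModeMatrix) q)) = bareModes .periodic q := by
    rw [rotatedWaves, map_blockRotate, map_blockRotate, h1]
    have h3 : (fun q => (carAlgebra L .periodic).subtype.toLinearMap
        (fieldMap hL .periodic (waves L .periodic q))) = blockRotate (mixing .periodic) (bareModes .periodic) := by
      funext q
      rw [← fockPsi_eq, ← coe_psi hL]
      rfl
    rw [h3, blockRotate_star_blockRotate (mixing_mem _)]
  exact h2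

/-- The configuration in which the particle zero mode is occupied if `i ≠ 1` and the antiparticle
zero mode is occupied if `j = 1`. -/
def zeroConfig (i j : Fin 2) : Finset Label :=
  (if i = 1 then ∅ else {toLex (0, 0)}) ∪ (if j = 1 then {toLex (1, 0)} else ∅)

theorem mem_zeroConfig {i j : Fin 2} {l : Label} :
    l ∈ zeroConfig i j ↔ (i ≠ 1 ∧ l = toLex (0, 0)) ∨ (j = 1 ∧ l = toLex (1, 0)) := by
  unfold zeroConfig
  by_cases hi : i = 1 <;> by_cases hj : j = 1 <;> simp [hi, hj]

/-- For `i = 1` the operator `a_0` annihilates, so the particle state is empty; for `j = 1` it is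
`b_0†` that annihilates, so the antiparticle state is filled. -/
theorem isVacuum_zeroConfig {L : ℝ} (hL : 0 < L) (i j : Fin 2) :
    IsVacuum (fieldMap hL .periodic) (rotatedWaves L (star zeroModeMatrix)) (vacuumModes i j)
      (vectorState L .periodic (configVector (zeroConfig i j))) := by
  have hA : ∀ q, (fieldMap hL .periodic (rotatedWaves L (star zeroModeMatrix) q) : Op)
      = bareModes .periodic q := coe_fieldMap_rotatedWaves hL
  have hne : ∀ k l : ℤ, (toLex ((0 : Fin 2), k) : Label) ≠ toLex ((1 : Fin 2), l) := by
    intro k l h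
    simpa using congrArg Prod.fst (toLex_inj.1 h)
  have h0 : (0, 0) ∈ particleModes .periodic := by simp [particleModes]
  have h1 : (1, 0) ∉ particleModes .periodic := by simp [particleModes]
  have hp : ∀ q ∈ particleModes .periodic, bareModes .periodic q = annihilate (toLex (0, q.2)) := by
    intro q hq
    have hq' := hq
    simp only [particleModes, Set.mem_ofPred_eq] at hq'
    rw [bareModes, if_pos hq, modeLabel, if_pos hq']
  have hn : ∀ q ∉ particleModes .periodic,
      bareModes .periodic q = star (annihilate (toLex (1, -q.2))) := by
    intro q hq
    have hq' := hq
    simp only [particleModes, Set.mem_ofPred_eq] at hq'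
    rw [bareModes, if_neg hq, modeLabel, if_neg hq']; rfl
  refine ⟨isState_vectorState _ _ (norm_configVector _), fun q hq => ?_, fun q hq => ?_⟩
  · rw [vectorState_star_mul_self, hA]
    suffices h : bareModes .periodic q (configVector (zeroConfig i j)) = 0 by rw [h]; simp
    rcases hq with ⟨hq, hq0⟩ | ⟨rfl, rfl⟩ | ⟨rfl, rfl⟩
    · rw [hp q hq]
      refine annihilate_single_of_notMem fun h => ?_
      rcases mem_zeroConfig.1 h with ⟨-, h⟩ | ⟨-, h⟩
      · exact hq0 (congrArg Prod.snd (toLex_inj.1 h))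
      · exact hne _ _ h
    · rw [hp _ h0]
      refine annihilate_single_of_notMem fun h => ?_
      rcases mem_zeroConfig.1 h with ⟨h, -⟩ | ⟨-, h⟩
      · exact h rfl
      · exact hne _ _ h
    · rw [hn _ h1]
      exact star_annihilate_single_of_mem (mem_zeroConfig.2 (Or.inr ⟨rfl, rfl⟩))
  · have hs := vectorState_star_mul_self L .periodic (configVector (zeroConfig i j))
      (star (fieldMap hL .periodic (rotatedWaves L (star zeroModeMatrix) q)))
    rw [star_star] at hs
    rw [hs]
    suffices h : star (bareModes .periodic q) (configVector (zeroConfig i j)) = 0 by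
      have h' : ((star (fieldMap hL .periodic (rotatedWaves L (star zeroModeMatrix) q)) :
        carAlgebra L .periodic) : Op) = star (bareModes .periodic q) := by rw [← hA]; rfl
      rw [h', h]; simp
    simp only [vacuumModes, Set.mem_ofPred_eq, not_or, not_and] at hq
    obtain ⟨hq1, hq2, hq3⟩ := hq
    by_cases hq : q ∈ particleModes .periodic
    · have hq0 := not_not.1 (hq1 hq)
      have : q = (0, 0) := by
        obtain ⟨a, n⟩ := q
        subst hq0
        rcases Fin.exists_fin_two.1 ⟨a, rfl⟩ with rfl | rfl
        · rfl
        · exact absurd hq h1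
      subst this
      rw [hp _ hq]
      exact star_annihilate_single_of_mem (mem_zeroConfig.2 (Or.inl ⟨fun h => hq2 h rfl, rfl⟩))
    · rw [hn q hq, star_star]
      refine annihilate_single_of_notMem fun h => ?_
      rcases mem_zeroConfig.1 h with ⟨-, h⟩ | ⟨hj, h⟩
      · exact hne _ _ h.symm
      · have h2 : q.2 = 0 := by simpa using congrArg Prod.snd (toLex_inj.1 h)
        obtain ⟨a, n⟩ := q
        subst h2
        rcases Fin.exists_fin_two.1 ⟨a, rfl⟩ with rfl | rfl
        · exact hq h0
        · exact hq3 hj rfl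

/-! ### Thermal states -/

theorem summable_exp_neg_mode {c : ℝ} (hc : 0 < c) :
    Summable fun n : ℤ => Real.exp (-(c * |BC.periodic.mode n|)) := by
  have h : Summable fun n : ℕ => Real.exp (-c) ^ n :=
    summable_geometric_of_lt_one (Real.exp_pos _).le (by simpa using hc)
  have h' : ∀ n : ℕ, Real.exp (-c) ^ n = Real.exp (-(c * n)) := by
    intro n; rw [← Real.exp_nat_mul]; ring_nf
  refine Summable.of_nat_of_neg ?_ ?_ <;> refine h.congr fun n => ?_ <;> rw [h'] <;> simp

theorem boltzmannWeight_eq_prod (L : ℝ) (bc : BC) (β : ℝ) (S : Finset Label) :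
    boltzmannWeight L bc β S
      = ∏ i ∈ S, Real.exp (-(β * (2 * Real.pi / L) * |bc.mode (ofLex i).2|)) := by
  rw [boltzmannWeight, configEnergy, Finset.mul_sum, Real.exp_sum]
  refine Finset.prod_congr rfl fun i _ => ?_
  ring_nf

/-- The weight of a configuration is a product over its occupied states, and such products are
summable over finite sets as soon as the one-particle weights are; the latter form geometric series
in `|n|`. -/
theorem summable_boltzmannWeight {L : ℝ} (hL : 0 < L) {β : ℝ} (hβ : 0 < β) :
    Summable (boltzmannWeight L .periodic β) := by
  have hc : 0 < β * (2 * Real.pi / L) := by positivity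
  have h1 : Summable fun i : Label =>
      Real.exp (-(β * (2 * Real.pi / L) * |BC.periodic.mode (ofLex i).2|)) := by
    rw [← (toLex : Fin 2 × ℤ ≃ Label).summable_iff]
    exact (summable_prod_of_nonneg fun _ => (Real.exp_pos _).le).2
      ⟨fun _ => summable_exp_neg_mode hc, Summable.of_finite⟩
  exact (summable_finsetProd_of_summable_nonneg (fun _ => (Real.exp_pos _).le) h1).congr
    fun S => (boltzmannWeight_eq_prod L .periodic β S).symm

theorem configEnergy_nonneg {L : ℝ} (hL : 0 < L) (bc : BC) (S : Finset Label) :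
    0 ≤ configEnergy L bc S :=
  Finset.sum_nonneg fun i _ => by positivity

theorem configEnergy_eq_zero_iff {L : ℝ} (hL : 0 < L) (S : Finset Label) :
    configEnergy L .periodic S = 0 ↔ S ⊆ {toLex (0, 0), toLex (1, 0)} := by
  have hpi : 2 * Real.pi / L ≠ 0 := by positivity
  rw [configEnergy, Finset.sum_eq_zero_iff_of_nonneg fun i _ => by positivity]
  refine forall_congr' fun i => ?_
  refine imp_congr_right fun _ => ?_
  obtain ⟨⟨a, n⟩, rfl⟩ := (toLex : Fin 2 × ℤ ≃ Label).surjective i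
  simp only [ofLex_toLex, mul_eq_zero, hpi, false_or, abs_eq_zero, periodic_mode,
    Int.cast_eq_zero, Finset.mem_insert, Finset.mem_singleton, toLex_inj, Prod.mk.injEq]
  fin_cases a <;> simp

/-- For β ≥ 1 the weights at β = 1 dominate. In the limit only configurations of zero energy
survive, those built from the two zero modes. -/
theorem tendsto_tsum_boltzmannWeight {L : ℝ} (hL : 0 < L) {c : Finset Label → ℂ} {C : ℝ}
    (hc : ∀ S, ‖c S‖ ≤ C) :
    Tendsto (fun β : ℝ => ∑' S, (boltzmannWeight L .periodic β S : ℂ) * c S) atTop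
      (𝓝 (∑ S ∈ ({toLex (0, 0), toLex (1, 0)} : Finset Label).powerset, c S)) := by
  have hsum : ∑ S ∈ ({toLex (0, 0), toLex (1, 0)} : Finset Label).powerset, c S
      = ∑' S, if S ⊆ ({toLex (0, 0), toLex (1, 0)} : Finset Label) then c S else 0 := by
    rw [tsum_eq_sum (s := ({toLex (0, 0), toLex (1, 0)} : Finset Label).powerset)]
    · exact Finset.sum_congr rfl fun S hS => (if_pos (Finset.mem_powerset.1 hS)).symm
    · exact fun S hS => if_neg fun h => hS (Finset.mem_powerset.2 h)
  rw [hsum]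
  refine tendsto_tsum_of_dominated_convergence
    (bound := fun S => boltzmannWeight L .periodic 1 S * C)
    ((summable_boltzmannWeight hL one_pos).mul_right C) (fun S => ?_) ?_
  · simp only [← configEnergy_eq_zero_iff hL]
    split_ifs with hS
    · simp only [boltzmannWeight, hS, mul_zero, Real.exp_zero, Complex.ofReal_one, one_mul]
      exact tendsto_const_nhds
    · have hpos := lt_of_le_of_ne (configEnergy_nonneg hL .periodic S) (Ne.symm hS)
      have h1 : Tendsto (fun β => boltzmannWeight L .periodic β S) atTop (𝓝 0) := by
        refine Real.tendsto_exp_atBot.comp ?_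
        simp only [neg_mul]
        exact tendsto_neg_atTop_atBot.comp (tendsto_id.atTop_mul_const hpos)
      have h2 := ((Complex.continuous_ofReal.tendsto 0).comp h1).mul_const (c S)
      simpa using h2
  · filter_upwards [eventually_ge_atTop 1] with β hβ S
    have hw : 0 ≤ boltzmannWeight L .periodic β S := (Real.exp_pos _).le
    rw [norm_mul, Complex.norm_real, Real.norm_of_nonneg hw]
    refine mul_le_mul ?_ (hc S) (norm_nonneg _) (Real.exp_pos _).le
    refine Real.exp_le_exp.2 ?_
    have := mul_le_mul_of_nonneg_right hβ (configEnergy_nonneg hL .periodic S)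
    linarith

theorem sum_powerset_zeroModes (c : Finset Label → ℂ) :
    ∑ S ∈ ({toLex (0, 0), toLex (1, 0)} : Finset Label).powerset, c S
      = c (zeroConfig 1 0) + c (zeroConfig 0 0) + c (zeroConfig 1 1) + c (zeroConfig 0 1) := by
  have h01 : (toLex (0, 0) : Label) ∉ ({toLex (1, 0)} : Finset Label) := by simp
  rw [Finset.sum_powerset_insert h01]
  have hp : ({toLex (1, 0)} : Finset Label).powerset = {∅, {toLex (1, 0)}} := by
    rw [← insert_empty_eq, Finset.powerset_insert]; rfl
  have hne : (∅ : Finset Label) ∉ ({{toLex (1, 0)}} : Finset (Finset Label)) := by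
    simp
  rw [hp, Finset.sum_insert hne, Finset.sum_insert hne, Finset.sum_singleton,
    Finset.sum_singleton]
  simp only [zeroConfig, if_true, Fin.zero_eq_one_iff, OfNat.ofNat_ne_one, if_false,
    Finset.empty_union, Finset.union_empty, insert_empty_eq]
  rw [← Finset.insert_eq]
  ring

theorem zero_mem_hSet {L : ℝ} (hL : 0 < L) : hMatrix 0 0 0 0 ∈ hSet L :=
  ⟨0, 0, 0, 0, ⟨by rw [abs_zero]; positivity, by rw [abs_zero]; positivity,
    ⟨le_rfl, by positivity⟩, ⟨le_rfl, by positivity⟩⟩, rfl⟩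

/-- Equal probabilities give `W† (1/2) W = 1/2` whatever the rotation `W`, which is the case `h =
0`. -/
theorem mixture_zeroConfig_eq {L : ℝ} (hL : 0 < L) :
    mixture (1 / 2) (1 / 2)
      (fun i j => vectorState L .periodic (configVector (zeroConfig i j)))
      = groundFamily hL (hMatrix 0 0 0 0) := by
  have hW := star_zeroModeMatrix_mem
  have hw := isVacuum_zeroConfig hL
  have hm : (1 / 2 : ℝ) ∈ Set.Icc (0 : ℝ) 1 := by norm_num
  refine eq_groundFamily hL (zero_mem_hSet hL)
    (HasZeroEnergy.mixture (fun i j => (hw i j).hasZeroEnergy_of_rotated) hm hm)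
    (quasiFree_mixture_vacua hL hw hW _ _).isQuasiFree fun a b => ?_
  rw [zeroModePair_mixture hL hw hW hm hm]
  have h := congrFun (congrFun (Matrix.mem_unitaryGroup_iff'.1 hW) a) b
  rw [Matrix.mul_apply, Matrix.one_apply, Fin.sum_univ_two] at h
  have h0 : hMatrix 0 0 0 0 a b = 0 := by
    rw [hMatrix_eq]; fin_cases a <;> fin_cases b <;> simp
  rw [h0, Fin.sum_univ_two]
  simp only [Matrix.star_apply (star zeroModeMatrix)] at h
  have h2 : (if a = b then (1 / 2 : ℂ) else 0) = 1 / 2 * (if a = b then 1 else 0) := by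
    split_ifs <;> simp
  rw [h2, ← h]
  simp only [Matrix.cons_val_zero, Matrix.cons_val_one, Matrix.cons_val_fin_one]
  push_cast
  ring

theorem tendsto_thermalExpectation {L : ℝ} (hL : 0 < L) (A : carAlgebra L .periodic) :
    Tendsto (fun β : ℝ => thermalExpectation L .periodic β A) atTop
      (𝓝 (groundFamily hL (hMatrix 0 0 0 0) A)) := by
  have h1 := tendsto_tsum_boltzmannWeight hL (C := ‖(A : Op)‖)
    (c := fun S => vectorState L .periodic (configVector S) A) (fun S => by
      change ‖(inner ℂ (configVector S) ((A : Op) (configVector S)) : ℂ)‖ ≤ _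
      refine (norm_inner_le_norm _ _).trans ?_
      rw [norm_configVector, one_mul]
      exact ((A : Op).le_opNorm _).trans (by rw [norm_configVector, mul_one]))
  -- The partition function tends to 4, the number of zero-energy configurations.
  have h2 := tendsto_tsum_boltzmannWeight hL (C := 1) (c := fun _ => 1) (by simp)
  rw [sum_powerset_zeroModes] at h1 h2
  have h3 := h1.div h2 (by norm_num)
  simp only [mul_one] at h3
  have h4 : ∀ β : ℝ, thermalExpectation L .periodic β A
      = (∑' S, (boltzmannWeight L .periodic β S : ℂ) * vectorState L .periodic (configVector S) A) /
        ∑' S, (boltzmannWeight L .periodic β S : ℂ) := by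
    intro β
    rw [thermalExpectation, Complex.ofReal_tsum]
    rfl
  have h5 : mixture (1 / 2) (1 / 2)
      (fun i j => vectorState L .periodic (configVector (zeroConfig i j))) A
      = (vectorState L .periodic (configVector (zeroConfig 1 0)) A
        + vectorState L .periodic (configVector (zeroConfig 0 0)) A
        + vectorState L .periodic (configVector (zeroConfig 1 1)) A
        + vectorState L .periodic (configVector (zeroConfig 0 1)) A) / (1 + 1 + 1 + 1) := by
    simp only [mixture, LinearMap.add_apply, LinearMap.smul_apply, smul_eq_mul]
    push_cast
    ring
  rw [← mixture_zeroConfig_eq hL, h5, funext h4]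
  exact h3

/-! ### The massive Dirac field -/

/-- The relativistic energy. -/
def relEnergy (m k : ℝ) : ℝ := √(k ^ 2 + m ^ 2)

theorem relEnergy_sq (m k : ℝ) : relEnergy m k ^ 2 = k ^ 2 + m ^ 2 := Real.sq_sqrt (by positivity)

theorem relEnergy_pos {m : ℝ} (hm : m ≠ 0) (k : ℝ) : 0 < relEnergy m k :=
  Real.sqrt_pos.2 (by positivity)

theorem relEnergy_add_pos {m : ℝ} (hm : m ≠ 0) (k : ℝ) : 0 < relEnergy m k + k := by
  have h : |k| < relEnergy m k := by
    rw [← Real.sqrt_sq_eq_abs]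
    refine Real.sqrt_lt_sqrt (sq_nonneg k) ?_
    have : 0 < m ^ 2 := by positivity
    linarith
  linarith [neg_abs_le k]

/-- The rows are the conjugates of the eigenvectors of `diracMatrix m k` of positive and of negative
energy. -/
def massRotation (m k : ℝ) : Matrix (Fin 2) (Fin 2) ℂ :=
  -- For `m = 0` the normalization can vanish, namely when `k ≤ 0`; the default 1 keeps the matrix
  -- unitary for all `m`.
  if m = 0 then 1 else
    ((1 / √(2 * relEnergy m k * (relEnergy m k + k)) : ℝ) : ℂ) •
      !![Complex.I * m, ((relEnergy m k + k : ℝ) : ℂ); ((relEnergy m k + k : ℝ) : ℂ), Complex.I * m]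

theorem star_massRotation_mul {m : ℝ} (hm : m ≠ 0) (k : ℝ) (i j a b : Fin 2) :
    star (massRotation m k i a) * massRotation m k j b =
      ((1 / (2 * relEnergy m k * (relEnergy m k + k)) : ℝ) : ℂ) *
      (star ((!![Complex.I * m, ((relEnergy m k + k : ℝ) : ℂ);
        ((relEnergy m k + k : ℝ) : ℂ), Complex.I * m] : Matrix (Fin 2) (Fin 2) ℂ) i a) *
      (!![Complex.I * m, ((relEnergy m k + k : ℝ) : ℂ);
        ((relEnergy m k + k : ℝ) : ℂ), Complex.I * m] : Matrix (Fin 2) (Fin 2) ℂ) j b) := by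
  have hE := relEnergy_pos hm k
  have hs := relEnergy_add_pos hm k
  have h1 : (1 / (2 * relEnergy m k * (relEnergy m k + k)) : ℝ)
      = 1 / √(2 * relEnergy m k * (relEnergy m k + k)) *
        (1 / √(2 * relEnergy m k * (relEnergy m k + k))) := by
    rw [div_mul_div_comm, one_mul, Real.mul_self_sqrt (by positivity)]
  rw [massRotation, if_neg hm, Matrix.smul_apply, Matrix.smul_apply, smul_eq_mul, smul_eq_mul,
    star_mul', Complex.star_def, Complex.conj_ofReal, ← Complex.star_def, h1, Complex.ofReal_mul]
  ring

/-- The products of the entries of `massRotation` that belong to the same eigenvector. -/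
theorem massRotation_dyads {m : ℝ} (hm : m ≠ 0) (k : ℝ) :
    (fun a b => star (massRotation m k 0 a) * massRotation m k 0 b) =
      (!![((relEnergy m k - k) / (2 * relEnergy m k) : ℂ), -(Complex.I * m) / (2 * relEnergy m k);
        Complex.I * m / (2 * relEnergy m k), (relEnergy m k + k) / (2 * relEnergy m k)] :
          Matrix (Fin 2) (Fin 2) ℂ) ∧
    (fun a b => star (massRotation m k 1 a) * massRotation m k 1 b) =
      (!![((relEnergy m k + k) / (2 * relEnergy m k) : ℂ), Complex.I * m / (2 * relEnergy m k);
        -(Complex.I * m) / (2 * relEnergy m k), (relEnergy m k - k) / (2 * relEnergy m k)] :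
          Matrix (Fin 2) (Fin 2) ℂ) := by
  have hE : (relEnergy m k : ℂ) ≠ 0 := by exact_mod_cast (relEnergy_pos hm k).ne'
  have hs : (relEnergy m k + k : ℂ) ≠ 0 := by exact_mod_cast (relEnergy_add_pos hm k).ne'
  have hsq : (relEnergy m k : ℂ) ^ 2 = k ^ 2 + m ^ 2 := by exact_mod_cast relEnergy_sq m k
  have hI := Complex.I_sq
  constructor <;> funext a b <;> rw [star_massRotation_mul hm] <;> push_cast <;>
    fin_cases a <;> fin_cases b <;> simp <;> field_simp
  all_goals linear_combination -(m : ℂ) ^ 2 * hI - hsq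

theorem massRotation_mem (m k : ℝ) : massRotation m k ∈ Matrix.unitaryGroup (Fin 2) ℂ := by
  by_cases hm : m = 0
  · rw [massRotation, if_pos hm]; exact one_mem _
  have hE : (relEnergy m k : ℂ) ≠ 0 := by exact_mod_cast (relEnergy_pos hm k).ne'
  obtain ⟨h0, h1⟩ := massRotation_dyads hm k
  rw [Matrix.mem_unitaryGroup_iff']
  ext a b
  rw [Matrix.mul_apply, Fin.sum_univ_two, Matrix.star_apply, Matrix.star_apply]
  refine (congrArg₂ (· + ·) (congrFun (congrFun h0 a) b) (congrFun (congrFun h1 a) b)).trans ?_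
  fin_cases a <;> fin_cases b <;> simp <;> field_simp <;> ring

theorem diracMatrix_eq {m : ℝ} (hm : m ≠ 0) (k : ℝ) (a b : Fin 2) :
    diracMatrix m k a b = relEnergy m k * (star (massRotation m k 0 a) * massRotation m k 0 b
      - star (massRotation m k 1 a) * massRotation m k 1 b) := by
  have hE : (relEnergy m k : ℂ) ≠ 0 := by exact_mod_cast (relEnergy_pos hm k).ne'
  obtain ⟨h0, h1⟩ := massRotation_dyads hm k
  refine Eq.trans ?_ (congrArg ((relEnergy m k : ℂ) * ·) (congrArg₂ (· - ·)
    (congrFun (congrFun h0 a) b) (congrFun (congrFun h1 a) b)).symm)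
  fin_cases a <;> fin_cases b <;> simp [diracMatrix] <;> field_simp <;> ring

/-- The one-particle eigenstates of the massive Dirac Hamiltonian. -/
def massiveWaves (L m : ℝ) : Fin 2 × ℤ → OneParticle L :=
  blockRotate (fun n : ℤ => massRotation m (2 * Real.pi * n / L)) (waves L .periodic)

theorem orthonormal_massiveWaves {L : ℝ} (hL : 0 < L) (m : ℝ) : Orthonormal ℂ (massiveWaves L m) :=
  Orthonormal.blockRotate (orthonormal_waves hL .periodic) fun _ => massRotation_mem _ _

theorem dense_massiveWaves {L : ℝ} (hL : 0 < L) (m : ℝ) :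
    (Submodule.span ℂ (Set.range (massiveWaves L m))).topologicalClosure = ⊤ :=
  dense_blockRotate (dense_waves hL .periodic) fun _ => massRotation_mem _ _

theorem IsCAR.map_add_swap {A H : Type*} [CStarAlgebra A] [NormedAddCommGroup H]
    [InnerProductSpace ℂ H] {Ψ : H →ₗ[ℂ] A} (hΨ : IsCAR Ψ) {ω : A →ₗ[ℂ] ℂ} (hω : IsState ω)
    {f : H} (hf : ‖f‖ = 1) : ω (Ψ f * star (Ψ f)) + ω (star (Ψ f) * Ψ f) = 1 := by
  have h := congrArg ω (hΨ.anti_star f f)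
  rw [map_add, map_smul, hω.1, smul_eq_mul, mul_one, inner_self_eq_norm_sq_to_K, hf] at h
  simpa using h

theorem map_star_massiveWaves_mul {L : ℝ} (hL : 0 < L) (m : ℝ) (ω : Functional L .periodic)
    (i : Fin 2) (n : ℤ) :
    ω (star (fieldMap hL .periodic (massiveWaves L m (i, n))) *
        fieldMap hL .periodic (massiveWaves L m (i, n)))
      = ∑ a, ∑ b, star (massRotation m (2 * Real.pi * n / L) i a) *
          massRotation m (2 * Real.pi * n / L) i b *
          ω (star (psi L .periodic a n) * psi L .periodic b n) := by
  rw [massiveWaves, map_blockRotate]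
  simp only [blockRotate, star_sum, star_smul, Finset.sum_mul_sum, map_sum, smul_mul_smul_comm,
    map_smul, smul_eq_mul]
  rfl

/-- Normal ordering through the anticommutation relations: for the negative-energy mode `-E ω(ψ† ψ)
+ E = E ω(ψ ψ†)`. Each term thus is `E > 0` times a sum of two nonnegative expectation values. -/
theorem massiveEnergy_term {L : ℝ} (hL : 0 < L) {m : ℝ} (hm : m ≠ 0) {ω : Functional L .periodic}
    (hω : IsState ω) (n : ℤ) :
    (∑ a : Fin 2, ∑ b : Fin 2, diracMatrix m (2 * Real.pi * n / L) a b *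
        ω (star (psi L .periodic a n) * psi L .periodic b n)) + relEnergy m (2 * Real.pi * n / L)
      = relEnergy m (2 * Real.pi * n / L) *
        (ω (star (fieldMap hL .periodic (massiveWaves L m (0, n))) *
            fieldMap hL .periodic (massiveWaves L m (0, n)))
          + ω (fieldMap hL .periodic (massiveWaves L m (1, n)) *
            star (fieldMap hL .periodic (massiveWaves L m (1, n))))) := by
  have h1 := (fieldMap_isCAR hL .periodic).map_add_swap hω
    ((orthonormal_massiveWaves hL m).1 (1, n))
  rw [eq_sub_of_add_eq h1, map_star_massiveWaves_mul, map_star_massiveWaves_mul]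
  simp only [diracMatrix_eq hm, Fin.sum_univ_two]
  ring

theorem massiveEnergy_eq_zero_iff {L : ℝ} (hL : 0 < L) {m : ℝ} (hm : m ≠ 0)
    {ω : Functional L .periodic} (hω : IsState ω) :
    massiveEnergy m ω = 0 ↔
      IsVacuum (fieldMap hL .periodic) (massiveWaves L m) {q | q.1 = 0} ω := by
  have hterm : ∀ n : ℤ, (∑ a : Fin 2, ∑ b : Fin 2, diracMatrix m (2 * Real.pi * n / L) a b *
        ω (star (psi L .periodic a n) * psi L .periodic b n)).re
      + √((2 * Real.pi * n / L) ^ 2 + m ^ 2) = relEnergy m (2 * Real.pi * n / L) *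
        ((ω (star (fieldMap hL .periodic (massiveWaves L m (0, n))) *
            fieldMap hL .periodic (massiveWaves L m (0, n)))).re
          + (ω (fieldMap hL .periodic (massiveWaves L m (1, n)) *
            star (fieldMap hL .periodic (massiveWaves L m (1, n))))).re) := by
    intro n
    have h := congrArg Complex.re (massiveEnergy_term hL hm hω n)
    rwa [Complex.add_re, Complex.ofReal_re, Complex.re_ofReal_mul, Complex.add_re] at h
  have hpos : ∀ q, 0 ≤ (ω (fieldMap hL .periodic (massiveWaves L m q) *
      star (fieldMap hL .periodic (massiveWaves L m q)))).re := by
    intro q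
    have := hω.re_nonneg (star (fieldMap hL .periodic (massiveWaves L m q)))
    rwa [star_star] at this
  rw [massiveEnergy, ENNReal.tsum_eq_zero]
  simp only [hterm, ENNReal.ofReal_eq_zero]
  constructor
  · intro h
    have h' : ∀ n : ℤ, _ := fun n => nonpos_of_mul_nonpos_right (h n) (relEnergy_pos hm _)
    refine ⟨hω, ?_, ?_⟩
    · rintro ⟨a, n⟩ rfl
      exact hω.eq_zero_of_re (by
        linarith [h' n, hpos (1, n), hω.re_nonneg (fieldMap hL .periodic (massiveWaves L m (0, n)))])
    · rintro ⟨a, n⟩ ha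
      obtain rfl : a = 1 := by
        rcases Fin.exists_fin_two.1 ⟨a, rfl⟩ with h | h
        · exact absurd h ha
        · exact h
      have := hω.eq_zero_of_re (a := star (fieldMap hL .periodic (massiveWaves L m (1, n)))) (by
        rw [star_star]
        linarith [h' n, hpos (1, n), hω.re_nonneg (fieldMap hL .periodic (massiveWaves L m (0, n)))])
      rwa [star_star] at this
  · intro h n
    rw [h.annihilates (0, n) rfl, h.star_annihilates (1, n) (by simp)]
    simp

theorem exists_massiveVacuum {L : ℝ} (hL : 0 < L) (m : ℝ) :
    ∃ ω, IsVacuum (fieldMap hL .periodic) (massiveWaves L m) {q | q.1 = 0} ω :=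
  (fieldMap_isCAR hL .periodic).exists_isVacuum (exists_isState L .periodic)
    (orthonormal_massiveWaves hL m) _

/-- The vacuum of the massive field. -/
def massiveVacuum {L : ℝ} (hL : 0 < L) (m : ℝ) : Functional L .periodic :=
  (exists_massiveVacuum hL m).choose

theorem isVacuum_massiveVacuum {L : ℝ} (hL : 0 < L) (m : ℝ) :
    IsVacuum (fieldMap hL .periodic) (massiveWaves L m) {q | q.1 = 0} (massiveVacuum hL m) :=
  (exists_massiveVacuum hL m).choose_spec

theorem isMassiveVacuum_iff {L : ℝ} (hL : 0 < L) {m : ℝ} (hm : m ≠ 0)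
    (ω : Functional L .periodic) : IsMassiveVacuum m ω ↔ ω = massiveVacuum hL m := by
  have hv := isVacuum_massiveVacuum hL m
  have h0 := (massiveEnergy_eq_zero_iff hL hm hv.isState).2 hv
  constructor
  · rintro ⟨h1, h2⟩
    have h3 := h2 _ hv.isState
    rw [h0] at h3
    exact ((massiveEnergy_eq_zero_iff hL hm h1).1 (le_antisymm h3 zero_le)).unique hv
      (fieldMap_isCAR hL .periodic) (orthonormal_massiveWaves hL m) (dense_massiveWaves hL m)
  · rintro rfl
    exact ⟨hv.isState, fun ω' _ => by rw [h0]; exact zero_le⟩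

/-- In the expansion into energy eigenmodes only the filled negative-energy mode contributes. -/
theorem IsVacuum.map_star_psi_mul {L : ℝ} {hL : 0 < L} {m : ℝ} {ω : Functional L .periodic}
    (h : IsVacuum (fieldMap hL .periodic) (massiveWaves L m) {q | q.1 = 0} ω) (a : Fin 2) (n : ℤ) :
    ω (star (psi L .periodic a n) * psi L .periodic a n)
      = star (massRotation m (2 * Real.pi * n / L) 1 a) *
        massRotation m (2 * Real.pi * n / L) 1 a := by
  have hU : ∀ n : ℤ, massRotation m (2 * Real.pi * n / L) ∈ Matrix.unitaryGroup (Fin 2) ℂ :=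
    fun _ => massRotation_mem _ _
  have h1 := congrFun (blockRotate_star_blockRotate hU
    (fun q => fieldMap hL .periodic (waves L .periodic q))) (a, n)
  have h2 : ∀ q, blockRotate (fun n : ℤ => massRotation m (2 * Real.pi * n / L))
      (fun q => fieldMap hL .periodic (waves L .periodic q)) q
      = fieldMap hL .periodic (massiveWaves L m q) := fun q => (map_blockRotate _ _ _ _).symm
  have h3 : psi L .periodic a n = fieldMap hL .periodic (waves L .periodic (a, n)) := rfl
  have h4 := (fieldMap_isCAR hL .periodic).map_add_swap h.isState
    ((orthonormal_massiveWaves hL m).1 (1, n))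
  rw [h.star_annihilates (1, n) (by simp), zero_add] at h4
  have h5 := h.annihilates (0, n) rfl
  rw [h3, ← h1, blockRotate, Fin.sum_univ_two, h2, h2, star_add, add_mul, mul_add, mul_add]
  simp only [star_smul, smul_mul_smul_comm, map_add, map_smul, smul_eq_mul, Matrix.star_apply,
    star_star, h4, h5, h.isState.mul_eq_zero h5, h.isState.star_mul_eq_zero h5]
  ring

theorem tendsto_occupation {k : ℝ} (hk : k ≠ 0) (s : ℝ) (hs : |k| + s = 0) :
    Tendsto (fun m : ℝ => (((relEnergy m k + s) / (2 * relEnergy m k) : ℝ) : ℂ)) (𝓝[>] 0) (𝓝 0) := by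
  have hc : Continuous fun m => relEnergy m k := by unfold relEnergy; fun_prop
  have h0 : relEnergy 0 k = |k| := by rw [relEnergy, ← Real.sqrt_sq_eq_abs]; simp
  have h1 : Tendsto (fun m => relEnergy m k) (𝓝[>] 0) (𝓝 |k|) := by
    rw [← h0]; exact (hc.tendsto 0).mono_left nhdsWithin_le_nhds
  have h2 := (h1.add_const s).div (h1.const_mul 2) (by positivity)
  rw [hs, zero_div] at h2
  exact (Complex.continuous_ofReal.tendsto 0).comp h2

/-- At zero momentum the eigenvectors of the Dirac matrix do not depend on `m > 0`. Up to a phase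
they are the zero modes unmixed by `zeroModeMatrix`. -/
theorem massRotation_zero {m : ℝ} (hm : 0 < m) (b : Fin 2) :
    massRotation m 0 0 b = Complex.I * star zeroModeMatrix 0 b ∧
      massRotation m 0 1 b = star zeroModeMatrix 1 b := by
  have hE : relEnergy m 0 = m := by rw [relEnergy]; simp [Real.sqrt_sq hm.le]
  have h1 : ((1 / √(2 * m * (m + 0)) : ℝ) : ℂ) * m = ((1 / √2 : ℝ) : ℂ) := by
    rw [← Complex.ofReal_mul]
    congr 1
    rw [add_zero, mul_assoc, Real.sqrt_mul (by norm_num), Real.sqrt_mul_self hm.le]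
    field_simp
  have h2 : ∀ x : ℝ, star (x : ℂ) = x := Complex.conj_ofReal
  simp only [massRotation, if_neg hm.ne', hE, zeroModeMatrix, Matrix.star_apply, Matrix.smul_apply,
    smul_eq_mul, star_mul', h2, ← h1]
  fin_cases b <;> simp <;> ring_nf <;> simp

theorem massiveWaves_zero {L m : ℝ} (hm : 0 < m) :
    massiveWaves L m (0, 0) = Complex.I • rotatedWaves L (star zeroModeMatrix) (0, 0) ∧
      massiveWaves L m (1, 0) = rotatedWaves L (star zeroModeMatrix) (1, 0) := by
  have h0 : 2 * Real.pi * ((0 : ℤ) : ℝ) / L = 0 := by simp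
  simp only [rotatedWaves_zero, massiveWaves, blockRotate, h0, Finset.smul_sum, smul_smul,
    (massRotation_zero hm _).1, (massRotation_zero hm _).2, and_self]

/-- The occupation numbers of the massless modes in the massive vacuum. -/
theorem massiveVacuum_occupation {L : ℝ} (hL : 0 < L) {m : ℝ} (hm : m ≠ 0) (a : Fin 2) (n : ℤ) :
    massiveVacuum hL m (star (psi L .periodic a n) * psi L .periodic a n)
        = (((relEnergy m (2 * Real.pi * n / L) + (if a = 0 then 1 else -1) * (2 * Real.pi * n / L)) /
          (2 * relEnergy m (2 * Real.pi * n / L)) : ℝ) : ℂ) ∧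
    massiveVacuum hL m (psi L .periodic a n * star (psi L .periodic a n))
        = (((relEnergy m (2 * Real.pi * n / L) - (if a = 0 then 1 else -1) * (2 * Real.pi * n / L)) /
          (2 * relEnergy m (2 * Real.pi * n / L)) : ℝ) : ℂ) := by
  have hv := isVacuum_massiveVacuum hL m
  have hE : (relEnergy m (2 * Real.pi * n / L) : ℂ) ≠ 0 := by
    exact_mod_cast (relEnergy_pos hm (2 * Real.pi * n / L)).ne'
  have h1 : massiveVacuum hL m (star (psi L .periodic a n) * psi L .periodic a n)
      = (((relEnergy m (2 * Real.pi * n / L) + (if a = 0 then 1 else -1) * (2 * Real.pi * n / L)) /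
          (2 * relEnergy m (2 * Real.pi * n / L)) : ℝ) : ℂ) := by
    rw [hv.map_star_psi_mul]
    refine (congrFun (congrFun (massRotation_dyads hm (2 * Real.pi * n / L)).2 a) a).trans ?_
    generalize 2 * Real.pi * n / L = k
    fin_cases a <;> simp [sub_eq_add_neg]
  refine ⟨h1, ?_⟩
  have h2 : massiveVacuum hL m (psi L .periodic a n * star (psi L .periodic a n))
      + massiveVacuum hL m (star (psi L .periodic a n) * psi L .periodic a n) = 1 :=
    (fieldMap_isCAR hL .periodic).map_add_swap hv.isState ((orthonormal_waves hL .periodic).1 (a, n))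
  rw [eq_sub_of_add_eq h2, h1]
  generalize 2 * Real.pi * n / L = k at *
  push_cast
  field_simp
  ring

/-- By `IsVacuum.tendsto` convergence of occupation numbers suffices. At nonzero momentum they tend
to the massless values as the relativistic energy tends to `|k|`; at zero momentum they are constant
in `m`. -/
theorem tendsto_massiveVacuum {L : ℝ} (hL : 0 < L) (A : carAlgebra L .periodic) :
    Tendsto (fun m => massiveVacuum hL m A) (𝓝[>] 0)
      (𝓝 (zeroModeVacuum hL star_zeroModeMatrix_mem 1 0 A)) := by
  have hpi : 0 < 2 * Real.pi / L := by positivity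
  have hk : ∀ n : ℤ, 2 * Real.pi * n / L = 2 * Real.pi / L * n := fun n => by ring
  have hk0 : ∀ {n : ℤ}, n ≠ 0 → 2 * Real.pi * n / L ≠ 0 := fun {n} hn => by
    rw [hk]; exact mul_ne_zero hpi.ne' (Int.cast_ne_zero.2 hn)
  have hpos : ∀ {n : ℤ}, 0 < n → |2 * Real.pi * n / L| = 2 * Real.pi * n / L := fun {n} hn =>
    abs_of_pos (by rw [hk]; exact mul_pos hpi (Int.cast_pos.2 hn))
  have hneg : ∀ {n : ℤ}, n < 0 → |2 * Real.pi * n / L| = -(2 * Real.pi * n / L) := fun {n} hn =>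
    abs_of_neg (by rw [hk]; exact mul_neg_of_pos_of_neg hpi (Int.cast_lt_zero.2 hn))
  refine (isVacuum_zeroModeVacuum hL star_zeroModeMatrix_mem 1 0).tendsto
    (fieldMap_isCAR hL .periodic) (orthonormal_rotatedWaves hL star_zeroModeMatrix_mem)
    (dense_rotatedWaves hL star_zeroModeMatrix_mem)
    (fun m => (isVacuum_massiveVacuum hL m).isState) ?_ ?_ A
  · rintro ⟨a, n⟩ (⟨hq, hn⟩ | ⟨-, hq⟩ | ⟨h, -⟩)
    · rw [rotatedWaves_of_ne _ _ hn]
      refine (tendsto_occupation (hk0 hn) ((if a = 0 then 1 else -1) * (2 * Real.pi * n / L)) ?_).congr'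
        (eventually_nhdsWithin_of_forall fun m hm =>
          ((massiveVacuum_occupation hL (ne_of_gt hm) a n).1).symm)
      simp only [particleModes, Set.mem_ofPred_eq, periodic_mode] at hq hn
      rcases hq with ⟨rfl, hq⟩ | ⟨rfl, hq⟩
      · rw [hneg (lt_of_le_of_ne (by exact_mod_cast hq) hn)]; simp
      · rw [hpos (by exact_mod_cast hq)]; simp
    · refine tendsto_const_nhds.congr' (eventually_nhdsWithin_of_forall fun m hm => ?_)
      have h := (isVacuum_massiveVacuum hL m).annihilates (0, 0) rfl
      -- The phase `i` multiplies the occupation number by 1 and drops out.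
      rw [(massiveWaves_zero hm).1, map_smul, star_smul, smul_mul_smul_comm, map_smul] at h
      rw [hq]
      simpa using h.symm
    · exact absurd h (by decide)
  · rintro ⟨a, n⟩ hq
    simp only [vacuumModes, Set.mem_ofPred_eq, not_or, not_and] at hq
    by_cases hn : n = 0
    · subst hn
      have ha : a = 1 := by
        rcases Fin.exists_fin_two.1 ⟨a, rfl⟩ with h | h
        · exact absurd (by rw [h]) (hq.2.1 trivial)
        · exact h
      subst ha
      refine tendsto_const_nhds.congr' (eventually_nhdsWithin_of_forall fun m hm => ?_)
      have h := (isVacuum_massiveVacuum hL m).star_annihilates (1, 0) (by simp)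
      rw [(massiveWaves_zero hm).2] at h
      exact h.symm
    · rw [rotatedWaves_of_ne _ _ hn]
      refine (tendsto_occupation (hk0 hn) (-((if a = 0 then 1 else -1) * (2 * Real.pi * n / L))) ?_).congr'
        (eventually_nhdsWithin_of_forall fun m hm => by
          rw [← sub_eq_add_neg]
          exact ((massiveVacuum_occupation hL (ne_of_gt hm) a n).2).symm)
      have hq' : (a, n) ∉ particleModes .periodic := fun h => hq.1 h hn
      simp only [particleModes, Set.mem_ofPred_eq, periodic_mode, not_or, not_and, not_le,
        not_lt] at hq'
      rcases Fin.exists_fin_two.1 ⟨a, rfl⟩ with rfl | rfl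
      · rw [hpos (by exact_mod_cast hq'.1 rfl)]; simp
      · rw [hneg (lt_of_le_of_ne (by exact_mod_cast hq'.2 rfl) hn)]; simp

theorem massless_mem_hSet {L : ℝ} (hL : 0 < L) :
    hMatrix (-(1 / (2 * L))) (1 / (2 * L)) (Real.pi / 2) (Real.pi / 2) ∈ hSet L := by
  have h : |1 / (2 * L)| ≤ 1 / (2 * L) := (abs_of_pos (by positivity)).le
  have hpi := Real.pi_pos
  exact ⟨_, _, _, _, ⟨by rwa [abs_neg], h, ⟨by positivity, by linarith⟩,
    ⟨by positivity, by linarith⟩⟩, rfl⟩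

/-- With probabilities 1 and 0 the zero-mode matrix is the projection `(1 + σ_y)/2` onto the
positive-energy eigenvector of the mass term, so `h = σ_y/(2L)`. -/
theorem zeroModeVacuum_eq_groundFamily {L : ℝ} (hL : 0 < L) :
    zeroModeVacuum hL star_zeroModeMatrix_mem 1 0 = groundFamily hL
      (hMatrix (-(1 / (2 * L))) (1 / (2 * L)) (Real.pi / 2) (Real.pi / 2)) := by
  have hW := star_zeroModeMatrix_mem
  have hw := isVacuum_zeroModeVacuum hL hW
  have hm : mixture 1 0 (zeroModeVacuum hL hW) = zeroModeVacuum hL hW 1 0 := by simp [mixture]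
  have hLc : (L : ℂ) ≠ 0 := by exact_mod_cast hL.ne'
  rw [← hm]
  refine eq_groundFamily hL (massless_mem_hSet hL)
    (HasZeroEnergy.mixture (fun i j => (hw i j).hasZeroEnergy_of_rotated) (by simp) (by simp))
    (quasiFree_mixture_vacua hL hw hW _ _).isQuasiFree fun a b => ?_
  rw [zeroModePair_mixture hL hw hW (by simp) (by simp), Fin.sum_univ_two]
  have h2 : ∀ x : ℝ, star (x : ℂ) = x := Complex.conj_ofReal
  have hexp : Complex.exp (Complex.I * ((Real.pi / 2 : ℝ) : ℂ)) = Complex.I := by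
    rw [mul_comm]; push_cast; exact Complex.exp_pi_div_two_mul_I
  have hexp' : Complex.exp (-(Complex.I * ((Real.pi / 2 : ℝ) : ℂ))) = -Complex.I := by
    rw [Complex.exp_neg, hexp, Complex.inv_I]
  have h3 := inv_sqrt_two_mul_self
  simp only [hMatrix_eq, hexp, hexp', Real.sin_pi_div_two, Real.cos_pi_div_two, zeroModeMatrix,
    Matrix.star_apply, Matrix.smul_apply, smul_eq_mul, star_mul', h2]
  generalize ((1 / √2 : ℝ) : ℂ) = r at *
  fin_cases a <;> fin_cases b <;> simp <;> field_simp
  · linear_combination 2 * h3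
  · linear_combination -4 * h3
  · linear_combination 4 * h3
  · linear_combination 2 * h3 - 2 * r ^ 2 * Complex.I_sq

end DiracCylinder

end

/-! ### The classification of quasi-free ground states, their limits and their parameter space -/

theorem theorem1 (L : ℝ) (hL : 0 < L) :
    -- antiperiodic boundary conditions: the unique quasi-free ground state
    (∃ ω : DiracCylinder.Functional L .antiperiodic,
      (∀ ω' : DiracCylinder.Functional L .antiperiodic,
        (DiracCylinder.IsGroundState ω' ∧ DiracCylinder.IsQuasiFree ω') ↔ ω' = ω) ∧
      ∀ f g : DiracCylinder.OneParticle L,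
        Tendsto (fun ε : ℝ => DiracCylinder.sinKernel L ε f g) (𝓝[>] 0)
          (𝓝 (DiracCylinder.twoPoint ω f g))) ∧
    -- periodic boundary conditions: the family of quasi-free ground states
    (∃ Ω : Matrix (Fin 2) (Fin 2) ℂ → DiracCylinder.Functional L .periodic,
      (∀ ω : DiracCylinder.Functional L .periodic,
        (DiracCylinder.IsGroundState ω ∧ DiracCylinder.IsQuasiFree ω) ↔
          ∃ h ∈ DiracCylinder.hSet L, ω = Ω h) ∧
      Set.InjOn Ω (DiracCylinder.hSet L) ∧
      (∀ h ∈ DiracCylinder.hSet L, ∀ f g : DiracCylinder.OneParticle L,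
        Tendsto (fun ε : ℝ => DiracCylinder.cotKernel L ε f g
            + DiracCylinder.zeroModeTerm L h f g) (𝓝[>] 0)
          (𝓝 (DiracCylinder.twoPoint (Ω h) f g))) ∧
      (∀ h ∈ DiracCylinder.hSet L, DiracCylinder.energy (Ω h) = 0) ∧
      -- pure and mixed states
      (∀ h₁ h₂ φ ψ : ℝ, DiracCylinder.ParamRange L h₁ h₂ φ ψ →
        (DiracCylinder.IsPure (Ω (DiracCylinder.hMatrix h₁ h₂ φ ψ)) ↔
          |h₁| = 1 / (2 * L) ∧ |h₂| = 1 / (2 * L))) ∧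
      (∀ x ∈ DiracCylinder.doubleCone (1 / (2 * L)),
        (DiracCylinder.IsPure (Ω (DiracCylinder.pauliMatrix x)) ↔
          x ∈ Set.extremePoints ℝ (DiracCylinder.doubleCone (1 / (2 * L))))) ∧
      -- zero-temperature limit of the thermal state
      (∀ β : ℝ, 0 < β → Summable (DiracCylinder.boltzmannWeight L .periodic β)) ∧
      (∀ A : DiracCylinder.carAlgebra L .periodic,
        Tendsto (fun β : ℝ => DiracCylinder.thermalExpectation L .periodic β A) atTop
          (𝓝 (Ω (DiracCylinder.hMatrix 0 0 0 0) A))) ∧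
      -- massless limit of the vacuum of the massive field
      (∃ Ωm : ℝ → DiracCylinder.Functional L .periodic,
        (∀ m : ℝ, 0 < m → ∀ ω : DiracCylinder.Functional L .periodic,
          DiracCylinder.IsMassiveVacuum m ω ↔ ω = Ωm m) ∧
        ∀ A : DiracCylinder.carAlgebra L .periodic,
          Tendsto (fun m : ℝ => Ωm m A) (𝓝[>] 0)
            (𝓝 (Ω (DiracCylinder.hMatrix (-(1 / (2 * L))) (1 / (2 * L))
              (Real.pi / 2) (Real.pi / 2)) A)))) ∧
    -- the parameter space: Hermitian matrices with bounded eigenvalues, forming a double cone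
    (∀ h : Matrix (Fin 2) (Fin 2) ℂ, h ∈ DiracCylinder.hSet L ↔
      ∃ hh : h.IsHermitian, ∀ i, |hh.eigenvalues i| ≤ 1 / (2 * L)) ∧
    (∀ h₁ h₂ φ ψ : ℝ, (DiracCylinder.hMatrix h₁ h₂ φ ψ).charpoly =
      (Polynomial.X - Polynomial.C (h₁ : ℂ)) * (Polynomial.X - Polynomial.C (h₂ : ℂ))) ∧
    Set.BijOn DiracCylinder.pauliMatrix (DiracCylinder.doubleCone (1 / (2 * L)))
      (DiracCylinder.hSet L) ∧
    Set.extremePoints ℝ (DiracCylinder.doubleCone (1 / (2 * L))) =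
      DiracCylinder.tips (1 / (2 * L)) ∪ DiracCylinder.rim (1 / (2 * L)) ∧
    (∀ (h₁ h₂ φ ψ : ℝ) (x : DiracCylinder.R4), DiracCylinder.ParamRange L h₁ h₂ φ ψ →
      DiracCylinder.pauliMatrix x = DiracCylinder.hMatrix h₁ h₂ φ ψ →
      ((x = (1 / (2 * L), 0) ↔ h₁ = 1 / (2 * L) ∧ h₂ = 1 / (2 * L)) ∧
       (x = (-(1 / (2 * L)), 0) ↔ h₁ = -(1 / (2 * L)) ∧ h₂ = -(1 / (2 * L))) ∧
       (x ∈ DiracCylinder.rim (1 / (2 * L)) ↔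
         (h₁ = 1 / (2 * L) ∧ h₂ = -(1 / (2 * L))) ∨
         (h₁ = -(1 / (2 * L)) ∧ h₂ = 1 / (2 * L))))) := by
  open DiracCylinder in
  refine ⟨?_, ⟨groundFamily hL, fun ω => ?_, injOn_groundFamily hL, fun h hh f g => ?_,
    fun h hh => ?_, fun h₁ h₂ φ ψ hp => ?_, fun x hx => ?_,
    fun β hβ => summable_boltzmannWeight hL hβ, tendsto_thermalExpectation hL,
    ⟨massiveVacuum hL, fun m hm => isMassiveVacuum_iff hL (ne_of_gt hm), fun A => ?_⟩⟩,
    mem_hSet_iff L, hMatrix_charpoly, bijOn_pauliMatrix L, extremePoints_doubleCone (by positivity),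
    fun h₁ h₂ φ ψ x hp hx => ?_⟩
  · obtain ⟨ω, hω⟩ := (fieldMap_isCAR hL .antiperiodic).exists_isVacuum
      (exists_isState L .antiperiodic) (orthonormal_waves hL .antiperiodic)
      (particleModes .antiperiodic)
    refine ⟨ω, fun ω' => ⟨fun h => ?_, ?_⟩, fun f g => ?_⟩
    · exact ((hasZeroEnergy_antiperiodic_iff hL).1 ((isGroundState_iff hL).1 h.1)).unique hω
        (fieldMap_isCAR hL _) (orthonormal_waves hL _) (dense_waves hL _)
    · rintro rfl
      exact ⟨(isGroundState_iff hL).2 hω.hasZeroEnergy,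
        (hω.quasiFree (fieldMap_isCAR hL _) (orthonormal_waves hL _) (dense_waves hL _)).isQuasiFree⟩
    · rw [hω.hasZeroEnergy.twoPoint_antiperiodic hL]
      simpa only [sinKernel_eq] using tendsto_regKernel hL .antiperiodic f g
  · constructor
    · rintro ⟨h1, h2⟩
      have h3 := (isGroundState_iff hL).1 h1
      -- Positivity of the state alone puts its zero-mode matrix into the allowed range.
      obtain ⟨h, hh, h4⟩ := exists_mem_hSet hL h3.isState
      exact ⟨h, hh, eq_groundFamily hL hh h3 h2 h4⟩
    · rintro ⟨h, hh, rfl⟩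
      obtain ⟨h1, h2, -⟩ := groundFamily_spec hL hh
      exact ⟨(isGroundState_iff hL).2 h1, h2⟩
  · obtain ⟨h1, -, h3⟩ := groundFamily_spec hL hh
    rw [h1.twoPoint_periodic hL h3]
    simpa only [cotKernel_eq] using (tendsto_regKernel hL .periodic f g).add_const _
  · have h1 := (groundFamily_spec hL hh).1
    exact (energy_eq_zero_iff hL h1.isState).2 h1
  · rw [groundFamily_hMatrix hL hp, isPure_paramState_iff hL hp.1 hp.2.1]
  -- Purity and extremality are both the condition that the two eigenvalues have modulus `1/(2L)`.
  · obtain ⟨φ, hφ, ψ, hψ, hc⟩ := exists_conePoint x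
    obtain ⟨hb₁, hb₂⟩ := mem_doubleCone_iff.1 hx
    rw [hc, pauliMatrix_conePoint, groundFamily_hMatrix hL ⟨hb₁, hb₂, hφ, hψ⟩,
      isPure_paramState_iff hL hb₁ hb₂, conePoint_mem_extremePoints_iff (by positivity)]
  · rw [← zeroModeVacuum_eq_groundFamily hL]
    exact tendsto_massiveVacuum hL A
  · obtain rfl := pauliMatrix_eq_hMatrix_iff.1 hx
    exact ⟨conePoint_eq_tip_iff, conePoint_eq_tip_iff, conePoint_mem_rim_iff (by positivity)⟩
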